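/- Let $K\subset\mathbb C$ be an imaginary quadratic number field with discriminant $D_K$ and ring of integers $\mathcal O_K$, and let $\mathfrak n(z)=z\bar z$. Fix $\alpha\in\,]0,\frac12[$. Let $\phi:\mathbb N\setminus\{0\}\to\,]0,+\infty[$ tend to $+\infty$, and assume that the limits $$\lambda=\lim_{N\to\infty}\frac{\phi(N)}{N^{1-\alpha}},\quad \lambda'=\lim_{N\to\infty}\frac{\phi(N)}{N^{1-\alpha/2}},\quad \lambda''=\lim_{N\to\infty}\frac{\phi(N)}{N},\quad \lambda'''=\lim_{N\to\infty}\frac{\phi(N)}{N^{1+\alpha/2}}$$ exist in $[0,+\infty]$. Let $\gamma\in\,]0,\frac{1-2\alpha}2[$ be such that $\lim_{N\to\infty}\phi(N)/N^{2-2\alpha-2\gamma}=0$. Let $\omega_K=\frac{i\sqrt{|D_K|}}2$ if $D_K\equiv0\pmod 4$ and $\omega_K=\frac{1+i\sqrt{|D_K|}}2$ otherwise, so that $(1,\omega_K)$ is a $\mathbb Z$-basis of $\mathcal O_K$. For $p=x_p+\omega_Ky_p\in\mathcal O_K\setminus\{0\}$ with $x_p,y_p\in\mathbb Z$, let $x'_p=2x_p+y_p(\omega_K+\overline{\omega_K})$,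 $y'_p=x_p(\omega_K+\overline{\omega_K})+2\mathfrak n(\omega_K)y_p$, $c'_p=\gcd(x'_p,y'_p)$, $v_p=\frac1{c'_p}(y'_p-\omega_Kx'_p)$, and for $k\in\mathbb N$ let $$S_{N,k}=\frac{|D_K|(k+1)}{4\pi}\sum_{p\in\mathcal O_K,\ 0<|p|\le N^\alpha}\frac{|p|^k}{c'_p|v_p|}.$$ For a renormalizing function $\psi$ with $\psi(N)>0$ for $N\geq1$, let $$\mathcal R_N=\frac1{\psi(N)}\sum_{a,b\in\mathbb N,\ a\ne b,\ 0<a,b\le N^2} r_{K,\alpha}(a,b,N)\,\Delta_{\phi(N)(\ln a-\ln b)},$$ where $r_{K,\alpha}(a,b,N)=\mathrm{Card}\{(w,z)\in\mathcal O_K^2:\mathfrak n(w)=a,\ \mathfrak n(z)=b,\ \mathfrak n(z-w)\le N^{2\alpha}\}$ and $\Delta_x$ is the unit Dirac mass at $x$. If $\lambda\in\,]0,+\infty[$, let $\rho:\mathbb R\to[0,+\infty[$ be the even function with $\rho(0)=\frac{8\pi}{3|D_K|}$, $$\rho(t)=\frac{8\pi\lambda^3}{|D_K|t^3}\Big(\arcsin\frac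 t{2\lambda}-\frac t{2\lambda}\Big(1-\frac{t^2}{2\lambda^2}\Big)\Big(1-\frac{t^2}{4\lambda^2}\Big)^{1/2}\Big)\ \text{ if }0<t\le2\lambda,\qquad \rho(t)=\frac{4\pi^2\lambda^3}{|D_K|t^3}\ \text{ if }t>2\lambda.$$ Let $m=\frac{4\pi^2}{|D_K|}\Delta_0$ if $\lambda=0$, $m=\rho\,\mathrm{Leb}_{\mathbb R}$ if $\lambda\in\,]0,+\infty[$, and $m=\frac{8\pi}{3|D_K|}\mathrm{Leb}_{\mathbb R}$ if $\lambda=+\infty$. **Theorem 4.1.** For all $A\ge1$ and all $f\in C^1_c(\mathbb R)$ with support in $[-A,A]$, as $N\to+\infty$, we have $\mathcal R_N(f)=\int_{\mathbb R}f\,dm+E_N$ in each of the following cases, where the implied constants, and the integer from which the estimates hold, depend only on $K,\alpha,\phi,\gamma$ (not on $A$ and $f$). 1. If $\lambda=0$ and $\psi(N)=N^2S_{N,1}$, then $$E_N=O\Big(\Big(\frac{\phi(N)}{N^{1-\alpha}}\Big)^{1/2}\|f'\|_\infty\Big)+O\Big(\max\Big\{\frac{\phi(N)}{N^{1-\alpha}},\frac1{N^{2\gamma}}\Big\}\|f\|_\infty\Big).$$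 2. If $\lambda\in\,]0,+\infty[$, $D_K\equiv0\pmod4$ and $\psi(N)=\frac{N^{3+\alpha}}{\phi(N)}$, then, with $\delta_N=\big|\frac{N^{1-\alpha}}{\phi(N)}-\frac1\lambda\big|$ and the convention that $\delta_N^{1/2}|\ln\delta_N|=0$ if $\delta_N=0$, $$E_N=O\big(N^{-\alpha}\|f'\|_\infty\big)+O\Big(\max\Big\{\frac A{N^{\alpha/4}},\frac1{N^{2\gamma}}\Big\}\|f\|_\infty\Big)+O\big(A\,\delta_N^{1/2}|\ln\delta_N|\,\|f\|_\infty\big).$$ 3. If $\lambda=+\infty$, $\lambda'<+\infty$, $\alpha<\frac25$ and $\psi(N)=\frac{N^3S_{N,0}}{\phi(N)}$, then $$E_N=O\big(N^{\frac{5\alpha-2}4}\|f'\|_\infty\big)+O\Big(\max\Big\{A^3\Big(\frac{N^{1-\alpha}}{\phi(N)}\Big)^{2/3},N^{\frac{5\alpha-2}4}\Big\}\|f\|_\infty\Big).$$ 4. If $\lambda'=+\infty$, $\lambda''=0$, $\alpha\le\frac2{11}$ and $\psi(N)=\frac{N^3S_{N,0}}{\phi(N)}$, then $$E_N=O\Big(\frac{\phi(N)}{N^{1+\alpha/2}}\|f'\|_\infty+\frac{N^{1-\alpha/2}}{\phi(N)}A^3\|f\|_\infty\Big).$$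 5. If $\lambda''>0$, $\lambda'''=0$, $\alpha\le\frac2{11}$ and $\psi(N)=\frac{N^3S_{N,0}}{\phi(N)}$, then $$E_N=O\Big(\frac{\phi(N)}{N^{1+\alpha/2}}\big(\|f'\|_\infty+A^3\|f\|_\infty\big)\Big).$$ -/

import Mathlib

open Real Set Filter Topology MeasureTheory NumberField
open scoped ENNReal

noncomputable section

namespace PairCorr

/-! ## The field

`K` is an imaginary quadratic number field with discriminant `D_K = discr K`, seen inside `ℂ`
through an embedding `σ`; then `𝔫(z) = z * conj z = Complex.normSq z` and `|z| = ‖z‖`. -/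

section Field

variable (K : Type*) [Field K] [NumberField K]

/-- The absolute value `|D_K|` of the discriminant, as a real number. -/
def absDisc : ℝ := |(discr K : ℝ)|

open Classical in
/-- The second element `ω_K` of the usual `ℤ`-basis `(1, ω_K)` of `𝓞 K` in `ℂ`:
`i √|D_K| / 2` if `D_K ≡ 0 mod 4`, and `(1 + i √|D_K|) / 2` otherwise. -/
def omega : ℂ :=
  if 4 ∣ discr K then Complex.I * (√(absDisc K) : ℂ) / 2
  else (1 + Complex.I * (√(absDisc K) : ℂ)) / 2

open Classical in
/-- The trace `ω_K + conj ω_K`, which is an integer. -/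
def traceOmega : ℤ := if 4 ∣ discr K then 0 else 1

open Classical in
/-- The norm `ω_K * conj ω_K`, which is an integer (both divisions are exact). -/
def normOmega : ℤ := if 4 ∣ discr K then |discr K| / 4 else (1 + |discr K|) / 4

/-- The point `x + ω_K y` of the lattice `ℤ + ω_K ℤ`. -/
def latticePoint (c : ℤ × ℤ) : ℂ := (c.1 : ℂ) + omega K * (c.2 : ℂ)

variable {K} (σ : K →+* ℂ)

/-- The integral coordinates `(x_p, y_p)` of `p = x_p + ω_K y_p` (the map `latticePoint K` is
injective and its image is the image of `𝓞 K`). -/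
def coords (p : 𝓞 K) : ℤ × ℤ := Function.invFun (latticePoint K) (σ p)

/-- `x'_p = 2 x_p + y_p tr(ω_K)`. -/
def xPrime (p : 𝓞 K) : ℤ := 2 * (coords σ p).1 + (coords σ p).2 * traceOmega K

/-- `y'_p = x_p tr(ω_K) + 2 𝔫(ω_K) y_p`. -/
def yPrime (p : 𝓞 K) : ℤ := (coords σ p).1 * traceOmega K + 2 * normOmega K * (coords σ p).2

/-- `c'_p`, the greatest common divisor of `x'_p` and `y'_p`. -/
def cPrime (p : 𝓞 K) : ℕ := Int.gcd (xPrime σ p) (yPrime σ p)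

/-- `v_p = (y'_p - ω_K x'_p) / c'_p`. -/
def vVec (p : 𝓞 K) : ℂ := ((yPrime σ p : ℂ) - omega K * (xPrime σ p : ℂ)) / (cPrime σ p : ℂ)

/-- `S_{N,k} = (|D_K| (k+1) / (4π)) ∑_{p ∈ 𝓞 K, 0 < |p| ≤ N^α} |p|^k / (c'_p |v_p|)`
(a finite sum). -/
def S (α : ℝ) (k N : ℕ) : ℝ :=
  absDisc K * (k + 1) / (4 * π) *
    ∑ᶠ p ∈ {p : 𝓞 K | 0 < ‖σ p‖ ∧ ‖σ p‖ ≤ (N : ℝ) ^ α}, ‖σ p‖ ^ k / (cPrime σ p * ‖vVec σ p‖)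

/-- The number of pairs `(w, z)` of elements of `𝓞 K` with `𝔫(w) = a`, `𝔫(z) = b` and
`𝔫(z - w) ≤ N^{2α}` (a finite set if `a, b` are given). -/
def repCount (α : ℝ) (a b N : ℕ) : ℕ :=
  Set.ncard {wz : 𝓞 K × 𝓞 K | Complex.normSq (σ wz.1) = a ∧ Complex.normSq (σ wz.2) = b ∧
    Complex.normSq (σ wz.2 - σ wz.1) ≤ (N : ℝ) ^ (2 * α)}

/-- The empirical pair correlation measure with scaling `φ` and renormalization `ψ`:
`ℛ_N = (1/ψ(N)) ∑_{a ≠ b, 0 < a, b ≤ N²} r_{K,α}(a, b, N) Δ_{φ(N) (ln a - ln b)}`. -/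
def empirical (α : ℝ) (φ ψ : ℕ → ℝ) (N : ℕ) : Measure ℝ :=
  ENNReal.ofReal (1 / ψ N) •
    ∑ a ∈ Finset.Icc 1 (N ^ 2), ∑ b ∈ (Finset.Icc 1 (N ^ 2)).filter (fun b => a ≠ b),
      (repCount σ α a b N : ℝ≥0∞) • Measure.dirac (φ N * (Real.log a - Real.log b))

variable (K)

/-- The even density attached to the finite positive limit `l`; its value at `t` depends
on `|t|` only. -/
def rho (l t : ℝ) : ℝ :=
  if t = 0 then 8 * π / (3 * absDisc K)
  else if |t| ≤ 2 * l then
    8 * π * l ^ 3 / (absDisc K * |t| ^ 3) *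
      (Real.arcsin (|t| / (2 * l)) -
        |t| / (2 * l) * (1 - t ^ 2 / (2 * l ^ 2)) * √(1 - t ^ 2 / (4 * l ^ 2)))
  else 4 * π ^ 2 * l ^ 3 / (absDisc K * |t| ^ 3)

open Classical in
/-- The asymptotic pair correlation measure, as a function of `l = lim φ(N) / N^{1-α}`. -/
def limitMeasure (l : ℝ≥0∞) : Measure ℝ :=
  if l = 0 then ENNReal.ofReal (4 * π ^ 2 / absDisc K) • Measure.dirac 0
  else if l = ⊤ then ENNReal.ofReal (8 * π / (3 * absDisc K)) • volume
  else volume.withDensity (fun t => ENNReal.ofReal (rho K l.toReal t))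

end Field

/-- The supremum norm (used for bounded functions only). -/
def supNorm (f : ℝ → ℝ) : ℝ := ⨆ t, |f t|

/-- `ℛ_N(f) = m(f) + O(E(N, A, ‖f‖_∞, ‖f'‖_∞))` as `N → ∞`, for all `A ≥ 1` and all `C¹` functions
`f` with support in `[-A, A]`; neither the constant nor the threshold depends on `A` and `f`. -/
def HasErrorTerm (R : ℕ → Measure ℝ) (m : Measure ℝ) (E : ℕ → ℝ → ℝ → ℝ → ℝ) : Prop :=
  ∃ C : ℝ, ∃ N₀ : ℕ, ∀ A : ℝ, 1 ≤ A → ∀ f : ℝ → ℝ, ContDiff ℝ 1 f → tsupport f ⊆ Icc (-A) A →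
    ∀ N : ℕ, N₀ ≤ N →
      |(∫ t, f t ∂(R N)) - ∫ t, f t ∂m| ≤ C * E N A (supNorm f) (supNorm (deriv f))

end PairCorr

end

/-! Write `R = N^α` and `κ = φ(N)`. Grouping the pairs `(w, z)` by their difference `p = w - z`
turns the measure into a double lattice sum: `p` runs over the nonzero integers of modulus at most
`R`, and `z` over those of modulus at most `N` such that `z + p` is one too and has another norm
(`integral_empirical`). Since `ln 𝔫(z+p) - ln 𝔫(z) = 2 Re(p/z) + O(|p/z|²)`, and since few `z` are
near the origin, near the edge of the disc or on the line `𝔫(z+p) = 𝔫(z)`, the inner sum is close to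
a Riemann sum for `w ↦ f(2κ Re(p/w))` on the disc `|w| ≤ N`, with cells of area `Im ω_K`
(`exists_linearise`, `exists_riemann_snd`). The total error is `O(F N R³ + F' κ R⁴ N^ε)`, where `F`,
`F'` bound `|f|`, `|f'|` and `0 < ε ≤ 1` is fixed (`exists_abs_pairSum_sub_le`).

The behaviour of these integrals is governed by `X = κ R / N = φ(N) / N^(1-α)`, whose limit is `λ`.
There are three ways to finish. If `X → 0`, then `f` may be replaced by `f(0)`, and the sum over `p`
just counts lattice points. If `X → ∞`, only those `w` matter for which `p/w` is almost imaginary.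
In polar coordinates `∫ f(c cos θ) dθ ≈ (2/c) ∫ f` with `c = 2κ|p|/r`, so `p` contributes
`N³/(3κ|p|) ∫ f`, and `∑ 1/|p|` is the natural normalisation. If `X` has a finite positive limit,
the sum over `p` is a Riemann sum as well (`exists_riemann_fst`), and the double integral equals, up
to a scalar, `∫ f(t) profile(t/(2X)) dt` (`integral_integral_closedBall`). An explicit
antiderivative identifies `profile` with `rho` (`profile_eq`, `rho_eq`), and its Hölder dependence
on the scale allows `X` to be replaced by `λ`.

Arithmetic enters only through three facts: `𝓞 K = ℤ + ω_K ℤ` with `|D_K| = 4 (Im ω_K)²`; nonzero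
integers have modulus at least 1; and `c'_p |v_p| = √|D_K| |p|`, so the gcds cancel and `S_{N,k}` is
a multiple of `∑ |p|^(k-1)`. What remains is to compare powers of `N`, with `ε` chosen separately in
each regime. -/

namespace PairCorr

/-! ### Trace, norm and the integral basis of an imaginary quadratic field -/

section Arithmetic

variable {K : Type*} [Field K] [NumberField K]

/-- A totally complex quadratic field has exactly two complex embeddings, `σ` and its conjugate;
trace and norm are the sum and the product over them. -/
theorem trace_add_conj (hK : Module.finrank ℚ K = 2) [NumberField.IsTotallyComplex K] (σ : K →+* ℂ)
    (x : K) : ((Algebra.trace ℚ K x : ℚ) : ℂ) = σ x + (starRingEnd ℂ) (σ x) ∧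
      ((Algebra.norm ℚ x : ℚ) : ℂ) = σ x * (starRingEnd ℂ) (σ x) := by
  classical
  have hne : ComplexEmbedding.conjugate σ ≠ σ := by
    intro h
    have h1 := NumberField.IsTotallyComplex.isComplex (InfinitePlace.mk σ)
    rw [InfinitePlace.isComplex_mk_iff] at h1
    exact h1 h
  set s : K →ₐ[ℚ] ℂ := RingHom.toRatAlgHom σ with hs
  set s' : K →ₐ[ℚ] ℂ := RingHom.toRatAlgHom (ComplexEmbedding.conjugate σ) with hs'
  have hss : s ≠ s' := by
    intro h
    apply hne
    ext y
    have := congrArg (fun g : K →ₐ[ℚ] ℂ => g y) h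
    simpa [hs, hs'] using this.symm
  have huniv : (Finset.univ : Finset (K →ₐ[ℚ] ℂ)) = {s, s'} := by
    symm
    apply Finset.eq_univ_of_card
    rw [Finset.card_pair hss, AlgHom.card, hK]
  constructor
  · have := trace_eq_sum_embeddings ℂ (K := ℚ) (L := K) (x := x)
    rw [huniv, Finset.sum_pair hss] at this
    simpa [hs, hs'] using this
  · have := Algebra.norm_eq_prod_embeddings ℚ ℂ (L := K) x
    rw [huniv, Finset.prod_pair hss] at this
    simpa [hs, hs'] using this

theorem trace_int_eq (hK : Module.finrank ℚ K = 2) [NumberField.IsTotallyComplex K] (σ : K →+* ℂ)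
    (x : 𝓞 K) : ((Algebra.trace ℤ (𝓞 K) x : ℤ) : ℝ) = 2 * (σ x).re := by
  have h1 := (trace_add_conj hK σ x).1
  rw [← Algebra.coe_trace_int, Complex.add_conj] at h1
  exact_mod_cast h1

theorem norm_int_eq (hK : Module.finrank ℚ K = 2) [NumberField.IsTotallyComplex K] (σ : K →+* ℂ)
    (x : 𝓞 K) : ((Algebra.norm ℤ x : ℤ) : ℝ) = Complex.normSq (σ x) := by
  have h1 := (trace_add_conj hK σ x).2
  rw [← Algebra.coe_norm_int, Complex.mul_conj] at h1
  exact_mod_cast h1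

/-- A `ℤ`-basis of `𝓞 K` of the form `(1, θ)`. -/
theorem exists_generator (hK : Module.finrank ℚ K = 2) [NumberField.IsTotallyComplex K]
    (σ : K →+* ℂ) :
    ∃ θ : 𝓞 K, (∀ p : 𝓞 K, ∃ x y : ℤ, p = x + y * θ) ∧
      (discr K : ℝ) = -4 * (σ θ).im ^ 2 := by
  have hr : Module.finrank ℤ (𝓞 K) = 2 := by rw [RingOfIntegers.rank, hK]
  let b : Module.Basis (Fin 2) ℤ (𝓞 K) := Module.finBasisOfFinrankEq ℤ (𝓞 K) hr
  have hb : ∀ p : 𝓞 K, p = (b.repr p 0 : 𝓞 K) * b 0 + (b.repr p 1 : 𝓞 K) * b 1 := by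
    intro p
    have := b.sum_repr p
    rw [Fin.sum_univ_two] at this
    simpa [zsmul_eq_mul] using this.symm
  set m := b.repr 1 0 with hm
  set n := b.repr 1 1 with hn
  have h1 : (1 : 𝓞 K) = m * b 0 + n * b 1 := hb 1
  -- The vector 1 is primitive: a common divisor `g` of its coordinates gives `1 = g² · norm(...)`,
  -- so `g` is a unit.
  have hg : IsCoprime m n := by
    rw [Int.isCoprime_iff_gcd_eq_one]
    obtain ⟨m', hm'⟩ := Int.gcd_dvd_left m n
    obtain ⟨n', hn'⟩ := Int.gcd_dvd_right m n
    set g := Int.gcd m n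
    have h2 : (1 : 𝓞 K) = ((g : ℤ) : 𝓞 K) * (m' * b 0 + n' * b 1) := by
      rw [mul_add, ← mul_assoc, ← mul_assoc, ← Int.cast_mul, ← Int.cast_mul, ← hm', ← hn']
      exact h1
    have h3 := congrArg (Algebra.norm ℤ) h2
    rw [map_one, map_mul] at h3
    have h4 : (Algebra.norm ℤ ((g : ℤ) : 𝓞 K)) = (g : ℤ) ^ 2 := by
      rw [← hr]
      exact Algebra.norm_algebraMap_of_basis b (g : ℤ) |>.trans (by rw [hr]; simp)
    rw [h4, pow_two, mul_assoc] at h3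
    have h5 : (g : ℤ) ∣ 1 := ⟨_, h3⟩
    exact_mod_cast Int.eq_one_of_dvd_one (by positivity) h5
  obtain ⟨u, v, huv⟩ := hg
  have huv' : ((u : 𝓞 K)) * m + v * n = 1 := by exact_mod_cast huv
  -- Bézout completes the primitive vector `(m, n)` to a unimodular matrix, with determinant `u m +
  -- v n = 1`.
  let θ : 𝓞 K := -v * b 0 + u * b 1
  have e0 : b 0 = u - n * θ := by
    linear_combination (-(b 0)) * huv' - (u : 𝓞 K) * h1
  have e1 : b 1 = v + m * θ := by
    linear_combination (-(b 1)) * huv' - (v : 𝓞 K) * h1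
  refine ⟨θ, fun p => ⟨b.repr p 0 * u + b.repr p 1 * v, -(b.repr p 0 * n) + b.repr p 1 * m, ?_⟩, ?_⟩
  · conv_lhs => rw [hb p, e0, e1]
    push_cast
    ring
  · have hD := NumberField.discr_eq_discr K b
    rw [Algebra.discr_def, Matrix.det_fin_two] at hD
    simp only [Algebra.traceMatrix_apply, Algebra.traceForm_apply] at hD
    rw [← hD]
    push_cast
    rw [trace_int_eq hK σ, trace_int_eq hK σ, trace_int_eq hK σ, trace_int_eq hK σ]
    have f0 : σ (b 0) = u - n * σ θ := by
      conv_lhs => rw [e0]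
      simp
    have f1 : σ (b 1) = v + m * σ θ := by
      conv_lhs => rw [e1]
      simp
    have huvR : (u : ℝ) * m + v * n = 1 := by exact_mod_cast huv
    -- The trace determinant of a pair is -4 times the squared area of the parallelogram it spans;
    -- the unimodular change of basis preserves this area.
    have g : ∀ s t : ℂ, (2 * (s * s).re) * (2 * (t * t).re) - (2 * (s * t).re) * (2 * (t * s).re) =
        -4 * (s.re * t.im - s.im * t.re) ^ 2 := by
      intro s t
      simp only [Complex.mul_re]
      ring
    simp only [map_mul]
    rw [g, f0, f1]
    simp only [Complex.add_re, Complex.sub_re, Complex.mul_re, Complex.add_im, Complex.sub_im,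
      Complex.mul_im, Complex.intCast_re, Complex.intCast_im]
    generalize (σ θ).re = r
    generalize (σ θ).im = i
    have : ((u:ℝ) - (n * r - 0 * i)) * (0 + (m * i + 0 * r)) - (0 - (n * i + 0 * r)) * (v + (m * r - 0 * i))
      = i * (u * m + v * n) := by ring
    rw [this, huvR, mul_one]

theorem absDisc_pos : 0 < absDisc K := by
  unfold absDisc
  have := NumberField.discr_ne_zero K
  positivity

theorem omega_im : (omega K).im = √(absDisc K) / 2 := by
  unfold omega
  split_ifs
  · have : Complex.I * (√(absDisc K) : ℂ) / 2 = ((√(absDisc K) / 2 : ℝ) : ℂ) * Complex.I := by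
      push_cast; ring
    rw [this]; simp
  · have : (1 + Complex.I * (√(absDisc K) : ℂ)) / 2 =
        ((1 / 2 : ℝ) : ℂ) + ((√(absDisc K) / 2 : ℝ) : ℂ) * Complex.I := by
      push_cast; ring
    rw [this]; simp

theorem omega_re : (omega K).re = (traceOmega K : ℝ) / 2 := by
  unfold omega traceOmega
  split_ifs
  · have : Complex.I * (√(absDisc K) : ℂ) / 2 = ((√(absDisc K) / 2 : ℝ) : ℂ) * Complex.I := by
      push_cast; ring
    rw [this]; simp
  · have : (1 + Complex.I * (√(absDisc K) : ℂ)) / 2 =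
        ((1 / 2 : ℝ) : ℂ) + ((√(absDisc K) / 2 : ℝ) : ℂ) * Complex.I := by
      push_cast; ring
    rw [this]; simp

theorem omega_im_pos : 0 < (omega K).im := by
  rw [omega_im]
  have := absDisc_pos (K := K)
  positivity

/-- The rings `σ (𝓞 K)` and `ℤ + ω_K ℤ` agree, and `normOmega K` is the norm of `ω_K`. -/
theorem exists_omega_eq (hK : Module.finrank ℚ K = 2) [NumberField.IsTotallyComplex K]
    (σ : K →+* ℂ) :
    (∃ θ : 𝓞 K, (∀ p : 𝓞 K, ∃ x y : ℤ, p = x + y * θ) ∧ σ θ = omega K) ∧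
      (normOmega K : ℝ) = Complex.normSq (omega K) := by
  obtain ⟨θ, hθ, hD⟩ := exists_generator hK σ
  have habs : absDisc K = 4 * (σ θ).im ^ 2 := by
    unfold absDisc
    rw [hD, abs_of_nonpos (by nlinarith [sq_nonneg (σ θ).im])]
    ring
  have hsq : √(absDisc K) = 2 * |(σ θ).im| := by
    rw [habs, show 4 * (σ θ).im ^ 2 = (2 * |(σ θ).im|) ^ 2 by rw [mul_pow, sq_abs]; norm_num]
    exact Real.sqrt_sq (by positivity)
  have hn := norm_int_eq hK σ θ
  have ht := trace_int_eq hK σ θ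
  set t := Algebra.trace ℤ (𝓞 K) θ
  set n := Algebra.norm ℤ θ
  have hDt : discr K = t ^ 2 - 4 * n := by
    have : (discr K : ℝ) = (t : ℝ) ^ 2 - 4 * n := by
      rw [hD, hn, ht, Complex.normSq_apply]; ring
    exact_mod_cast this
  have hneg : discr K < 0 := by
    have h0 := NumberField.discr_ne_zero K
    have : (discr K : ℝ) ≤ 0 := by rw [hD]; nlinarith [sq_nonneg (σ θ).im]
    have : discr K ≤ 0 := by exact_mod_cast this
    omega
  -- a shift of `t` to the trace of `ω_K`
  obtain ⟨k, hk⟩ : ∃ k : ℤ, t = 2 * k + traceOmega K := by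
    unfold traceOmega
    rcases Int.even_or_odd' t with ⟨k, hk | hk⟩
    · refine ⟨k, ?_⟩
      have : 4 ∣ discr K := by rw [hDt, hk]; exact ⟨k ^ 2 - n, by ring⟩
      rw [if_pos this]; omega
    · refine ⟨k, ?_⟩
      have : ¬ 4 ∣ discr K := by
        rw [hDt, hk]
        rintro ⟨q, hq⟩
        have : 4 * (k ^ 2 + k - n - q) = -1 := by linear_combination hq
        omega
      rw [if_neg this]; exact hk
  have hkR : (t : ℝ) = 2 * k + traceOmega K := by exact_mod_cast hk
  refine ⟨?_, ?_⟩
  -- Up to sign and an integer translation `θ` is `ω_K`. The sign is the one that makes the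
  -- imaginary part positive.
  · rcases le_or_gt 0 (σ θ).im with h | h
    · refine ⟨θ - k, fun p => ?_, ?_⟩
      · obtain ⟨x, y, rfl⟩ := hθ p
        exact ⟨x + y * k, y, by push_cast; ring⟩
      · apply Complex.ext
        · rw [omega_re]; simp; linarith
        · rw [omega_im, hsq, abs_of_nonneg h]; simp
    · refine ⟨-θ + (k + traceOmega K), fun p => ?_, ?_⟩
      · obtain ⟨x, y, rfl⟩ := hθ p
        exact ⟨x + y * (k + traceOmega K), -y, by push_cast; ring⟩
      · apply Complex.ext
        · rw [omega_re]; simp; linarith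
        · rw [omega_im, hsq, abs_of_neg h]; simp; change -(σ θ).im = _; ring
  · rw [Complex.normSq_apply, omega_re, omega_im]
    have h1 : √(absDisc K) * √(absDisc K) = absDisc K := Real.mul_self_sqrt absDisc_pos.le
    have h2 : (absDisc K) = ((|discr K| : ℤ) : ℝ) := by unfold absDisc; push_cast; rfl
    have h3 : 4 * normOmega K = traceOmega K ^ 2 + |discr K| := by
      rw [abs_of_neg hneg]
      unfold normOmega traceOmega
      rw [abs_of_neg hneg]
      split_ifs with h
      · omega
      · have h5 : ¬ Even t := by
          rintro ⟨j, hj⟩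
          apply h
          rw [hDt, hj]; exact ⟨j ^ 2 - n, by ring⟩
        obtain ⟨j, hj⟩ := Int.not_even_iff_odd.1 h5
        have : 1 + -discr K = 4 * (n - j ^ 2 - j) := by rw [hDt, hj]; ring
        omega
    have h4 : 4 * (normOmega K : ℝ) = (traceOmega K : ℝ) ^ 2 + absDisc K := by
      rw [h2]; exact_mod_cast h3
    nlinarith

end Arithmetic

/-! ### Planar lattices `ℤ + ω ℤ` -/

/-- The point `x + ω y` of the lattice `ℤ + ω ℤ`. -/
def lat (ω : ℂ) (c : ℤ × ℤ) : ℂ := (c.1 : ℂ) + ω * (c.2 : ℂ)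

section Lat

variable {ω : ℂ}

theorem lat_add (c d : ℤ × ℤ) : lat ω (c + d) = lat ω c + lat ω d := by
  simp [lat]; ring

theorem lat_sub (c d : ℤ × ℤ) : lat ω (c - d) = lat ω c - lat ω d := by
  simp [lat]; ring

@[simp] theorem lat_zero : lat ω 0 = 0 := by simp [lat]

theorem lat_re (c : ℤ × ℤ) : (lat ω c).re = c.1 + ω.re * c.2 := by simp [lat]

theorem lat_im (c : ℤ × ℤ) : (lat ω c).im = ω.im * c.2 := by simp [lat]

theorem lat_injective (hω : 0 < ω.im) : Function.Injective (lat ω) := by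
  rintro ⟨x, y⟩ ⟨x', y'⟩ h
  have h1 := congrArg Complex.im h
  have h2 := congrArg Complex.re h
  simp only [lat_im, lat_re] at h1 h2
  have h3 : (y : ℝ) = y' := mul_left_cancel₀ hω.ne' h1
  rw [h3] at h2
  have h4 : (x : ℝ) = x' := by linarith
  ext
  · exact_mod_cast h4
  · exact_mod_cast h3

theorem abs_snd_le (hω : 0 < ω.im) (c : ℤ × ℤ) : |(c.2 : ℝ)| ≤ ‖lat ω c‖ / ω.im := by
  rw [le_div_iff₀ hω]
  have := Complex.abs_im_le_norm (lat ω c)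
  rw [lat_im, abs_mul, abs_of_pos hω] at this
  linarith

theorem abs_fst_le (hω : 0 < ω.im) (c : ℤ × ℤ) :
    |(c.1 : ℝ)| ≤ (1 + ‖ω‖ / ω.im) * ‖lat ω c‖ := by
  have h1 := Complex.abs_re_le_norm (lat ω c)
  rw [lat_re] at h1
  have h2 := abs_snd_le hω c
  have h3 : |ω.re * c.2| ≤ ‖ω‖ * (‖lat ω c‖ / ω.im) := by
    rw [abs_mul]
    exact mul_le_mul (Complex.abs_re_le_norm ω) h2 (abs_nonneg _) (norm_nonneg _)
  have h4 : |(c.1 : ℝ)| ≤ |c.1 + ω.re * c.2| + |ω.re * c.2| := by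
    have := abs_sub (c.1 + ω.re * c.2) (ω.re * c.2)
    simpa using this
  calc _ ≤ _ := h4
    _ ≤ ‖lat ω c‖ + ‖ω‖ * (‖lat ω c‖ / ω.im) := add_le_add h1 h3
    _ = _ := by ring

theorem finite_lat_le (hω : 0 < ω.im) (r : ℝ) : {c : ℤ × ℤ | ‖lat ω c‖ ≤ r}.Finite := by
  set X := (1 + ‖ω‖ / ω.im) * r
  set Y := r / ω.im
  apply (((Set.finite_Icc (-⌈X⌉) ⌈X⌉)).prod (Set.finite_Icc (-⌈Y⌉) ⌈Y⌉)).subset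
  intro c hc
  have hc' : ‖lat ω c‖ ≤ r := hc
  have h1 : |(c.1 : ℝ)| ≤ X := (abs_fst_le hω c).trans
    (mul_le_mul_of_nonneg_left hc' (by positivity))
  have h2 : |(c.2 : ℝ)| ≤ Y := (abs_snd_le hω c).trans
    (div_le_div_of_nonneg_right hc' hω.le)
  have h1' : |(c.1 : ℝ)| ≤ ⌈X⌉ := h1.trans (Int.le_ceil _)
  have h2' : |(c.2 : ℝ)| ≤ ⌈Y⌉ := h2.trans (Int.le_ceil _)
  rw [abs_le] at h1' h2'
  exact ⟨⟨by exact_mod_cast h1'.1, by exact_mod_cast h1'.2⟩,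
    ⟨by exact_mod_cast h2'.1, by exact_mod_cast h2'.2⟩⟩

/-- The condition `0 < ω.im` is part of the set so that finiteness holds for every `ω` and `ballPts`
can be defined without a hypothesis. -/
theorem finite_ballPts (ω : ℂ) (r : ℝ) : {c : ℤ × ℤ | 0 < ω.im ∧ c ≠ 0 ∧ ‖lat ω c‖ ≤ r}.Finite := by
  by_cases hω : 0 < ω.im
  · exact (finite_lat_le hω r).subset fun c hc => hc.2.2
  · simp [hω]

/-- The nonzero points of the lattice `ℤ + ω ℤ` in the closed disc of radius `r`. -/
noncomputable def ballPts (ω : ℂ) (r : ℝ) : Finset (ℤ × ℤ) := (finite_ballPts ω r).toFinset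

theorem mem_ballPts (hω : 0 < ω.im) {r : ℝ} {c : ℤ × ℤ} :
    c ∈ ballPts ω r ↔ c ≠ 0 ∧ ‖lat ω c‖ ≤ r := by
  simp [ballPts, hω]

open Classical in
/-- The sum over pairs of lattice points that defines the empirical pair correlation measures;
`p` is the difference of the two points, and `z` is one of them. -/
noncomputable def pairSum (ω : ℂ) (N R κ : ℝ) (f : ℝ → ℝ) : ℝ :=
  ∑ p ∈ ballPts ω R, ∑ z ∈ (ballPts ω N).filter (fun z => z + p ∈ ballPts ω N ∧
      Complex.normSq (lat ω (z + p)) ≠ Complex.normSq (lat ω z)),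
    f (κ * (Real.log (Complex.normSq (lat ω (z + p))) - Real.log (Complex.normSq (lat ω z))))

end Lat

/-! ### Passage from `𝓞 K` to lattice coordinates -/

section Field

variable {K : Type*} [Field K] [NumberField K]

theorem latticePoint_coords (hK : Module.finrank ℚ K = 2) [NumberField.IsTotallyComplex K]
    (σ : K →+* ℂ) (p : 𝓞 K) : lat (omega K) (coords σ p) = σ p := by
  obtain ⟨⟨θ, hθ, h⟩, -⟩ := exists_omega_eq hK σ
  apply Function.invFun_eq (f := latticePoint K)
  obtain ⟨x, y, rfl⟩ := hθ p
  refine ⟨(x, y), ?_⟩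
  simp only [latticePoint, ← h, map_add, map_mul, map_intCast]
  ring

theorem coords_bijective (hK : Module.finrank ℚ K = 2) [NumberField.IsTotallyComplex K]
    (σ : K →+* ℂ) : Function.Bijective (coords σ) := by
  obtain ⟨⟨θ, hθ, h⟩, -⟩ := exists_omega_eq hK σ
  constructor
  · intro p q hpq
    have := latticePoint_coords hK σ p
    rw [hpq, latticePoint_coords hK σ q] at this
    exact NumberField.RingOfIntegers.ext (σ.injective this.symm)
  · intro c
    refine ⟨(c.1 : 𝓞 K) + c.2 * θ, lat_injective (omega_im_pos (K := K)) ?_⟩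
    rw [latticePoint_coords hK σ]
    simp only [lat, ← h, map_add, map_mul, map_intCast]
    ring

/-- The coordinates, as a bijection `𝓞 K ≃ ℤ × ℤ`. -/
noncomputable def coordsEquiv (hK : Module.finrank ℚ K = 2) [NumberField.IsTotallyComplex K]
    (σ : K →+* ℂ) : 𝓞 K ≃ ℤ × ℤ := Equiv.ofBijective _ (coords_bijective hK σ)

theorem lat_coordsEquiv (hK : Module.finrank ℚ K = 2) [NumberField.IsTotallyComplex K]
    (σ : K →+* ℂ) (p : 𝓞 K) : lat (omega K) (coordsEquiv hK σ p) = σ p :=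
  latticePoint_coords hK σ p

theorem exists_nat_normSq (hK : Module.finrank ℚ K = 2) [NumberField.IsTotallyComplex K]
    (σ : K →+* ℂ) (c : ℤ × ℤ) : ∃ n : ℕ, Complex.normSq (lat (omega K) c) = n := by
  obtain ⟨p, rfl⟩ := (coordsEquiv hK σ).surjective c
  rw [lat_coordsEquiv, ← norm_int_eq hK σ p]
  have h : 0 ≤ Algebra.norm ℤ p := by
    have := Complex.normSq_nonneg (σ p)
    rw [← norm_int_eq hK σ p] at this
    exact_mod_cast this
  lift Algebra.norm ℤ p to ℕ using h with n
  exact ⟨n, by simp⟩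

/-- The squared modulus of a nonzero integer is a positive natural number. The analytic estimates
use this fact as the hypothesis `hmin`. -/
theorem one_le_norm_lat (hK : Module.finrank ℚ K = 2) [NumberField.IsTotallyComplex K]
    (σ : K →+* ℂ) {c : ℤ × ℤ} (hc : c ≠ 0) : 1 ≤ ‖lat (omega K) c‖ := by
  obtain ⟨n, hn⟩ := exists_nat_normSq hK σ c
  have h0 : lat (omega K) c ≠ 0 := fun h => hc (lat_injective omega_im_pos (by simpa using h))
  have h1 : n ≠ 0 := by
    rintro rfl
    exact h0 (Complex.normSq_eq_zero.1 (by simpa using hn))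
  have h2 : (1 : ℝ) ≤ n := by exact_mod_cast Nat.one_le_iff_ne_zero.2 h1
  rw [← hn, Complex.normSq_eq_norm_sq] at h2
  nlinarith [norm_nonneg (lat (omega K) c)]

/-- The numerator of `v_p` is `-i √|D_K| p`, so multiplication by the gcd removes all arithmetic
from the weights. -/
theorem cPrime_mul_norm_vVec (hK : Module.finrank ℚ K = 2) [NumberField.IsTotallyComplex K]
    (σ : K →+* ℂ) (p : 𝓞 K) :
    (cPrime σ p : ℝ) * ‖vVec σ p‖ = √(absDisc K) * ‖σ p‖ := by
  have hnum : (yPrime σ p : ℂ) - omega K * (xPrime σ p : ℂ) =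
      -(Complex.I * (√(absDisc K) : ℂ)) * σ p := by
    rw [← latticePoint_coords hK σ p]
    obtain ⟨-, hn⟩ := exists_omega_eq hK σ
    have ht := omega_re (K := K)
    have hi := omega_im (K := K)
    have ht' : (traceOmega K : ℂ) = ((2 * (omega K).re : ℝ) : ℂ) := by rw [ht]; push_cast; ring
    have hi' : (√(absDisc K) : ℂ) = ((2 * (omega K).im : ℝ) : ℂ) := by rw [hi]; push_cast; ring
    have hn' : (normOmega K : ℂ) = ((Complex.normSq (omega K) : ℝ) : ℂ) := by
      rw [← hn]; push_cast; rfl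
    simp only [yPrime, xPrime, lat]
    push_cast
    rw [ht', hi', hn']
    generalize omega K = w
    rw [Complex.normSq_apply]
    apply Complex.ext <;> simp <;> ring
  -- A zero gcd forces `p` to vanish; then `v_p` is a division by zero, and both sides are 0.
  by_cases hc : cPrime σ p = 0
  · have h0 := hc
    rw [cPrime, Int.gcd_eq_zero_iff] at h0
    rw [h0.1, h0.2] at hnum
    have := congrArg norm hnum
    simp only [Int.cast_zero, mul_zero, sub_zero, norm_zero, norm_mul, norm_neg, Complex.norm_I,
      Complex.norm_real, Real.norm_eq_abs, one_mul, abs_of_nonneg (Real.sqrt_nonneg _)] at this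
    rw [hc, ← this]; simp
  · have hc' : (cPrime σ p : ℝ) ≠ 0 := by exact_mod_cast hc
    rw [vVec, hnum, norm_div, norm_mul, norm_neg, norm_mul, Complex.norm_I, Complex.norm_real,
      Real.norm_eq_abs, abs_of_nonneg (Real.sqrt_nonneg _), Complex.norm_natCast]
    field_simp

theorem S_eq (hK : Module.finrank ℚ K = 2) [NumberField.IsTotallyComplex K]
    (σ : K →+* ℂ) (α : ℝ) (k N : ℕ) :
    S σ α k N = √(absDisc K) * (k + 1) / (4 * π) *
      ∑ c ∈ ballPts (omega K) ((N : ℝ) ^ α), ‖lat (omega K) c‖ ^ k / ‖lat (omega K) c‖ := by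
  have hD := absDisc_pos (K := K)
  have hsq : √(absDisc K) * √(absDisc K) = absDisc K := Real.mul_self_sqrt hD.le
  have hpos : 0 < √(absDisc K) := Real.sqrt_pos.2 hD
  have h : ∑ᶠ p ∈ {p : 𝓞 K | 0 < ‖σ p‖ ∧ ‖σ p‖ ≤ (N : ℝ) ^ α},
        ‖σ p‖ ^ k / (cPrime σ p * ‖vVec σ p‖) =
      ∑ᶠ c ∈ (ballPts (omega K) ((N : ℝ) ^ α) : Set (ℤ × ℤ)),
        ‖lat (omega K) c‖ ^ k / (√(absDisc K) * ‖lat (omega K) c‖) := by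
    apply finsum_mem_eq_of_bijOn (coordsEquiv hK σ)
    · refine (coordsEquiv hK σ).bijOn fun p => ?_
      rw [Finset.mem_coe, mem_ballPts omega_im_pos, lat_coordsEquiv, Set.mem_ofPred_eq, norm_pos_iff]
      refine and_congr_left' (not_congr ?_)
      rw [← lat_coordsEquiv hK σ p]
      exact ⟨fun h0 => by rw [h0, lat_zero],
        fun h0 => lat_injective omega_im_pos (by rw [h0, lat_zero])⟩
    · intro p _
      rw [lat_coordsEquiv, cPrime_mul_norm_vVec hK]
  rw [S, h, finsum_mem_coe_finset, Finset.mul_sum, Finset.mul_sum]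
  refine Finset.sum_congr rfl fun c _ => ?_
  generalize ‖lat (omega K) c‖ = x
  generalize √(absDisc K) = s at *
  rw [← hsq]
  field_simp

end Field

/-! ### The empirical measure as a double lattice sum -/

section Field

variable {K : Type*} [Field K] [NumberField K]

-- The coefficient `r_{K,α}(a, b, N)` is the size of the fibre over `(a, b)` of the map `(w, z) ↦
-- (𝔫(w), 𝔫(z))` on the finite set of admissible pairs. Summing over fibres and putting `p = w - z`
-- gives `pairSum`.
open Classical in
theorem integral_empirical (hK : Module.finrank ℚ K = 2) [NumberField.IsTotallyComplex K]
    (σ : K →+* ℂ) (α : ℝ) (φ ψ : ℕ → ℝ) (N : ℕ) (hψ : 0 < ψ N) (f : ℝ → ℝ) :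
    ∫ t, f t ∂(empirical σ α φ ψ N) =
      1 / ψ N * pairSum (omega K) N ((N : ℝ) ^ α) (φ N) f := by
  unfold pairSum
  have hω := omega_im_pos (K := K)
  choose n hn using exists_nat_normSq hK σ
  set ω := omega K with hωdef
  -- Norms are natural numbers, so the range `1 ≤ a ≤ N²` is exactly the punctured disc of radius
  -- `N`.
  have hballN : ∀ c : ℤ × ℤ, c ∈ ballPts ω N ↔ n c ∈ Finset.Icc 1 (N ^ 2) := by
    intro c
    rw [mem_ballPts hω, Finset.mem_Icc]
    have h1 : c ≠ 0 ↔ 1 ≤ n c := by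
      rw [Nat.one_le_iff_ne_zero, not_iff_not, ← Nat.cast_inj (R := ℝ), ← hn, Nat.cast_zero,
        Complex.normSq_eq_zero]
      exact ⟨fun h => by rw [h, lat_zero], fun h => lat_injective hω (by rw [h, lat_zero])⟩
    have h2 : ‖lat ω c‖ ≤ N ↔ n c ≤ N ^ 2 := by
      rw [← Nat.cast_le (α := ℝ), ← hn, Complex.normSq_eq_norm_sq, Nat.cast_pow]
      exact (pow_le_pow_iff_left₀ (norm_nonneg _) (Nat.cast_nonneg _) two_ne_zero).symm
    rw [h1, h2]
  have hR : ∀ c : ℤ × ℤ, Complex.normSq (lat ω c) ≤ (N : ℝ) ^ (2 * α) ↔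
      ‖lat ω c‖ ≤ (N : ℝ) ^ α := by
    intro c
    rw [Complex.normSq_eq_norm_sq, mul_comm, Real.rpow_mul (Nat.cast_nonneg _), Real.rpow_two]
    exact pow_le_pow_iff_left₀ (norm_nonneg _) (Real.rpow_nonneg (Nat.cast_nonneg _) _) two_ne_zero
  -- the pairs `(w, z)`
  set T : Finset ((ℤ × ℤ) × (ℤ × ℤ)) := (ballPts ω N ×ˢ ballPts ω N).filter
    (fun x => n x.1 ≠ n x.2 ∧ ‖lat ω (x.1 - x.2)‖ ≤ (N : ℝ) ^ α) with hT
  set F : ℕ × ℕ → ℝ := fun x => f (φ N * (Real.log x.1 - Real.log x.2)) with hF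
  have hrhs : ∑ p ∈ ballPts ω ((N : ℝ) ^ α),
        ∑ z ∈ (ballPts ω N).filter (fun z => z + p ∈ ballPts ω N ∧
          Complex.normSq (lat ω (z + p)) ≠ Complex.normSq (lat ω z)),
          f (φ N * (Real.log (Complex.normSq (lat ω (z + p))) -
            Real.log (Complex.normSq (lat ω z)))) = ∑ x ∈ T, F (n x.1, n x.2) := by
    rw [Finset.sum_sigma']
    refine Finset.sum_bij' (fun x _ => (x.2 + x.1, x.2)) (fun x _ => ⟨x.1 - x.2, x.2⟩) ?_ ?_ ?_ ?_ ?_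
    · rintro ⟨p, z⟩ h
      simp only [Finset.mem_sigma, Finset.mem_filter, mem_ballPts hω (r := (N : ℝ) ^ α), hn, Ne,
        Nat.cast_inj] at h
      simp only [hT, Finset.mem_filter, Finset.mem_product, add_sub_cancel_left, Ne]
      tauto
    · rintro ⟨w, z⟩ h
      simp only [hT, Finset.mem_filter, Finset.mem_product, Ne] at h
      simp only [Finset.mem_sigma, Finset.mem_filter, mem_ballPts hω (r := (N : ℝ) ^ α), hn, Ne,
        Nat.cast_inj, add_sub_cancel, sub_eq_zero]
      refine ⟨⟨fun h0 => h.2.1 (by rw [h0]), h.2.2⟩, h.1.2, h.1.1, h.2.1⟩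
    · rintro ⟨p, z⟩ h
      simp
    · rintro ⟨w, z⟩ h
      simp
    · rintro ⟨p, z⟩ h
      simp only [hF, hn]
  rw [hrhs]
  set U : Finset (ℕ × ℕ) := (Finset.Icc 1 (N ^ 2) ×ˢ Finset.Icc 1 (N ^ 2)).filter
    (fun x => x.1 ≠ x.2) with hU
  have hmaps : ∀ x ∈ T, (n x.1, n x.2) ∈ U := by
    rintro ⟨w, z⟩ h
    simp only [hT, Finset.mem_filter, Finset.mem_product, hballN] at h
    simp only [hU, Finset.mem_filter, Finset.mem_product]
    tauto
  have hrep : ∀ x ∈ U, repCount σ α x.1 x.2 N =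
      (T.filter (fun y => (n y.1, n y.2) = x)).card := by
    rintro ⟨a, b⟩ h
    simp only [hU, Finset.mem_filter, Finset.mem_product] at h
    rw [repCount, ← Set.ncard_image_of_injective _
      ((coordsEquiv hK σ).prodCongr (coordsEquiv hK σ)).injective, ← Set.ncard_coe_finset]
    congr 1
    ext ⟨w, z⟩
    rw [Equiv.image_eq_preimage_symm]
    obtain ⟨w, rfl⟩ := (coordsEquiv hK σ).surjective w
    obtain ⟨z, rfl⟩ := (coordsEquiv hK σ).surjective z
    simp only [Equiv.prodCongr_symm, Set.mem_preimage, Equiv.prodCongr_apply, Prod.map_apply,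
      Equiv.symm_apply_apply, Set.mem_ofPred_eq, Finset.coe_filter, hT, Finset.mem_filter,
      Finset.mem_product, hballN, Prod.mk.injEq, ← lat_coordsEquiv hK σ]
    rw [← lat_sub, hR, lat_sub, lat_sub, norm_sub_rev, hn, hn, Nat.cast_inj, Nat.cast_inj]
    constructor
    · rintro ⟨rfl, rfl, h3⟩
      exact ⟨⟨h.1, h.2, h3⟩, rfl, rfl⟩
    · rintro ⟨h1, h2, h3⟩
      exact ⟨h2, h3, h1.2.2⟩
  rw [← Finset.sum_fiberwise_of_maps_to hmaps (fun x => F (n x.1, n x.2))]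
  have hfib : ∀ x ∈ U, ∑ y ∈ T.filter (fun y => (n y.1, n y.2) = x), F (n y.1, n y.2) =
      repCount σ α x.1 x.2 N * F x := by
    intro x hx
    rw [hrep x hx, Finset.sum_congr rfl (fun y hy => by rw [(Finset.mem_filter.1 hy).2]),
      Finset.sum_const, nsmul_eq_mul]
  rw [Finset.sum_congr rfl hfib, hU, Finset.sum_filter, Finset.sum_product, empirical,
    integral_smul_measure, ENNReal.toReal_ofReal (by positivity), smul_eq_mul]
  congr 1
  have hint : ∀ a b : ℕ, Integrable f ((repCount σ α a b N : ℝ≥0∞) •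
      Measure.dirac (φ N * (Real.log a - Real.log b))) := fun a b =>
    (integrable_dirac (by simp)).smul_measure (by simp)
  rw [integral_finsetSum_measure]
  · refine Finset.sum_congr rfl fun a _ => ?_
    rw [integral_finsetSum_measure (fun b _ => hint a b), Finset.sum_filter]
    refine Finset.sum_congr rfl fun b _ => ?_
    split_ifs
    · rw [integral_smul_measure, integral_dirac]
      simp [hF]
    · rfl
  · intro a _
    exact integrable_finsetSum_measure.2 fun b _ => hint a b

end Field

/-! ### Lattice cells and lattice point counting -/

section Cells

/-- The index of the lattice cell that contains a complex number. -/
noncomputable def idx (ω : ℂ) (w : ℂ) : ℤ × ℤ :=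
  (⌊w.re - ω.re / ω.im * w.im⌋, ⌊w.im / ω.im⌋)

/-- The cell of index `c`, a translate of the half-open parallelogram spanned by `1` and `ω`. -/
def cell (ω : ℂ) (c : ℤ × ℤ) : Set ℂ := {w | idx ω w = c}

/-- An upper bound for the diameter of the cells. -/
noncomputable def cellDiam (ω : ℂ) : ℝ := 1 + ‖ω‖

variable {ω : ℂ}

theorem one_le_cellDiam : 1 ≤ cellDiam ω := by simp [cellDiam]

theorem measurable_idx : Measurable (idx ω) := by
  unfold idx
  fun_prop

theorem measurableSet_cell (c : ℤ × ℤ) : MeasurableSet (cell ω c) :=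
  measurable_idx (measurableSet_singleton c)

theorem norm_sub_lat_idx_le (hω : 0 < ω.im) (w : ℂ) : ‖w - lat ω (idx ω w)‖ ≤ cellDiam ω := by
  have h : w - lat ω (idx ω w) = ((Int.fract (w.re - ω.re / ω.im * w.im) : ℝ) : ℂ) +
      ω * (Int.fract (w.im / ω.im) : ℝ) := by
    have h1 := Int.self_sub_floor (w.re - ω.re / ω.im * w.im)
    have h2 := Int.self_sub_floor (w.im / ω.im)
    have h3 : ω.im * (w.im / ω.im) = w.im := mul_div_cancel₀ _ hω.ne'
    apply Complex.ext
    · simp [lat, idx]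
      linear_combination h1 + ω.re * h2
    · simp [lat, idx]
      linear_combination ω.im * h2 - h3
  rw [h, cellDiam]
  refine (norm_add_le _ _).trans (add_le_add ?_ ?_)
  · rw [Complex.norm_real, Real.norm_eq_abs, abs_of_nonneg (Int.fract_nonneg _)]
    exact (Int.fract_lt_one _).le
  · rw [norm_mul, Complex.norm_real, Real.norm_eq_abs, abs_of_nonneg (Int.fract_nonneg _)]
    exact mul_le_of_le_one_right (norm_nonneg _) (Int.fract_lt_one _).le

/-- A horizontal slice of a cell is an interval of length 1 or empty, and the nonempty ones fill a
height of `Im ω`. -/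
theorem volume_cell (hω : 0 < ω.im) (c : ℤ × ℤ) : volume (cell ω c) = ENNReal.ofReal ω.im := by
  have h1 : cell ω c = Complex.measurableEquivRealProd ⁻¹'
      {x : ℝ × ℝ | (⌊x.1 - ω.re / ω.im * x.2⌋, ⌊x.2 / ω.im⌋) = c} := rfl
  have hm : MeasurableSet {x : ℝ × ℝ | (⌊x.1 - ω.re / ω.im * x.2⌋, ⌊x.2 / ω.im⌋) = c} := by
    have : Measurable fun x : ℝ × ℝ => (⌊x.1 - ω.re / ω.im * x.2⌋, ⌊x.2 / ω.im⌋) := by fun_prop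
    exact this (measurableSet_singleton c)
  rw [h1, Complex.volume_preserving_equiv_real_prod.measure_preimage hm.nullMeasurableSet,
    Measure.volume_eq_prod, Measure.prod_apply_symm hm]
  have h2 : ∀ y : ℝ, volume ((fun x => (x, y)) ⁻¹'
      {x : ℝ × ℝ | (⌊x.1 - ω.re / ω.im * x.2⌋, ⌊x.2 / ω.im⌋) = c}) =
      (Ico (ω.im * c.2) (ω.im * (c.2 + 1))).indicator 1 y := by
    intro y
    have hy : ⌊y / ω.im⌋ = c.2 ↔ y ∈ Ico (ω.im * c.2) (ω.im * (c.2 + 1)) := by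
      rw [Int.floor_eq_iff, le_div_iff₀ hω, div_lt_iff₀ hω, mem_Ico, mul_comm ω.im, mul_comm ω.im]
    by_cases h : y ∈ Ico (ω.im * c.2) (ω.im * (c.2 + 1))
    · have : ((fun x => (x, y)) ⁻¹'
          {x : ℝ × ℝ | (⌊x.1 - ω.re / ω.im * x.2⌋, ⌊x.2 / ω.im⌋) = c}) =
          Ico (c.1 + ω.re / ω.im * y) (c.1 + ω.re / ω.im * y + 1) := by
        ext x
        simp only [Set.mem_preimage, Set.mem_ofPred_eq, Prod.ext_iff, hy, h, and_true]
        rw [Int.floor_eq_iff, mem_Ico]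
        constructor <;> rintro ⟨h1, h2⟩ <;> constructor <;> linarith
      rw [this, Real.volume_Ico, Set.indicator_of_mem h]
      simp
    · have : ((fun x => (x, y)) ⁻¹'
          {x : ℝ × ℝ | (⌊x.1 - ω.re / ω.im * x.2⌋, ⌊x.2 / ω.im⌋) = c}) = ∅ := by
        ext x
        simp only [Set.mem_preimage, Set.mem_ofPred_eq, Prod.ext_iff, hy, h, and_false,
          Set.mem_empty_iff_false]
      rw [this, Set.indicator_of_notMem h, measure_empty]
  simp_rw [h2]
  rw [lintegral_indicator_one measurableSet_Ico, Real.volume_Ico]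
  congr 1
  ring

theorem measureReal_cell (hω : 0 < ω.im) (c : ℤ × ℤ) : volume.real (cell ω c) = ω.im := by
  rw [Measure.real, volume_cell hω, ENNReal.toReal_ofReal hω.le]

theorem pairwiseDisjoint_cell (s : Set (ℤ × ℤ)) : s.PairwiseDisjoint (cell ω) := by
  intro c _ d _ hcd
  rw [Function.onFun, Set.disjoint_left]
  intro w hw hw'
  exact hcd (hw.symm.trans hw')

/-- Comparison of a lattice sum with an integral. -/
theorem abs_sum_sub_integral_le (hω : 0 < ω.im) (T : Finset (ℤ × ℤ)) (F : ℂ → ℝ)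
    (hF : Integrable F) (G e : ℤ × ℤ → ℝ) (h1 : ∀ w, idx ω w ∈ T → |G (idx ω w) - F w| ≤ e (idx ω w))
    (h2 : ∀ w, idx ω w ∉ T → F w = 0) :
    |ω.im * ∑ c ∈ T, G c - ∫ w, F w| ≤ ω.im * ∑ c ∈ T, e c := by
  have hint : ∫ w, F w = ∑ c ∈ T, ∫ w in cell ω c, F w := by
    rw [← integral_biUnion_finset T (fun c _ => measurableSet_cell c) (pairwiseDisjoint_cell _)
      (fun c _ => hF.integrableOn)]
    symm
    apply setIntegral_eq_integral_of_forall_compl_eq_zero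
    intro w hw
    apply h2
    intro h
    exact hw (Set.mem_biUnion (x := idx ω w) h rfl)
  rw [hint, Finset.mul_sum, Finset.mul_sum, ← Finset.sum_sub_distrib]
  refine (Finset.abs_sum_le_sum_abs _ _).trans (Finset.sum_le_sum fun c hc => ?_)
  have hfin : volume (cell ω c) < ⊤ := by rw [volume_cell hω]; exact ENNReal.ofReal_lt_top
  have h3 : ω.im * G c - ∫ w in cell ω c, F w = ∫ w in cell ω c, (G c - F w) := by
    rw [integral_sub (f := fun _ => G c) (integrableOn_const (C := G c) hfin.ne) hF.integrableOn, setIntegral_const,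
      measureReal_cell hω, smul_eq_mul]
  rw [h3, ← Real.norm_eq_abs]
  refine (norm_setIntegral_le_of_norm_le_const (C := e c) hfin ?_).trans ?_
  · intro w hw
    have hw' : idx ω w = c := hw
    rw [Real.norm_eq_abs, ← hw']
    exact h1 w (hw' ▸ hc)
  · rw [measureReal_cell hω, mul_comm]

/-- Packing: the cells of the points of `T` are disjoint, have area `Im ω` and lie in `A`. -/
theorem mul_card_le (hω : 0 < ω.im) (T : Finset (ℤ × ℤ)) (A : Set ℂ) (hA : volume A ≠ ⊤)
    (h : ∀ w, idx ω w ∈ T → w ∈ A) : ω.im * T.card ≤ volume.real A := by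
  have : volume.real (⋃ c ∈ T, cell ω c) = ω.im * T.card := by
    rw [measureReal_biUnion_finset (pairwiseDisjoint_cell _) (fun c _ => measurableSet_cell c)
      (fun c _ => by rw [volume_cell hω]; exact ENNReal.ofReal_ne_top)]
    simp [measureReal_cell hω, mul_comm]
  rw [← this]
  refine measureReal_mono ?_ hA
  intro w hw
  rw [Set.mem_iUnion₂] at hw
  obtain ⟨c, hc, hw⟩ := hw
  have hw' : idx ω w = c := hw
  exact h w (hw' ▸ hc)

/-- Covering: the cells of the points of `T` cover `A`. -/
theorem le_mul_card (hω : 0 < ω.im) (T : Finset (ℤ × ℤ)) (A : Set ℂ)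
    (h : ∀ w ∈ A, idx ω w ∈ T) : volume.real A ≤ ω.im * T.card := by
  have : volume.real (⋃ c ∈ T, cell ω c) = ω.im * T.card := by
    rw [measureReal_biUnion_finset (pairwiseDisjoint_cell _) (fun c _ => measurableSet_cell c)
      (fun c _ => by rw [volume_cell hω]; exact ENNReal.ofReal_ne_top)]
    simp [measureReal_cell hω, mul_comm]
  rw [← this]
  refine measureReal_mono ?_ ?_
  · intro w hw
    exact Set.mem_biUnion (x := idx ω w) (h w hw) rfl
  · exact (measure_biUnion_lt_top T.finite_toSet
      (fun c _ => by rw [volume_cell hω]; exact ENNReal.ofReal_lt_top)).ne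

theorem volume_real_closedBall (r : ℝ) (hr : 0 ≤ r) :
    volume.real (Metric.closedBall (0 : ℂ) r) = π * r ^ 2 := by
  rw [Measure.real, Complex.volume_closedBall]
  simp [ENNReal.toReal_ofReal hr, mul_comm]

theorem volume_real_ball (r : ℝ) (hr : 0 ≤ r) :
    volume.real (Metric.ball (0 : ℂ) r) = π * r ^ 2 := by
  rw [Measure.real, Complex.volume_ball]
  simp [ENNReal.toReal_ofReal hr, mul_comm]

theorem norm_le_of_idx (hω : 0 < ω.im) (w : ℂ) : ‖w‖ ≤ ‖lat ω (idx ω w)‖ + cellDiam ω := by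
  have := norm_sub_lat_idx_le hω w
  have h2 := norm_sub_norm_le w (lat ω (idx ω w))
  linarith

theorem norm_lat_idx_le (hω : 0 < ω.im) (w : ℂ) : ‖lat ω (idx ω w)‖ ≤ ‖w‖ + cellDiam ω := by
  have := norm_sub_lat_idx_le hω w
  have h2 := norm_sub_norm_le (lat ω (idx ω w)) w
  rw [norm_sub_rev] at h2
  linarith

/-- The cells of points of an annulus lie in the annulus thickened by `cellDiam ω` on both sides.
The maximum with 0 handles an inner radius smaller than the thickening. -/
theorem mul_card_annulus_le (hω : 0 < ω.im) (T : Finset (ℤ × ℤ)) {a b : ℝ} (hab : a ≤ b)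
    (hb : 0 ≤ b) (h : ∀ c ∈ T, a ≤ ‖lat ω c‖ ∧ ‖lat ω c‖ ≤ b) :
    ω.im * T.card ≤ 2 * π * ((b + cellDiam ω) * (b - a + 2 * cellDiam ω)) := by
  have hd := one_le_cellDiam (ω := ω)
  set d := cellDiam ω
  set m := max (a - d) 0
  have hm0 : 0 ≤ m := le_max_right _ _
  have hm1 : a - d ≤ m := le_max_left _ _
  have hm2 : m ≤ b + d := max_le (by linarith) (by linarith)
  have hsub : Metric.ball (0 : ℂ) m ⊆ Metric.closedBall 0 (b + d) :=
    (Metric.ball_subset_ball hm2).trans Metric.ball_subset_closedBall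
  have h1 := mul_card_le hω T (Metric.closedBall 0 (b + d) \ Metric.ball 0 m)
    ((measure_mono Set.sdiff_subset).trans_lt measure_closedBall_lt_top).ne (by
      intro w hw
      have h2 := norm_le_of_idx hω w
      have h3 := norm_lat_idx_le hω w
      have h4 := h _ hw
      refine ⟨by rw [mem_closedBall_zero_iff]; linarith, ?_⟩
      rw [mem_ball_zero_iff, not_lt]
      exact max_le (by linarith) (norm_nonneg _))
  refine h1.trans ?_
  rw [measureReal_sdiff hsub measurableSet_ball (measure_closedBall_lt_top.ne),
    volume_real_closedBall _ (by linarith), volume_real_ball _ hm0]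
  have : (b + d) ^ 2 - m ^ 2 ≤ 2 * ((b + d) * (b - a + 2 * d)) := by
    have e : (b + d) ^ 2 - m ^ 2 = (b + d + m) * (b + d - m) := by ring
    rw [e, ← mul_assoc]
    exact mul_le_mul (by linarith) (by linarith) (by linarith) (by linarith)
  nlinarith [Real.pi_pos]

/-- An upper bound for the number of lattice points in annuli. -/
theorem exists_card_annulus_le (hω : 0 < ω.im) : ∃ C : ℝ, 0 < C ∧ ∀ (T : Finset (ℤ × ℤ)) (a b : ℝ),
    a ≤ b → 1 ≤ b → (∀ c ∈ T, a ≤ ‖lat ω c‖ ∧ ‖lat ω c‖ ≤ b) →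
      (T.card : ℝ) ≤ C * (b * (b - a + 1)) := by
  have hd := one_le_cellDiam (ω := ω)
  refine ⟨2 * π * ((1 + cellDiam ω) * (1 + 2 * cellDiam ω)) / ω.im, by positivity, ?_⟩
  intro T a b hab hb h
  have h1 := mul_card_annulus_le hω T hab (by linarith) h
  rw [div_mul_eq_mul_div, le_div_iff₀ hω, mul_comm]
  refine h1.trans ?_
  rw [mul_assoc (2 * π)]
  gcongr ?_ * ?_
  have h2 : b + cellDiam ω ≤ (1 + cellDiam ω) * b := by nlinarith
  have h3 : b - a + 2 * cellDiam ω ≤ (1 + 2 * cellDiam ω) * (b - a + 1) := by nlinarith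
  calc _ ≤ ((1 + cellDiam ω) * b) * ((1 + 2 * cellDiam ω) * (b - a + 1)) :=
        mul_le_mul h2 h3 (by linarith) (by nlinarith)
    _ = _ := by ring

theorem exists_card_le (hω : 0 < ω.im) : ∃ C : ℝ, 0 < C ∧ ∀ (T : Finset (ℤ × ℤ)) (r : ℝ),
    1 ≤ r → (∀ c ∈ T, ‖lat ω c‖ ≤ r) → (T.card : ℝ) ≤ C * r ^ 2 := by
  obtain ⟨C, hC, h⟩ := exists_card_annulus_le hω
  refine ⟨2 * C, by positivity, fun T r hr hT => ?_⟩
  refine (h T 0 r (by linarith) hr (fun c hc => ⟨norm_nonneg _, hT c hc⟩)).trans ?_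
  have : r * (r - 0 + 1) ≤ 2 * r ^ 2 := by nlinarith
  nlinarith

/-- A lower bound for the number of lattice points in large discs. -/
theorem sq_le_card_ballPts (hω : 0 < ω.im) {r : ℝ} (hr : 4 * cellDiam ω ≤ r) :
    r ^ 2 ≤ ω.im * (ballPts ω r).card := by
  have hd := one_le_cellDiam (ω := ω)
  have hi : ω.im ≤ cellDiam ω := by
    have := (le_abs_self _).trans (Complex.abs_im_le_norm ω)
    rw [cellDiam]; linarith
  -- The origin has to be added because its cell also meets the disc; `r ≥ 4 cellDiam ω` and `π > 3`
  -- leave room to absorb this extra cell.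
  have h1 := le_mul_card hω (insert 0 (ballPts ω r)) (Metric.closedBall 0 (r - cellDiam ω)) (by
    intro w hw
    rw [mem_closedBall_zero_iff] at hw
    have h2 := norm_lat_idx_le hω w
    rw [Finset.mem_insert, mem_ballPts hω]
    by_cases h0 : idx ω w = 0
    · exact Or.inl h0
    · exact Or.inr ⟨h0, by linarith⟩)
  rw [volume_real_closedBall _ (by linarith)] at h1
  have h2 : ((insert 0 (ballPts ω r)).card : ℝ) ≤ (ballPts ω r).card + 1 := by
    exact_mod_cast Finset.card_insert_le _ _
  have h3 : ω.im * ((insert 0 (ballPts ω r)).card : ℝ) ≤ ω.im * ((ballPts ω r).card + 1) :=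
    mul_le_mul_of_nonneg_left h2 hω.le
  have h4 : 3 * (r - cellDiam ω) ^ 2 ≤ π * (r - cellDiam ω) ^ 2 :=
    mul_le_mul_of_nonneg_right Real.pi_gt_three.le (sq_nonneg _)
  have h5 : (3 / 4 * r) ^ 2 ≤ (r - cellDiam ω) ^ 2 := by
    apply pow_le_pow_left₀ <;> linarith
  nlinarith

/-- Dyadic decomposition: the points with `r/2 < |c| ≤ r` contribute `O(r^(2-s))`, and halving `r`
multiplies this bound by `2^(s-2) < 1`, so the series is geometric. It stops because a disc of
radius below 1 contains no nonzero point. -/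
theorem exists_sum_rpow_le (hω : 0 < ω.im) (hmin : ∀ c ≠ 0, 1 ≤ ‖lat ω c‖) {s : ℝ} (hs : 0 ≤ s)
    (hs2 : s < 2) : ∃ C : ℝ, 0 < C ∧ ∀ r : ℝ, 0 ≤ r →
      ∑ c ∈ ballPts ω r, ‖lat ω c‖ ^ (-s) ≤ C * r ^ (2 - s) := by
  obtain ⟨C, hC, h⟩ := exists_card_le hω
  set q : ℝ := (1 / 2 : ℝ) ^ (2 - s) with hq
  have hq0 : 0 < q := by positivity
  have hq1 : q < 1 := Real.rpow_lt_one (by norm_num) (by norm_num) (by linarith)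
  -- `B` is the fixed point of the recursion: `B = B q + C 2^s`.
  set B := C * 2 ^ s / (1 - q) with hB
  have hB0 : 0 < B := by have : 0 < 1 - q := by linarith
                         positivity
  refine ⟨B, hB0, ?_⟩
  have key : ∀ n : ℕ, ∀ r : ℝ, 0 ≤ r → r < 2 ^ n →
      ∑ c ∈ ballPts ω r, ‖lat ω c‖ ^ (-s) ≤ B * r ^ (2 - s) := by
    intro n
    induction n with
    | zero =>
      intro r hr0 hr
      have : ballPts ω r = ∅ := by
        rw [Finset.eq_empty_iff_forall_notMem]
        intro c hc
        rw [mem_ballPts hω] at hc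
        have := hmin c hc.1
        rw [pow_zero] at hr
        linarith
      rw [this, Finset.sum_empty]
      positivity
    | succ n ih =>
      intro r hr0 hr
      rcases lt_or_ge r 1 with hr1 | hr1
      · exact ih r hr0 (hr1.trans_le (one_le_pow₀ (by norm_num)))
      rw [← Finset.sum_filter_add_sum_filter_not _ (fun c => ‖lat ω c‖ ≤ r / 2)]
      have h1 : (ballPts ω r).filter (fun c => ‖lat ω c‖ ≤ r / 2) = ballPts ω (r / 2) := by
        ext c
        rw [Finset.mem_filter, mem_ballPts hω, mem_ballPts hω]
        constructor
        · rintro ⟨h1, h2⟩; exact ⟨h1.1, h2⟩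
        · rintro ⟨h1, h2⟩; exact ⟨⟨h1, by linarith⟩, h2⟩
      have h2 := ih (r / 2) (by linarith) (by rw [pow_succ] at hr; linarith)
      have h3 : ∑ c ∈ (ballPts ω r).filter (fun c => ¬ ‖lat ω c‖ ≤ r / 2), ‖lat ω c‖ ^ (-s) ≤
          C * r ^ 2 * (r / 2) ^ (-s) := by
        refine (Finset.sum_le_card_nsmul _ _ ((r / 2) ^ (-s)) ?_).trans ?_
        · intro c hc
          rw [Finset.mem_filter, not_le] at hc
          exact Real.rpow_le_rpow_of_nonpos (by linarith) hc.2.le (by linarith)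
        · rw [nsmul_eq_mul]
          refine mul_le_mul_of_nonneg_right (h _ r hr1 ?_) (by positivity)
          intro c hc
          rw [Finset.mem_filter, mem_ballPts hω] at hc
          exact hc.1.2
      rw [h1]
      have h4 : (r / 2) ^ (2 - s) = q * r ^ (2 - s) := by
        rw [hq, ← Real.mul_rpow (by norm_num) hr0]; ring_nf
      have h5 : r ^ 2 * (r / 2) ^ (-s) = 2 ^ s * r ^ (2 - s) := by
        rw [Real.div_rpow hr0 (by norm_num), Real.rpow_neg (by norm_num : (0:ℝ) ≤ 2), div_inv_eq_mul,
          sub_eq_add_neg, Real.rpow_add (by linarith), Real.rpow_two]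
        ring
      have h6 : B * (1 - q) = C * 2 ^ s := by
        rw [hB]; field_simp [(by linarith : (1 - q) ≠ 0)]
      calc _ ≤ B * (r / 2) ^ (2 - s) + C * r ^ 2 * (r / 2) ^ (-s) := add_le_add h2 h3
        _ = (B * q + C * 2 ^ s) * r ^ (2 - s) := by rw [h4, mul_assoc C, h5]; ring
        _ = B * r ^ (2 - s) := by rw [← h6]; ring
  intro r hr
  obtain ⟨n, hn⟩ := pow_unbounded_of_one_lt r (by norm_num : (1 : ℝ) < 2)
  exact key n r hr hn

/-- Few lattice points lie on a given line. -/
theorem exists_card_diagonal_le (hω : 0 < ω.im) : ∃ C : ℝ, 0 < C ∧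
    ∀ (T : Finset (ℤ × ℤ)) (p : ℤ × ℤ) (r : ℝ), p ≠ 0 → 1 ≤ r → (∀ c ∈ T, ‖lat ω c‖ ≤ r ∧
      Complex.normSq (lat ω (c + p)) = Complex.normSq (lat ω c)) → (T.card : ℝ) ≤ C * r := by
  set a := 1 + ‖ω‖ / ω.im with ha
  set b := 1 / ω.im with hb
  have hb0 : 0 < b := by positivity
  have ha0 : 0 < a := by positivity
  refine ⟨2 * (a + b) + 3, by positivity, ?_⟩
  intro T p r hp hr hT
  -- Equality of the two norms is an affine condition on `c`: after subtraction, `c - c'` is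
  -- orthogonal to `p`. Hence one of the two coordinates determines the point, which one depending
  -- on whether `Re p = 0`.
  have hline : ∀ c ∈ T, ∀ c' ∈ T, ((c.1 : ℝ) - c'.1) * (lat ω p).re +
      ((c.2 : ℝ) - c'.2) * (ω.re * (lat ω p).re + ω.im * (lat ω p).im) = 0 := by
    intro c hc c' hc'
    have h1 := (hT c hc).2
    have h2 := (hT c' hc').2
    simp only [lat_add, Complex.normSq_apply, Complex.add_re, Complex.add_im] at h1 h2
    simp only [lat_re c, lat_im c, lat_re c', lat_im c'] at h1 h2
    linear_combination h1 / 2 - h2 / 2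
  have hcard : ∀ g : ℤ × ℤ → ℤ, Set.InjOn g T → (∀ c ∈ T, |(g c : ℝ)| ≤ (a + b) * r) →
      (T.card : ℝ) ≤ (2 * (a + b) + 3) * r := by
    intro g hg hgb
    rw [← Finset.card_image_of_injOn hg]
    have hsub : T.image g ⊆ Finset.Icc (-⌈(a + b) * r⌉) ⌈(a + b) * r⌉ := by
      intro x hx
      obtain ⟨c, hc, rfl⟩ := Finset.mem_image.1 hx
      have h1 := (hgb c hc).trans (Int.le_ceil _)
      rw [abs_le] at h1
      exact Finset.mem_Icc.2 ⟨by exact_mod_cast h1.1, by exact_mod_cast h1.2⟩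
    have h2 := Finset.card_le_card hsub
    have hpos : 0 ≤ ⌈(a + b) * r⌉ := Int.ceil_nonneg (by positivity)
    rw [Int.card_Icc] at h2
    have h3 : ((T.image g).card : ℤ) ≤ 2 * ⌈(a + b) * r⌉ + 1 := by omega
    have h4 : ((T.image g).card : ℝ) ≤ 2 * ⌈(a + b) * r⌉ + 1 := by exact_mod_cast h3
    have h5 := Int.ceil_lt_add_one ((a + b) * r)
    nlinarith
  by_cases hre : (lat ω p).re = 0
  · have him : (lat ω p).im ≠ 0 := by
      intro him
      exact hp (lat_injective hω (by rw [lat_zero]; exact Complex.ext hre him))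
    refine hcard Prod.fst ?_ ?_
    · intro c hc c' hc' h
      have h1 := hline c hc c' hc'
      rw [hre, mul_zero, mul_zero, zero_add, zero_add, mul_eq_zero] at h1
      have h2 := h1.resolve_right (mul_ne_zero hω.ne' him)
      refine Prod.ext h ?_
      rw [sub_eq_zero] at h2
      exact_mod_cast h2
    · intro c hc
      refine (abs_fst_le hω c).trans ?_
      have := (hT c hc).1
      nlinarith
  · refine hcard Prod.snd ?_ ?_
    · intro c hc c' hc' h
      have h1 := hline c hc c' hc'
      have h : c.2 = c'.2 := h
      rw [h, sub_self, zero_mul, add_zero, mul_eq_zero] at h1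
      have h2 := h1.resolve_right hre
      refine Prod.ext ?_ h
      rw [sub_eq_zero] at h2
      exact_mod_cast h2
    · intro c hc
      refine (abs_snd_le hω c).trans ?_
      have := (hT c hc).1
      rw [div_eq_mul_one_div, ← hb]
      nlinarith

end Cells

/-! ### Linearisation and comparison of sums with integrals -/

section Riemann

variable {ω : ℂ}

theorem sum_ite_const_le (T : Finset (ℤ × ℤ)) (P : ℤ × ℤ → Prop) [DecidablePred P] (F X : ℝ)
    (hF : 0 ≤ F) (h : ((T.filter P).card : ℝ) ≤ X) :
    ∑ c ∈ T, (if P c then F else 0) ≤ F * X := by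
  rw [← Finset.sum_filter, Finset.sum_const, nsmul_eq_mul, mul_comm]
  exact mul_le_mul_of_nonneg_left h hF

/-- Comparison of the sum over a lattice of a bounded function on a disc with its integral. -/
theorem exists_abs_sum_ballPts_sub_integral_le (hω : 0 < ω.im) : ∃ C : ℝ, 0 < C ∧
    ∀ (r F : ℝ) (g : ℂ → ℝ) (e : ℤ × ℤ → ℝ), 1 ≤ r → 0 ≤ F → Measurable g → (∀ w, |g w| ≤ F) →
      (∀ c, 0 ≤ e c) →
      (∀ c w, 2 * cellDiam ω < ‖lat ω c‖ → ‖lat ω c‖ < r - cellDiam ω →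
        ‖w - lat ω c‖ ≤ cellDiam ω → |g (lat ω c) - g w| ≤ e c) →
      |∑ c ∈ ballPts ω r, g (lat ω c) - 1 / ω.im * ∫ w in Metric.closedBall 0 r, g w| ≤
        C * (F * r) + ∑ c ∈ ballPts ω (r + cellDiam ω), e c := by
  classical
  obtain ⟨C₁, hC₁, hcard⟩ := exists_card_le hω
  obtain ⟨C₂, hC₂, hann⟩ := exists_card_annulus_le hω
  have hd := one_le_cellDiam (ω := ω)
  set d := cellDiam ω with hdd
  refine ⟨2 * (C₁ * (2 * d) ^ 2) + 2 * (C₂ * ((1 + d) * (2 * d + 1))), by positivity, ?_⟩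
  intro r F g e hr hF hgm hg he hvar
  -- Enlarging the radius and adding the origin makes the cells of `T` cover the whole disc.
  set T : Finset (ℤ × ℤ) := insert 0 (ballPts ω (r + d)) with hT
  have hTnorm : ∀ c, c ∈ T ↔ ‖lat ω c‖ ≤ r + d := by
    intro c
    rw [hT, Finset.mem_insert, mem_ballPts hω]
    by_cases h0 : c = 0
    · subst h0; simp; linarith
    · simp [h0]
  have hsub : ballPts ω r ⊆ T := by
    intro c hc
    rw [mem_ballPts hω] at hc
    rw [hTnorm]; linarith
  -- Three sources of error: cells near the origin, where `g` need not be regular; cells near the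
  -- boundary circle; and the oscillation of `g` inside the other cells.
  set e' : ℤ × ℤ → ℝ := fun c => (if ‖lat ω c‖ ≤ 2 * d then 2 * F else 0) +
    (if r - d ≤ ‖lat ω c‖ then 2 * F else 0) + (if c ∈ ballPts ω (r + d) then e c else 0) with he'
  have hint : Integrable ((Metric.closedBall (0 : ℂ) r).indicator g) := by
    rw [integrable_indicator_iff measurableSet_closedBall]
    exact Measure.integrableOn_of_bounded measure_closedBall_lt_top.ne
      hgm.aestronglyMeasurable (Eventually.of_forall hg)
  have hmain := abs_sum_sub_integral_le hω T ((Metric.closedBall (0 : ℂ) r).indicator g) hint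
    (fun c => if c ∈ ballPts ω r then g (lat ω c) else 0) e' (by
      intro w hw
      have hdist := norm_sub_lat_idx_le hω w
      have hn1 := norm_le_of_idx hω w
      rw [hTnorm] at hw
      simp only [he']
      generalize idx ω w = c at *
      have hb1 : |if c ∈ ballPts ω r then g (lat ω c) else 0| ≤ F := by
        split_ifs
        · exact hg _
        · simpa using hF
      have hb2 : |(Metric.closedBall (0 : ℂ) r).indicator g w| ≤ F := by
        by_cases h : w ∈ Metric.closedBall (0 : ℂ) r
        · rw [Set.indicator_of_mem h]; exact hg w
        · rw [Set.indicator_of_notMem h]; simpa using hF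
      have htriv := (abs_sub _ _).trans (add_le_add hb1 hb2)
      have hnn : 0 ≤ (if c ∈ ballPts ω (r + d) then e c else 0) := by
        split_ifs
        · exact he c
        · exact le_rfl
      by_cases h1 : ‖lat ω c‖ ≤ 2 * d
      · rw [if_pos h1]
        have : 0 ≤ (if r - d ≤ ‖lat ω c‖ then 2 * F else 0) := by split_ifs <;> linarith
        linarith
      by_cases h2 : r - d ≤ ‖lat ω c‖
      · rw [if_pos h2, if_neg h1]
        linarith
      rw [if_neg h1, if_neg h2]
      rw [not_le] at h1 h2
      have hc0 : c ≠ 0 := by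
        rintro rfl
        rw [lat_zero, norm_zero] at h1
        linarith
      have hm1 : c ∈ ballPts ω r := (mem_ballPts hω).2 ⟨hc0, by linarith⟩
      have hm2 : c ∈ ballPts ω (r + d) := (mem_ballPts hω).2 ⟨hc0, by linarith⟩
      have hm3 : w ∈ Metric.closedBall (0 : ℂ) r := by
        rw [mem_closedBall_zero_iff]; linarith
      rw [if_pos hm1, if_pos hm2, Set.indicator_of_mem hm3, zero_add, zero_add]
      exact hvar c w h1 h2 hdist) (by
      intro w hw
      rw [hTnorm, not_le] at hw
      have := norm_lat_idx_le hω w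
      apply Set.indicator_of_notMem
      rw [mem_closedBall_zero_iff, not_le]
      linarith)
  rw [integral_indicator measurableSet_closedBall, ← Finset.sum_filter, Finset.filter_mem_eq_inter,
    Finset.inter_eq_right.2 hsub] at hmain
  have hsum : ∑ c ∈ T, e' c ≤ (2 * (C₁ * (2 * d) ^ 2) + 2 * (C₂ * ((1 + d) * (2 * d + 1)))) * (F * r) +
      ∑ c ∈ ballPts ω (r + d), e c := by
    rw [he', Finset.sum_add_distrib, Finset.sum_add_distrib]
    have h1 := sum_ite_const_le T (fun c => ‖lat ω c‖ ≤ 2 * d) (2 * F) (C₁ * (2 * d) ^ 2)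
      (by linarith) (hcard _ (2 * d) (by linarith) (fun c hc => (Finset.mem_filter.1 hc).2))
    have h2 := sum_ite_const_le T (fun c => r - d ≤ ‖lat ω c‖) (2 * F)
      (C₂ * ((r + d) * (r + d - (r - d) + 1))) (by linarith)
      (hann _ (r - d) (r + d) (by linarith) (by linarith) (fun c hc =>
        ⟨(Finset.mem_filter.1 hc).2, (hTnorm c).1 (Finset.mem_filter.1 hc).1⟩))
    have h3 : ∑ c ∈ T, (if c ∈ ballPts ω (r + d) then e c else 0) = ∑ c ∈ ballPts ω (r + d), e c := by
      rw [← Finset.sum_filter, Finset.filter_mem_eq_inter, Finset.inter_eq_right.2]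
      exact Finset.subset_insert _ _
    rw [h3]
    have h4 : r + d ≤ (1 + d) * r := by nlinarith
    have h5 : C₂ * ((r + d) * (r + d - (r - d) + 1)) ≤ C₂ * ((1 + d) * (2 * d + 1)) * r := by
      rw [mul_assoc]
      refine mul_le_mul_of_nonneg_left ?_ hC₂.le
      nlinarith
    have h6 : C₁ * (2 * d) ^ 2 ≤ C₁ * (2 * d) ^ 2 * r := le_mul_of_one_le_right (by positivity) hr
    have h7 := mul_le_mul_of_nonneg_left h5 (by linarith : 0 ≤ 2 * F)
    have h8 := mul_le_mul_of_nonneg_left h6 (by linarith : 0 ≤ 2 * F)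
    calc _ ≤ 2 * F * (C₁ * (2 * d) ^ 2 * r) + 2 * F * (C₂ * ((1 + d) * (2 * d + 1)) * r) +
          ∑ c ∈ ballPts ω (r + d), e c := by linarith
      _ = _ := by ring
  have hfac : ∑ c ∈ ballPts ω r, g (lat ω c) - 1 / ω.im * ∫ w in Metric.closedBall 0 r, g w =
      1 / ω.im * (ω.im * ∑ c ∈ ballPts ω r, g (lat ω c) - ∫ w in Metric.closedBall 0 r, g w) := by
    field_simp
  rw [hfac, abs_mul, abs_of_pos (by positivity)]
  calc _ ≤ 1 / ω.im * (ω.im * ∑ c ∈ T, e' c) := mul_le_mul_of_nonneg_left hmain (by positivity)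
    _ = ∑ c ∈ T, e' c := by field_simp
    _ ≤ _ := hsum

/-- Riemann sums over the second variable. -/
theorem exists_riemann_snd (hω : 0 < ω.im) (hmin : ∀ c ≠ 0, 1 ≤ ‖lat ω c‖) {ε : ℝ} (hε : 0 < ε)
    (hε1 : ε ≤ 1) : ∃ C : ℝ, 0 < C ∧ ∀ (N κ F F' : ℝ) (f : ℝ → ℝ) (P : ℂ), 1 ≤ N → 0 ≤ κ → 0 ≤ F →
      0 ≤ F' → Continuous f → (∀ t, |f t| ≤ F) → (∀ s t, |f s - f t| ≤ F' * |s - t|) →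
      |∑ z ∈ ballPts ω N, f (κ * (2 * (P / lat ω z).re)) -
        1 / ω.im * ∫ w in Metric.closedBall 0 N, f (κ * (2 * (P / w).re))| ≤
        C * (F * N + F' * κ * ‖P‖ * N ^ ε) := by
  obtain ⟨C₁, hC₁, h1⟩ := exists_abs_sum_ballPts_sub_integral_le hω
  obtain ⟨C₂, hC₂, h2⟩ := exists_sum_rpow_le hω hmin (s := 2 - ε) (by linarith) (by linarith)
  have hd := one_le_cellDiam (ω := ω)
  set d := cellDiam ω with hdd
  refine ⟨C₁ + 4 * d * (C₂ * (1 + d)), by positivity, ?_⟩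
  intro N κ F F' f P hN hκ hF hF' hf hfF hfL
  set B := 4 * d * (F' * κ * ‖P‖) with hB
  have hB0 : 0 ≤ B := by positivity
  have hmeas : Measurable fun w : ℂ => f (κ * (2 * (P / w).re)) :=
    hf.measurable.comp (((Complex.measurable_re.comp (measurable_id.const_div P)).const_mul 2).const_mul κ)
  have h3 := h1 N F (fun w => f (κ * (2 * (P / w).re))) (fun c => B * ‖lat ω c‖ ^ (-(2 - ε))) hN hF
    hmeas (fun w => hfF _) (fun c => by positivity) (by
      intro c w hc1 hc2 hw
      set z := lat ω c
      have hz : 0 < ‖z‖ := by linarith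
      have hz0 : z ≠ 0 := norm_pos_iff.1 hz
      have hw1 : ‖z‖ / 2 ≤ ‖w‖ := by
        have := norm_sub_norm_le z w
        rw [norm_sub_rev] at this
        linarith
      have hw0 : w ≠ 0 := norm_pos_iff.1 (by linarith)
      refine (hfL _ _).trans ?_
      have e1 : κ * (2 * (P / z).re) - κ * (2 * (P / w).re) = κ * 2 * (P * (w - z) / (z * w)).re := by
        rw [← mul_sub, ← mul_sub, ← Complex.sub_re, mul_assoc]
        congr 4
        field_simp
      have e2 : |(P * (w - z) / (z * w)).re| ≤ ‖P‖ * d * (2 * ‖z‖ ^ (-(2 - ε))) := by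
        refine (Complex.abs_re_le_norm _).trans ?_
        rw [norm_div, norm_mul, norm_mul, div_eq_mul_inv]
        refine mul_le_mul (mul_le_mul_of_nonneg_left hw (norm_nonneg _)) ?_ (by positivity)
          (by positivity)
        -- The oscillation over a cell is of order `|z|^(-2)`, whose lattice sum grows
        -- logarithmically. Giving up `ε` in the exponent turns the logarithm into `N^ε`.
        have e3 : ‖z‖ ^ (-(2 : ℝ)) ≤ ‖z‖ ^ (-(2 - ε)) :=
          Real.rpow_le_rpow_of_exponent_le (by linarith) (by linarith)
        refine le_trans ?_ (mul_le_mul_of_nonneg_left e3 (by norm_num))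
        rw [Real.rpow_neg hz.le, Real.rpow_two, ← div_eq_mul_inv, inv_eq_one_div,
          div_le_div_iff₀ (by positivity) (by positivity)]
        nlinarith
      rw [e1, abs_mul, abs_of_nonneg (by positivity : 0 ≤ κ * 2)]
      calc F' * (κ * 2 * |(P * (w - z) / (z * w)).re|)
          ≤ F' * (κ * 2 * (‖P‖ * d * (2 * ‖z‖ ^ (-(2 - ε))))) := by gcongr
        _ = B * ‖z‖ ^ (-(2 - ε)) := by rw [hB]; ring)
  refine h3.trans ?_
  rw [← Finset.mul_sum]
  have h4 := h2 (N + d) (by linarith)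
  have h5 : (N + d) ^ (2 - (2 - ε)) ≤ (1 + d) * N ^ ε := by
    rw [sub_sub_cancel]
    calc (N + d) ^ ε ≤ ((1 + d) * N) ^ ε :=
          Real.rpow_le_rpow (by linarith) (by nlinarith) hε.le
      _ = (1 + d) ^ ε * N ^ ε := Real.mul_rpow (by linarith) (by linarith)
      _ ≤ (1 + d) ^ (1 : ℝ) * N ^ ε := by
          gcongr
          linarith
      _ = _ := by rw [Real.rpow_one]
  have h6 : ∑ c ∈ ballPts ω (N + d), ‖lat ω c‖ ^ (-(2 - ε)) ≤ C₂ * ((1 + d) * N ^ ε) :=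
    h4.trans (mul_le_mul_of_nonneg_left h5 hC₂.le)
  calc _ ≤ C₁ * (F * N) + B * (C₂ * ((1 + d) * N ^ ε)) := by gcongr
    _ ≤ C₁ * (F * N + F' * κ * ‖P‖ * N ^ ε) + 4 * d * (C₂ * (1 + d)) * (F * N + F' * κ * ‖P‖ * N ^ ε) := by
        have a1 : C₁ * (F * N) ≤ C₁ * (F * N + F' * κ * ‖P‖ * N ^ ε) := by
          gcongr; exact le_add_of_nonneg_right (by positivity)
        have a2 : B * (C₂ * ((1 + d) * N ^ ε)) = 4 * d * (C₂ * (1 + d)) * (F' * κ * ‖P‖ * N ^ ε) := by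
          rw [hB]; ring
        rw [a2]
        have a3 : 4 * d * (C₂ * (1 + d)) * (F' * κ * ‖P‖ * N ^ ε) ≤
            4 * d * (C₂ * (1 + d)) * (F * N + F' * κ * ‖P‖ * N ^ ε) := by
          gcongr; exact le_add_of_nonneg_left (by positivity)
        linarith
    _ = _ := by ring

/-- Riemann sums over the first variable. -/
theorem exists_riemann_fst (hω : 0 < ω.im) : ∃ C : ℝ, 0 < C ∧
    ∀ (R κ F F' : ℝ) (f : ℝ → ℝ) (w : ℂ), 1 ≤ R → 0 ≤ κ → 0 ≤ F → 0 ≤ F' → Continuous f →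
      (∀ t, |f t| ≤ F) → (∀ s t, |f s - f t| ≤ F' * |s - t|) →
      |∑ p ∈ ballPts ω R, f (κ * (2 * (lat ω p / w).re)) -
        1 / ω.im * ∫ p in Metric.closedBall 0 R, f (κ * (2 * (p / w).re))| ≤
        C * (F * R + F' * κ * R ^ 2 * ‖w‖⁻¹) := by
  obtain ⟨C₁, hC₁, h1⟩ := exists_abs_sum_ballPts_sub_integral_le hω
  obtain ⟨C₂, hC₂, h2⟩ := exists_card_le hω
  have hd := one_le_cellDiam (ω := ω)
  set d := cellDiam ω with hdd
  refine ⟨C₁ + 2 * d * (C₂ * (1 + d) ^ 2), by positivity, ?_⟩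
  intro R κ F F' f w hR hκ hF hF' hf hfF hfL
  set B := 2 * d * (F' * κ * ‖w‖⁻¹) with hB
  have hB0 : 0 ≤ B := by positivity
  have hmeas : Measurable fun p : ℂ => f (κ * (2 * (p / w).re)) :=
    hf.measurable.comp (((Complex.measurable_re.comp (measurable_id.div_const w)).const_mul 2).const_mul κ)
  have h3 := h1 R F (fun p => f (κ * (2 * (p / w).re))) (fun _ => B) hR hF
    hmeas (fun w => hfF _) (fun c => hB0) (by
      intro c p hc1 hc2 hp
      refine (hfL _ _).trans ?_
      have e1 : κ * (2 * (lat ω c / w).re) - κ * (2 * (p / w).re) =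
          κ * 2 * ((lat ω c - p) / w).re := by
        rw [sub_div, Complex.sub_re]; ring
      have e2 : |((lat ω c - p) / w).re| ≤ d * ‖w‖⁻¹ := by
        refine (Complex.abs_re_le_norm _).trans ?_
        rw [norm_div, div_eq_mul_inv, norm_sub_rev]
        gcongr
      rw [e1, abs_mul, abs_of_nonneg (by positivity : 0 ≤ κ * 2)]
      calc F' * (κ * 2 * |((lat ω c - p) / w).re|)
          ≤ F' * (κ * 2 * (d * ‖w‖⁻¹)) := by gcongr
        _ = B := by rw [hB]; ring)
  refine h3.trans ?_
  rw [Finset.sum_const, nsmul_eq_mul]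
  have h4 := h2 (ballPts ω (R + d)) (R + d) (by linarith) (fun c hc => ((mem_ballPts hω).1 hc).2)
  have h5 : (R + d) ^ 2 ≤ (1 + d) ^ 2 * R ^ 2 := by
    rw [← mul_pow]
    exact pow_le_pow_left₀ (by linarith) (by nlinarith) 2
  have h6 : ((ballPts ω (R + d)).card : ℝ) ≤ C₂ * ((1 + d) ^ 2 * R ^ 2) :=
    h4.trans (mul_le_mul_of_nonneg_left h5 hC₂.le)
  have h7 := mul_le_mul_of_nonneg_right h6 hB0
  have h8 : C₂ * ((1 + d) ^ 2 * R ^ 2) * B = 2 * d * (C₂ * (1 + d) ^ 2) * (F' * κ * R ^ 2 * ‖w‖⁻¹) := by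
    rw [hB]; ring
  have a1 : 0 ≤ C₁ * (F' * κ * R ^ 2 * ‖w‖⁻¹) := by positivity
  have a2 : 0 ≤ 2 * d * (C₂ * (1 + d) ^ 2) * (F * R) := by positivity
  linarith

/-- The linear approximation of the logarithm of the quotient of two norms. -/
theorem abs_log_normSq_sub_le {p z : ℂ} (hz : z ≠ 0) (hp : 2 * ‖p‖ ≤ ‖z‖) :
    |Real.log (Complex.normSq (z + p)) - Real.log (Complex.normSq z) - 2 * (p / z).re| ≤
      2 * (‖p‖ / ‖z‖) ^ 2 := by
  have hz' : 0 < ‖z‖ := norm_pos_iff.2 hz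
  have hu : ‖p / z‖ ≤ 1 / 2 := by
    rw [norm_div, div_le_iff₀ hz']; linarith
  have hu1 : ‖p / z‖ < 1 := by linarith
  have h1 : z + p = z * (1 + p / z) := by field_simp
  have hne : 1 + p / z ≠ 0 := by
    intro h
    have : p / z = -1 := by linear_combination h
    rw [this, norm_neg, norm_one] at hu1
    exact lt_irrefl _ hu1
  have h2 : Real.log (Complex.normSq (z + p)) - Real.log (Complex.normSq z) =
      2 * (Complex.log (1 + p / z)).re := by
    rw [h1, Complex.normSq_mul, Real.log_mul (Complex.normSq_pos.2 hz).ne'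
      (Complex.normSq_pos.2 hne).ne', Complex.log_re, Complex.normSq_eq_norm_sq (1 + p / z),
      Real.log_pow]
    push_cast; ring
  have h3 := Complex.norm_log_one_add_sub_self_le hu1
  rw [h2, ← mul_sub, ← Complex.sub_re, abs_mul, abs_two, ← norm_div]
  have h4 : (1 - ‖p / z‖)⁻¹ ≤ 2 := by
    rw [inv_le_comm₀ (by linarith) (by norm_num)]; linarith
  have h5 : ‖p / z‖ ^ 2 * (1 - ‖p / z‖)⁻¹ / 2 ≤ ‖p / z‖ ^ 2 := by
    have := mul_le_mul_of_nonneg_left h4 (sq_nonneg ‖p / z‖)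
    linarith
  have h6 := (Complex.abs_re_le_norm _).trans (h3.trans h5)
  linarith

open Classical in
/-- Linearisation, for a given difference `p`. -/
theorem exists_linearise (hω : 0 < ω.im) (hmin : ∀ c ≠ 0, 1 ≤ ‖lat ω c‖) {ε : ℝ} (hε : 0 < ε)
    (hε1 : ε ≤ 1) : ∃ C : ℝ, 0 < C ∧ ∀ (N R κ F F' : ℝ) (f : ℝ → ℝ) (p : ℤ × ℤ), 1 ≤ R → R ≤ N →
      0 ≤ κ → 0 ≤ F → 0 ≤ F' → (∀ t, |f t| ≤ F) → (∀ s t, |f s - f t| ≤ F' * |s - t|) →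
      p ∈ ballPts ω R →
      |∑ z ∈ (ballPts ω N).filter (fun z => z + p ∈ ballPts ω N ∧
          Complex.normSq (lat ω (z + p)) ≠ Complex.normSq (lat ω z)),
          f (κ * (Real.log (Complex.normSq (lat ω (z + p))) -
            Real.log (Complex.normSq (lat ω z)))) -
        ∑ z ∈ ballPts ω N, f (κ * (2 * (lat ω p / lat ω z).re))| ≤
        C * (F * (N * R) + F' * κ * R ^ 2 * N ^ ε) := by
  obtain ⟨C₁, hC₁, hcard⟩ := exists_card_le hω
  obtain ⟨C₂, hC₂, hann⟩ := exists_card_annulus_le hω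
  obtain ⟨C₃, hC₃, hdiag⟩ := exists_card_diagonal_le hω
  obtain ⟨C₄, hC₄, hsum⟩ := exists_sum_rpow_le hω hmin (s := 2 - ε) (by linarith) (by linarith)
  refine ⟨8 * C₁ + 4 * C₂ + 2 * C₃ + 2 * C₄, by positivity, ?_⟩
  intro N R κ F F' f p hR hRN hκ hF hF' hfF hfL hp
  rw [mem_ballPts hω] at hp
  have hN : 1 ≤ N := hR.trans hRN
  rw [Finset.sum_filter, ← Finset.sum_sub_distrib]
  -- The four terms account for small `z`, where `p/z` is not small; `z` near the edge, where `z +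
  -- p` may leave the disc; `z` excluded because the two norms agree; and the quadratic remainder of
  -- the logarithm.
  set e : ℤ × ℤ → ℝ := fun z => (if ‖lat ω z‖ ≤ 2 * R then 2 * F else 0) +
    (if N - R ≤ ‖lat ω z‖ then 2 * F else 0) +
    (if Complex.normSq (lat ω (z + p)) = Complex.normSq (lat ω z) then 2 * F else 0) +
    2 * (F' * κ * R ^ 2) * ‖lat ω z‖ ^ (-(2 - ε)) with he
  have hbound : ∀ z ∈ ballPts ω N,
      |(if z + p ∈ ballPts ω N ∧ Complex.normSq (lat ω (z + p)) ≠ Complex.normSq (lat ω z) then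
          f (κ * (Real.log (Complex.normSq (lat ω (z + p))) -
            Real.log (Complex.normSq (lat ω z)))) else 0) -
        f (κ * (2 * (lat ω p / lat ω z).re))| ≤ e z := by
    intro z hz
    rw [mem_ballPts hω] at hz
    have hz1 := hmin z hz.1
    have hz0 : lat ω z ≠ 0 := norm_pos_iff.1 (by linarith)
    have hlast : 0 ≤ 2 * (F' * κ * R ^ 2) * ‖lat ω z‖ ^ (-(2 - ε)) := by positivity
    have htriv : |(if z + p ∈ ballPts ω N ∧ Complex.normSq (lat ω (z + p)) ≠
          Complex.normSq (lat ω z) then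
          f (κ * (Real.log (Complex.normSq (lat ω (z + p))) -
            Real.log (Complex.normSq (lat ω z)))) else 0) -
        f (κ * (2 * (lat ω p / lat ω z).re))| ≤ 2 * F := by
      refine (abs_sub _ _).trans ?_
      have : |(if z + p ∈ ballPts ω N ∧ Complex.normSq (lat ω (z + p)) ≠
          Complex.normSq (lat ω z) then
          f (κ * (Real.log (Complex.normSq (lat ω (z + p))) -
            Real.log (Complex.normSq (lat ω z)))) else 0)| ≤ F := by
        split_ifs
        · exact hfF _
        · simpa using hF
      linarith [hfF (κ * (2 * (lat ω p / lat ω z).re))]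
    simp only [he]
    have hnn : ∀ (P : Prop) [Decidable P], 0 ≤ (if P then 2 * F else 0) := by
      intro P _; split_ifs <;> linarith
    have n1 := hnn (‖lat ω z‖ ≤ 2 * R)
    have n2 := hnn (N - R ≤ ‖lat ω z‖)
    have n3 := hnn (Complex.normSq (lat ω (z + p)) = Complex.normSq (lat ω z))
    by_cases c1 : ‖lat ω z‖ ≤ 2 * R
    · rw [if_pos c1]; linarith
    by_cases c2 : N - R ≤ ‖lat ω z‖
    · rw [if_pos c2]; linarith
    by_cases c3 : Complex.normSq (lat ω (z + p)) = Complex.normSq (lat ω z)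
    · rw [if_pos c3]; linarith
    rw [not_le] at c1 c2
    have hzp : z + p ∈ ballPts ω N := by
      rw [mem_ballPts hω, lat_add]
      refine ⟨?_, (norm_add_le _ _).trans (by linarith)⟩
      intro h0
      have : lat ω z = -lat ω p := by
        rw [← add_eq_zero_iff_eq_neg, ← lat_add, h0, lat_zero]
      rw [this, norm_neg] at c1
      linarith
    rw [if_pos ⟨hzp, c3⟩]
    have hlog := abs_log_normSq_sub_le (p := lat ω p) hz0 (by linarith)
    rw [lat_add] at n3 ⊢
    refine (hfL _ _).trans ?_
    rw [← mul_sub, abs_mul, abs_of_nonneg hκ]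
    have h7 : (‖lat ω p‖ / ‖lat ω z‖) ^ 2 ≤ R ^ 2 * ‖lat ω z‖ ^ (-(2 - ε)) := by
      rw [div_pow, div_eq_mul_inv]
      have e3 : ‖lat ω z‖ ^ (-(2 : ℝ)) ≤ ‖lat ω z‖ ^ (-(2 - ε)) :=
        Real.rpow_le_rpow_of_exponent_le (by linarith) (by linarith)
      rw [Real.rpow_neg (norm_nonneg _), Real.rpow_two] at e3
      exact mul_le_mul (pow_le_pow_left₀ (norm_nonneg _) hp.2 2) e3 (by positivity) (by positivity)
    have h8 : F' * (κ * |Real.log (Complex.normSq (lat ω z + lat ω p)) -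
        Real.log (Complex.normSq (lat ω z)) - 2 * (lat ω p / lat ω z).re|) ≤
        F' * (κ * (2 * (R ^ 2 * ‖lat ω z‖ ^ (-(2 - ε))))) := by
      gcongr
      linarith
    have h9 : F' * (κ * (2 * (R ^ 2 * ‖lat ω z‖ ^ (-(2 - ε))))) =
      2 * (F' * κ * R ^ 2) * ‖lat ω z‖ ^ (-(2 - ε)) := by ring
    linarith
  refine (Finset.abs_sum_le_sum_abs _ _).trans ((Finset.sum_le_sum hbound).trans ?_)
  simp only [he]
  rw [Finset.sum_add_distrib, Finset.sum_add_distrib, Finset.sum_add_distrib, ← Finset.mul_sum]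
  have s1 := sum_ite_const_le (ballPts ω N) (fun c => ‖lat ω c‖ ≤ 2 * R) (2 * F) (C₁ * (2 * R) ^ 2)
      (by linarith) (hcard _ (2 * R) (by linarith) (fun c hc => (Finset.mem_filter.1 hc).2))
  have s2 := sum_ite_const_le (ballPts ω N) (fun c => N - R ≤ ‖lat ω c‖) (2 * F)
      (C₂ * (N * (N - (N - R) + 1))) (by linarith)
      (hann _ (N - R) N (by linarith) (by linarith) (fun c hc =>
        ⟨(Finset.mem_filter.1 hc).2, ((mem_ballPts hω).1 (Finset.mem_filter.1 hc).1).2⟩))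
  have s3 := sum_ite_const_le (ballPts ω N)
      (fun z => Complex.normSq (lat ω (z + p)) = Complex.normSq (lat ω z)) (2 * F)
      (C₃ * N) (by linarith)
      (hdiag _ p N hp.1 hN (fun c hc =>
        ⟨((mem_ballPts hω).1 (Finset.mem_filter.1 hc).1).2, (Finset.mem_filter.1 hc).2⟩))
  have s4 := hsum N (by linarith)
  rw [sub_sub_cancel] at s4
  have s4' := mul_le_mul_of_nonneg_left s4 (by positivity : 0 ≤ 2 * (F' * κ * R ^ 2))
  have t1 : 2 * F * (C₁ * (2 * R) ^ 2) ≤ 8 * C₁ * (F * (N * R)) := by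
    have : R * R ≤ N * R := by gcongr
    calc _ = 8 * C₁ * (F * (R * R)) := by ring
      _ ≤ _ := by gcongr
  have t2 : 2 * F * (C₂ * (N * (N - (N - R) + 1))) ≤ 4 * C₂ * (F * (N * R)) := by
    calc _ = 2 * C₂ * (F * (N * (R + 1))) := by ring
      _ ≤ 2 * C₂ * (F * (N * (2 * R))) := by gcongr; linarith
      _ = _ := by ring
  have t3 : 2 * F * (C₃ * N) ≤ 2 * C₃ * (F * (N * R)) := by
    calc _ = 2 * C₃ * (F * (N * 1)) := by ring
      _ ≤ _ := by gcongr
  have t4 : 2 * (F' * κ * R ^ 2) * (C₄ * N ^ ε) = 2 * C₄ * (F' * κ * R ^ 2 * N ^ ε) := by ring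
  have u1 : 0 ≤ 2 * C₄ * (F * (N * R)) := by positivity
  have u2 : 0 ≤ (8 * C₁ + 4 * C₂ + 2 * C₃) * (F' * κ * R ^ 2 * N ^ ε) := by positivity
  linarith

/-- The lattice sums that define the empirical measures, compared with integrals. -/
theorem exists_abs_pairSum_sub_le (hω : 0 < ω.im) (hmin : ∀ c ≠ 0, 1 ≤ ‖lat ω c‖) {ε : ℝ}
    (hε : 0 < ε) (hε1 : ε ≤ 1) : ∃ C : ℝ, 0 < C ∧ ∀ (N R κ F F' : ℝ) (f : ℝ → ℝ), 1 ≤ R → R ≤ N →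
      0 ≤ κ → 0 ≤ F → 0 ≤ F' → Continuous f → (∀ t, |f t| ≤ F) →
      (∀ s t, |f s - f t| ≤ F' * |s - t|) →
      |pairSum ω N R κ f -
        1 / ω.im * ∑ p ∈ ballPts ω R,
          ∫ w in Metric.closedBall 0 N, f (κ * (2 * (lat ω p / w).re))| ≤
        C * (F * N * R ^ 3 + F' * κ * R ^ 4 * N ^ ε) := by
  obtain ⟨C₁, hC₁, h1⟩ := exists_linearise hω hmin hε hε1
  obtain ⟨C₂, hC₂, h2⟩ := exists_riemann_snd hω hmin hε hε1
  obtain ⟨C₃, hC₃, hcard⟩ := exists_card_le hω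
  refine ⟨C₃ * (C₁ + C₂), by positivity, ?_⟩
  intro N R κ F F' f hR hRN hκ hF hF' hf hfF hfL
  have hN : 1 ≤ N := hR.trans hRN
  rw [pairSum, Finset.mul_sum, ← Finset.sum_sub_distrib]
  refine (Finset.abs_sum_le_sum_abs _ _).trans ?_
  refine (Finset.sum_le_card_nsmul _ _ ((C₁ + C₂) * (F * (N * R) + F' * κ * R ^ 2 * N ^ ε)) ?_).trans ?_
  · intro p hp
    have a1 := h1 N R κ F F' f p hR hRN hκ hF hF' hfF hfL hp
    have a2 := h2 N κ F F' f (lat ω p) hN hκ hF hF' hf hfF hfL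
    -- This crude bound, valid since `R ≥ 1`, lets the Riemann sum error be absorbed into the
    -- linearisation error.
    have hpR : ‖lat ω p‖ ≤ R ^ 2 := ((mem_ballPts hω).1 hp).2.trans (by nlinarith)
    have a3 : C₂ * (F * N + F' * κ * ‖lat ω p‖ * N ^ ε) ≤
        C₂ * (F * (N * R) + F' * κ * R ^ 2 * N ^ ε) := by
      gcongr
      nlinarith
    refine (abs_sub_le _ (∑ z ∈ ballPts ω N, f (κ * (2 * (lat ω p / lat ω z).re))) _).trans ?_
    linarith
  · rw [nsmul_eq_mul]
    have a4 := hcard (ballPts ω R) R hR (fun c hc => ((mem_ballPts hω).1 hc).2)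
    calc _ ≤ (C₃ * R ^ 2) * ((C₁ + C₂) * (F * (N * R) + F' * κ * R ^ 2 * N ^ ε)) := by
          gcongr
      _ = _ := by ring

end Riemann

/-! ### Integrals over discs -/

section Integrals

theorem integral_closedBall_radial (u : ℝ → ℝ) {N : ℝ} (hN : 0 ≤ N) :
    ∫ w in Metric.closedBall (0 : ℂ) N, u ‖w‖ = 2 * π * ∫ r in (0 : ℝ)..N, r * u r := by
  have h1 : ∫ w in Metric.closedBall (0 : ℂ) N, u ‖w‖ = ∫ w : ℂ, (Iic N).indicator u ‖w‖ := by
    rw [← integral_indicator measurableSet_closedBall]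
    congr 1
    ext w
    simp only [Set.indicator, mem_closedBall_zero_iff, mem_Iic]
  rw [h1, integral_fun_norm_addHaar volume ((Iic N).indicator u), Complex.finrank_real_complex,
    volume_real_ball 1 zero_le_one, intervalIntegral.integral_of_le hN]
  have h2 : ∀ y : ℝ, y ^ (2 - 1) • (Iic N).indicator u y = (Iic N).indicator (fun r => r * u r) y := by
    intro y
    by_cases h : y ∈ Iic N
    · rw [Set.indicator_of_mem h, Set.indicator_of_mem h]; simp
    · rw [Set.indicator_of_notMem h, Set.indicator_of_notMem h]; simp
  simp_rw [h2]
  rw [setIntegral_indicator measurableSet_Iic, Ioi_inter_Iic]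
  simp
  ring

theorem integrableOn_closedBall_norm_inv (N : ℝ) :
    IntegrableOn (fun w : ℂ => ‖w‖⁻¹) (Metric.closedBall 0 N) := by
  have h1 : (Metric.closedBall (0 : ℂ) N).indicator (fun w : ℂ => ‖w‖⁻¹) =
      fun w => (Iic N).indicator (fun r => r⁻¹) ‖w‖ := by
    ext w
    simp only [Set.indicator, mem_closedBall_zero_iff, mem_Iic]
  rw [← integrable_indicator_iff measurableSet_closedBall, h1, integrable_fun_norm_addHaar,
    Complex.finrank_real_complex]
  have h2 : EqOn ((Ioc 0 N).indicator (fun _ => (1 : ℝ)))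
      (fun y : ℝ => y ^ (2 - 1) • (Iic N).indicator (fun r => r⁻¹) y) (Ioi 0) := by
    intro y hy
    have hy : 0 < y := hy
    by_cases h : y ∈ Iic N
    · have h' : y ∈ Ioc 0 N := ⟨hy, h⟩
      simp only
      rw [Set.indicator_of_mem h, Set.indicator_of_mem h']
      simp [hy.ne']
    · have h' : y ∉ Ioc 0 N := fun h0 => h h0.2
      simp only
      rw [Set.indicator_of_notMem h, Set.indicator_of_notMem h']
      simp
  refine IntegrableOn.congr_fun ?_ h2 measurableSet_Ioi
  exact ((integrable_indicator_iff measurableSet_Ioc).2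
    (integrableOn_const (by simp))).integrableOn

theorem integral_closedBall_norm_inv {N : ℝ} (hN : 0 ≤ N) :
    ∫ w in Metric.closedBall (0 : ℂ) N, ‖w‖⁻¹ = 2 * π * N := by
  rw [integral_closedBall_radial (fun r => r⁻¹) hN, intervalIntegral.integral_of_le hN,
    setIntegral_congr_fun measurableSet_Ioc (g := fun _ => (1 : ℝ))
      (fun r hr => mul_inv_cancel₀ hr.1.ne')]
  simp [hN]

theorem integral_closedBall_rotate (g : ℂ → ℝ) (N : ℝ) {c : ℂ} (hc : ‖c‖ = 1) :
    ∫ w in Metric.closedBall (0 : ℂ) N, g (c * w) = ∫ w in Metric.closedBall (0 : ℂ) N, g w := by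
  let a : Circle := ⟨c, by simp [Submonoid.unitSphere, hc]⟩
  have h1 : MeasurePreserving (rotation a) := (rotation a).measurePreserving
  have h2 := h1.setIntegral_preimage_emb (rotation a).toHomeomorph.measurableEmbedding g
    (Metric.closedBall 0 N)
  rw [← h2]
  have h3 : (rotation a) ⁻¹' (Metric.closedBall 0 N) = Metric.closedBall 0 N := by
    ext w
    rw [Set.mem_preimage, mem_closedBall_zero_iff, mem_closedBall_zero_iff,
      LinearIsometryEquiv.norm_map]
  rw [h3]
  simp_rw [rotation_apply]
  rfl

/-- Slice the disc by vertical chords; the one at abscissa `x` has length `2 √(R² - x²)`. Outside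
the disc the real square root is 0, so no cutoff is needed. -/
theorem integral_closedBall_re (g : ℝ → ℝ) (hg : Continuous g) {F : ℝ} (hF : ∀ t, |g t| ≤ F) (R : ℝ)
    (hR : 0 ≤ R) :
    ∫ p in Metric.closedBall (0 : ℂ) R, g p.re = ∫ x, g x * (2 * √(R ^ 2 - x ^ 2)) := by
  set S : Set (ℝ × ℝ) := {x | x.1 ^ 2 + x.2 ^ 2 ≤ R ^ 2} with hS
  have hSm : MeasurableSet S := by
    apply measurableSet_le <;> fun_prop
  have hpre : Complex.measurableEquivRealProd ⁻¹' S = Metric.closedBall (0 : ℂ) R := by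
    ext w
    rw [mem_closedBall_zero_iff, Set.mem_preimage, hS, Set.mem_ofPred_eq,
      ← pow_le_pow_iff_left₀ (norm_nonneg w) hR two_ne_zero, ← Complex.normSq_eq_norm_sq,
      Complex.normSq_apply, Complex.measurableEquivRealProd_apply]
    simp only [pow_two]
  have h1 := Complex.volume_preserving_equiv_real_prod.setIntegral_preimage_emb
    Complex.measurableEquivRealProd.measurableEmbedding (fun x : ℝ × ℝ => g x.1) S
  rw [hpre] at h1
  have h2 : ∫ p in Metric.closedBall (0 : ℂ) R, g p.re = ∫ x in S, g x.1 := h1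
  have hSfin : volume S ≠ ⊤ := by
    rw [← Complex.volume_preserving_equiv_real_prod.measure_preimage hSm.nullMeasurableSet, hpre]
    exact measure_closedBall_lt_top.ne
  have hint : Integrable (S.indicator (fun x : ℝ × ℝ => g x.1)) := by
    rw [integrable_indicator_iff hSm]
    exact Measure.integrableOn_of_bounded hSfin
      (hg.comp continuous_fst).aestronglyMeasurable (Eventually.of_forall fun x => hF _)
  rw [h2, ← integral_indicator hSm, Measure.volume_eq_prod, integral_prod _ hint]
  congr 1
  ext x
  have h3 : ∀ y, S.indicator (fun x : ℝ × ℝ => g x.1) (x, y) =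
      {y : ℝ | x ^ 2 + y ^ 2 ≤ R ^ 2}.indicator (fun _ => g x) y := by
    intro y
    simp only [Set.indicator, hS, Set.mem_ofPred_eq]
  have hm : MeasurableSet {y : ℝ | x ^ 2 + y ^ 2 ≤ R ^ 2} := by
    apply measurableSet_le <;> fun_prop
  simp_rw [h3]
  rw [integral_indicator hm, setIntegral_const, smul_eq_mul, mul_comm]
  congr 1
  by_cases h : 0 ≤ R ^ 2 - x ^ 2
  · have : {y : ℝ | x ^ 2 + y ^ 2 ≤ R ^ 2} = Icc (-√(R ^ 2 - x ^ 2)) (√(R ^ 2 - x ^ 2)) := by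
      ext y
      rw [Set.mem_ofPred_eq, mem_Icc, ← abs_le, ← Real.sqrt_sq_eq_abs, Real.sqrt_le_sqrt_iff h]
      constructor <;> intro <;> linarith
    rw [this, Real.volume_real_Icc_of_le (by linarith [Real.sqrt_nonneg (R ^ 2 - x ^ 2)])]
    ring
  · have : {y : ℝ | x ^ 2 + y ^ 2 ≤ R ^ 2} = ∅ := by
      ext y
      rw [Set.mem_ofPred_eq, Set.mem_empty_iff_false, iff_false]
      nlinarith [sq_nonneg y]
    rw [this, Real.sqrt_eq_zero_of_nonpos (by linarith)]
    simp

/-- The substitution `t = κ cos θ` would be exact with the Jacobian factor `sin θ`. On the support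
of `f(κ cos θ)` one has `|cos θ| ≤ A/κ`, hence `0 ≤ 1 - sin θ ≤ cos² θ` is small. The factor 2 comes
from the two half circles. -/
theorem integral_cos_sub_le (f : ℝ → ℝ) (hf : Continuous f) {F A κ : ℝ} (hF : ∀ t, |f t| ≤ F)
    (hA : 0 ≤ A) (hfA : ∀ t, A < |t| → f t = 0) (hκ : 0 < κ) :
    |(∫ θ in (-π)..π, f (κ * Real.cos θ)) - 2 / κ * ∫ t, f t| ≤ 16 * F * (A / κ) ^ (5 / 3 : ℝ) := by
  have hF0 : 0 ≤ F := (abs_nonneg _).trans (hF 0)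
  set X := A / κ with hX
  have hX0 : 0 ≤ X := by positivity
  have hc1 : Continuous fun θ => f (κ * Real.cos θ) := by fun_prop
  have heven : ∫ θ in (-π)..π, f (κ * Real.cos θ) = 2 * ∫ θ in (0 : ℝ)..π, f (κ * Real.cos θ) := by
    rw [← intervalIntegral.integral_add_adjacent_intervals (b := 0) (hc1.intervalIntegrable _ _)
      (hc1.intervalIntegrable _ _)]
    have := intervalIntegral.integral_comp_neg (a := 0) (b := π) (fun θ => f (κ * Real.cos θ))
    simp only [Real.cos_neg, neg_zero] at this
    rw [this]; ring
  have hsub : ∫ θ in (0 : ℝ)..π, f (κ * Real.cos θ) * (κ * Real.sin θ) = ∫ t in (-κ)..κ, f t := by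
    have h := intervalIntegral.integral_comp_mul_deriv (a := 0) (b := π)
      (f := fun θ => κ * Real.cos θ) (f' := fun θ => κ * (-Real.sin θ)) (g := f)
      (fun θ _ => (Real.hasDerivAt_cos θ).const_mul κ) (by fun_prop) hf
    rw [Real.cos_zero, Real.cos_pi, mul_one, mul_neg, mul_one,
      intervalIntegral.integral_symm (-κ) κ] at h
    rw [← neg_inj, ← h, ← intervalIntegral.integral_neg]
    congr 1
    ext θ
    simp only [Function.comp]
    ring
  have hdiff : |(∫ θ in (0 : ℝ)..π, f (κ * Real.cos θ)) - 1 / κ * ∫ t in (-κ)..κ, f t| ≤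
      F * X ^ (5 / 3 : ℝ) * 4 := by
    rw [← hsub, ← intervalIntegral.integral_const_mul, ← intervalIntegral.integral_sub
      (hc1.intervalIntegrable _ _) ((by fun_prop : Continuous fun θ =>
        1 / κ * (f (κ * Real.cos θ) * (κ * Real.sin θ))).intervalIntegrable _ _)]
    have := intervalIntegral.norm_integral_le_of_norm_le_const (a := 0) (b := π)
      (f := fun θ => f (κ * Real.cos θ) - 1 / κ * (f (κ * Real.cos θ) * (κ * Real.sin θ)))
      (C := F * X ^ (5 / 3 : ℝ)) (by
        intro θ hθ
        rw [uIoc_of_le Real.pi_pos.le] at hθ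
        have hs0 : 0 ≤ Real.sin θ := Real.sin_nonneg_of_nonneg_of_le_pi hθ.1.le hθ.2
        have hs1 := Real.sin_le_one θ
        have e1 : f (κ * Real.cos θ) - 1 / κ * (f (κ * Real.cos θ) * (κ * Real.sin θ)) =
            f (κ * Real.cos θ) * (1 - Real.sin θ) := by field_simp
        rw [e1, norm_mul, Real.norm_eq_abs, Real.norm_eq_abs, abs_of_nonneg (by linarith : 0 ≤ 1 - Real.sin θ)]
        by_cases h : A < |κ * Real.cos θ|
        · rw [hfA _ h, abs_zero, zero_mul]; positivity
        · rw [not_lt, abs_mul, abs_of_pos hκ] at h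
          have h1 : |Real.cos θ| ≤ X := by rw [hX, le_div_iff₀ hκ]; linarith
          have h2 : 1 - Real.sin θ ≤ |Real.cos θ| ^ (2 : ℝ) := by
            rw [Real.rpow_two, sq_abs]
            nlinarith [Real.sin_sq_add_cos_sq θ]
          -- The exponent is lowered below 2 because this error is later summed over `p` as
          -- `|p|^(-5/3)`, for which `exists_sum_rpow_le` applies. The value `5/3` leads to the
          -- exponent `2/3` of the final error terms.
          have h3 : |Real.cos θ| ^ (2 : ℝ) ≤ |Real.cos θ| ^ (5 / 3 : ℝ) := by
            rcases (abs_nonneg (Real.cos θ)).eq_or_lt with h0 | h0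
            · rw [← h0, Real.zero_rpow (by norm_num), Real.zero_rpow (by norm_num)]
            · exact Real.rpow_le_rpow_of_exponent_ge h0 (Real.abs_cos_le_one θ) (by norm_num)
          have h4 : |Real.cos θ| ^ (5 / 3 : ℝ) ≤ X ^ (5 / 3 : ℝ) :=
            Real.rpow_le_rpow (abs_nonneg _) h1 (by norm_num)
          exact mul_le_mul (hF _) (by linarith) (by linarith) hF0)
    refine this.trans ?_
    rw [sub_zero, abs_of_pos Real.pi_pos]
    exact mul_le_mul_of_nonneg_left Real.pi_le_four (by positivity)
  have hcompact : HasCompactSupport f := by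
    apply HasCompactSupport.of_support_subset_isCompact (isCompact_Icc (a := -A) (b := A))
    intro t ht
    rw [mem_Icc, ← abs_le]
    by_contra h
    exact ht (hfA t (not_le.1 h))
  have hfull : ∀ B : ℝ, A ≤ B → ∫ t in (-B)..B, f t = ∫ t, f t := by
    intro B hB
    rw [intervalIntegral.integral_of_le (by linarith), ← integral_Icc_eq_integral_Ioc]
    apply setIntegral_eq_integral_of_forall_compl_eq_zero
    intro t ht
    apply hfA
    rw [mem_Icc, ← abs_le, not_le] at ht
    linarith
  have hbd : ∀ B : ℝ, 0 ≤ B → |∫ t in (-B)..B, f t| ≤ F * (2 * B) := by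
    intro B hB
    have := intervalIntegral.norm_integral_le_of_norm_le_const (a := -B) (b := B) (f := f) (C := F)
      (fun t _ => hF t)
    rwa [sub_neg_eq_add, abs_of_nonneg (by linarith), ← two_mul] at this
  -- For `A ≤ κ` the truncated integral is the full one. For `A > κ` the ratio `A/κ` exceeds 1, so
  -- the trivial bound suffices.
  have htail : |1 / κ * (∫ t in (-κ)..κ, f t) - 1 / κ * ∫ t, f t| ≤ 4 * F * X ^ (5 / 3 : ℝ) := by
    rcases le_or_gt A κ with h | h
    · rw [hfull κ h, sub_self, abs_zero]; positivity
    · have hX1 : 1 ≤ X := by rw [hX, le_div_iff₀ hκ]; linarith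
      have h1 : X ≤ X ^ (5 / 3 : ℝ) := by
        calc X = X ^ (1 : ℝ) := (Real.rpow_one X).symm
          _ ≤ _ := Real.rpow_le_rpow_of_exponent_le hX1 (by norm_num)
      rw [← hfull A le_rfl]
      refine (abs_sub _ _).trans ?_
      rw [abs_mul, abs_mul, abs_of_pos (by positivity : 0 < 1 / κ)]
      have h2 := mul_le_mul_of_nonneg_left (hbd κ hκ.le) (by positivity : 0 ≤ 1 / κ)
      have h3 := mul_le_mul_of_nonneg_left (hbd A hA) (by positivity : 0 ≤ 1 / κ)
      have h4 : 1 / κ * (F * (2 * κ)) = 2 * F := by field_simp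
      have h5 : 1 / κ * (F * (2 * A)) = 2 * F * X := by rw [hX]; field_simp
      have h6 : 2 * F * 1 ≤ 2 * F * X ^ (5 / 3 : ℝ) := by gcongr; linarith
      have h7 : 2 * F * X ≤ 2 * F * X ^ (5 / 3 : ℝ) := by gcongr
      linarith
  rw [heven]
  have e : 2 * (∫ θ in (0 : ℝ)..π, f (κ * Real.cos θ)) - 2 / κ * ∫ t, f t =
      2 * (((∫ θ in (0 : ℝ)..π, f (κ * Real.cos θ)) - 1 / κ * ∫ t in (-κ)..κ, f t) +
        (1 / κ * (∫ t in (-κ)..κ, f t) - 1 / κ * ∫ t, f t)) := by ring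
  rw [e, abs_mul, abs_two]
  have := abs_add_le ((∫ θ in (0 : ℝ)..π, f (κ * Real.cos θ)) - 1 / κ * ∫ t in (-κ)..κ, f t)
    (1 / κ * (∫ t in (-κ)..κ, f t) - 1 / κ * ∫ t, f t)
  linarith

/-- The integrability statement allows a main term to be subtracted under the integral over the
radius. -/
theorem integral_closedBall_polar (g : ℂ → ℝ) (hg : Measurable g) {F : ℝ} (hF : ∀ w, |g w| ≤ F)
    (N : ℝ) :
    IntegrableOn (fun r => ∫ θ in Ioo (-π) π, r * g (Complex.polarCoord.symm (r, θ))) (Ioc 0 N) ∧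
    ∫ w in Metric.closedBall (0 : ℂ) N, g w =
      ∫ r in Ioc 0 N, ∫ θ in Ioo (-π) π, r * g (Complex.polarCoord.symm (r, θ)) := by
  have hF0 : 0 ≤ F := (abs_nonneg _).trans (hF 0)
  have hmeas : Measurable fun x : ℝ × ℝ => x.1 * g (Complex.polarCoord.symm x) := by
    refine measurable_fst.mul (hg.comp ?_)
    have : (Complex.polarCoord.symm : ℝ × ℝ → ℂ) =
        fun x => (x.1 : ℂ) * ((Real.cos x.2 : ℂ) + (Real.sin x.2 : ℂ) * Complex.I) := by
      ext x; rw [Complex.polarCoord_symm_apply]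
    rw [this]
    fun_prop
  have hint : IntegrableOn (fun x : ℝ × ℝ => x.1 * g (Complex.polarCoord.symm x))
      (Ioc 0 N ×ˢ Ioo (-π) π) := by
    refine Measure.integrableOn_of_bounded (M := |N| * F) ?_ hmeas.aestronglyMeasurable ?_
    · rw [Measure.volume_eq_prod, Measure.prod_prod]
      exact ENNReal.mul_ne_top (by simp) (by simp)
    · refine (ae_restrict_iff' (measurableSet_Ioc.prod measurableSet_Ioo)).2
        (Eventually.of_forall fun x hx => ?_)
      rw [norm_mul, Real.norm_eq_abs, Real.norm_eq_abs, abs_of_pos hx.1.1]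
      exact mul_le_mul (hx.1.2.trans (le_abs_self _)) (hF _) (abs_nonneg _) (abs_nonneg _)
  constructor
  · rw [IntegrableOn, Measure.volume_eq_prod, ← Measure.prod_restrict] at hint
    exact hint.integral_prod_left
  · rw [Measure.volume_eq_prod] at hint
    rw [← setIntegral_prod _ hint, ← Measure.volume_eq_prod, ← integral_indicator measurableSet_closedBall,
      ← Complex.integral_comp_polarCoord_symm]
    rw [polarCoord_target]
    symm
    rw [setIntegral_eq_of_subset_of_forall_sdiff_eq_zero (measurableSet_Ioi.prod measurableSet_Ioo)
      (s := Ioc 0 N ×ˢ Ioo (-π) π)]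
    · refine setIntegral_congr_fun (measurableSet_Ioc.prod measurableSet_Ioo) fun x hx => ?_
      rw [Set.indicator_of_mem, smul_eq_mul]
      rw [mem_closedBall_zero_iff, Complex.norm_polarCoord_symm, abs_of_pos hx.1.1]
      exact hx.1.2
    · exact Set.prod_mono Ioc_subset_Ioi_self subset_rfl
    · intro x hx
      rw [Set.indicator_of_notMem, smul_zero]
      rw [mem_closedBall_zero_iff, Complex.norm_polarCoord_symm, abs_of_pos hx.1.1]
      exact fun h => hx.2 ⟨⟨hx.1.1, h⟩, hx.1.2⟩

/-- The integral over a disc of a function of `Re (P / w)` is almost that of its linearisation. -/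
theorem abs_integral_closedBall_div_sub_le (f : ℝ → ℝ) (hf : Continuous f) {F A κ N : ℝ} {P : ℂ}
    (hF : ∀ t, |f t| ≤ F) (hA : 0 ≤ A) (hfA : ∀ t, A < |t| → f t = 0) (hκ : 0 < κ) (hP : P ≠ 0)
    (hN : 0 < N) :
    |(∫ w in Metric.closedBall (0 : ℂ) N, f (κ * (2 * (P / w).re))) -
      N ^ 3 / (3 * κ * ‖P‖) * ∫ t, f t| ≤ 16 * F * N ^ 2 * (A * N / (κ * ‖P‖)) ^ (5 / 3 : ℝ) := by
  have hF0 : 0 ≤ F := (abs_nonneg _).trans (hF 0)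
  have hP' : 0 < ‖P‖ := norm_pos_iff.2 hP
  -- Rotating the disc makes `P` real positive, so that in polar coordinates `Re(P/w)` becomes `|P|
  -- cos θ / r`.
  have hrot := integral_closedBall_rotate (fun w => f (κ * (2 * (P / w).re))) N (c := P / ‖P‖)
    (by rw [norm_div, Complex.norm_real, norm_norm, div_self hP'.ne'])
  have hsimp : ∀ w : ℂ, P / (P / ‖P‖ * w) = ‖P‖ / w := by
    intro w
    have : (‖P‖ : ℂ) ≠ 0 := by exact_mod_cast hP'.ne'
    by_cases hw : w = 0
    · simp [hw]
    · field_simp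
  simp only [hsimp] at hrot
  rw [← hrot]
  have hmeas : Measurable fun w : ℂ => f (κ * (2 * ((‖P‖ : ℂ) / w).re)) :=
    hf.measurable.comp
      (((Complex.measurable_re.comp (measurable_id.const_div _)).const_mul 2).const_mul κ)
  obtain ⟨hint, heq⟩ := integral_closedBall_polar _ hmeas (fun w => hF _) N
  rw [heq]
  have hmain : ∫ r in Ioc 0 N, r ^ 2 / (κ * ‖P‖) * ∫ t, f t = N ^ 3 / (3 * κ * ‖P‖) * ∫ t, f t := by
    rw [← intervalIntegral.integral_of_le hN.le, intervalIntegral.integral_mul_const,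
      intervalIntegral.integral_div, integral_pow]
    congr 1
    norm_num
    field_simp
  have hint2 : IntegrableOn (fun r : ℝ => r ^ 2 / (κ * ‖P‖) * ∫ t, f t) (Ioc 0 N) :=
    (Continuous.integrableOn_Icc (by fun_prop)).mono_set Ioc_subset_Icc_self
  rw [← hmain, ← integral_sub hint hint2, ← Real.norm_eq_abs]
  have hfin : volume (Ioc 0 N) < ⊤ := by simp
  refine (norm_setIntegral_le_of_norm_le_const (C := N * (16 * F * (A * N / (κ * ‖P‖)) ^ (5 / 3 : ℝ)))
    hfin ?_).trans (le_of_eq ?_)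
  · intro r hr
    have hr0 : 0 < r := hr.1
    have hk : 0 < 2 * κ * ‖P‖ / r := by positivity
    have e1 : ∫ θ in Ioo (-π) π, r * f (κ * (2 * ((‖P‖ : ℂ) / Complex.polarCoord.symm (r, θ)).re)) =
        r * ∫ θ in (-π)..π, f (2 * κ * ‖P‖ / r * Real.cos θ) := by
      rw [integral_const_mul, intervalIntegral.integral_of_le (by linarith [Real.pi_pos]),
        integral_Ioc_eq_integral_Ioo]
      congr 2
      ext θ
      congr 1
      have : ((‖P‖ : ℂ) / Complex.polarCoord.symm (r, θ)).re = ‖P‖ / r * Real.cos θ := by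
        have hE : Complex.polarCoord.symm (r, θ) = r * Complex.exp (θ * Complex.I) := by
          rw [Complex.polarCoord_symm_apply, Complex.exp_mul_I]; push_cast; rfl
        rw [hE, ← div_div, div_eq_mul_inv _ (Complex.exp _), ← Complex.exp_neg, ← neg_mul,
          ← Complex.ofReal_neg, ← Complex.ofReal_div, Complex.re_ofReal_mul,
          Complex.exp_ofReal_mul_I_re, Real.cos_neg]
      rw [this]; ring
    rw [e1]
    have e2 : r * (∫ θ in (-π)..π, f (2 * κ * ‖P‖ / r * Real.cos θ)) - r ^ 2 / (κ * ‖P‖) * ∫ t, f t =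
        r * ((∫ θ in (-π)..π, f (2 * κ * ‖P‖ / r * Real.cos θ)) -
          2 / (2 * κ * ‖P‖ / r) * ∫ t, f t) := by
      field_simp
    rw [e2, norm_mul, Real.norm_eq_abs, Real.norm_eq_abs, abs_of_pos hr0]
    refine mul_le_mul hr.2 ?_ (abs_nonneg _) hN.le
    refine (integral_cos_sub_le f hf hF hA hfA hk).trans ?_
    refine mul_le_mul_of_nonneg_left (Real.rpow_le_rpow (by positivity) ?_ (by norm_num))
      (by positivity)
    rw [div_div_eq_mul_div]
    have : A * r ≤ A * N := by gcongr; exact hr.2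
    calc A * r / (2 * κ * ‖P‖) ≤ A * N / (2 * κ * ‖P‖) := by gcongr
      _ ≤ A * N / (κ * ‖P‖) := by
        apply div_le_div_of_nonneg_left (by positivity) (by positivity)
        nlinarith [mul_pos hκ hP']
  · rw [Real.volume_real_Ioc_of_le hN.le]
    ring

end Integrals

/-! ### The limiting density -/

section Density

/-- The normalised density of the pair correlations. -/
noncomputable def profile (x : ℝ) : ℝ := ∫ s in (0 : ℝ)..1, s ^ 2 * √(1 - (x * s) ^ 2)

theorem continuous_profile : Continuous profile := by
  unfold profile
  apply intervalIntegral.continuous_parametric_intervalIntegral_of_continuous'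
  fun_prop

theorem profile_nonneg (x : ℝ) : 0 ≤ profile x :=
  intervalIntegral.integral_nonneg zero_le_one fun s _ => by positivity

theorem profile_zero : profile 0 = 1 / 3 := by
  simp [profile, integral_pow]; norm_num

/-- The derivative of `arcsin v - v (1 - 2v²) √(1 - v²)` is `8 v² √(1 - v²)` for `|v| < 1`. For `v >
1` both sides stay correct: `arcsin` is constant equal to `π/2` and the square root vanishes. Thus
one formula covers both branches of the density. -/
theorem profile_eq {x : ℝ} (hx : 0 < x) :
    profile x = (Real.arcsin x - x * (1 - 2 * x ^ 2) * √(1 - x ^ 2)) / (8 * x ^ 3) := by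
  set P : ℝ → ℝ := fun u => Real.arcsin (x * u) - x * u * (1 - 2 * (x * u) ^ 2) * √(1 - (x * u) ^ 2)
    with hP
  have hPc : Continuous P := by
    simp only [hP]
    exact (Real.continuous_arcsin.comp (by fun_prop)).sub (by fun_prop)
  -- At `u = 1/x` the integrand switches off; that point is left out, since the fundamental theorem
  -- of calculus tolerates a countable exceptional set.
  have hderiv : ∀ u ∈ Ioo (min (0 : ℝ) 1) (max 0 1) \ {1 / x},
      HasDerivAt P (8 * x ^ 3 * (u ^ 2 * √(1 - (x * u) ^ 2))) u := by
    rintro u ⟨hu, hux⟩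
    rw [min_eq_left zero_le_one, max_eq_right zero_le_one] at hu
    have hu0 : 0 < u := hu.1
    have hxu0 : 0 < x * u := by positivity
    have hlin : HasDerivAt (fun u => x * u) x u := by
      simpa using (hasDerivAt_id u).const_mul x
    rcases lt_trichotomy (x * u) 1 with h | h | h
    · have hpos : 0 < 1 - (x * u) ^ 2 := by nlinarith
      have hs : 0 < √(1 - (x * u) ^ 2) := Real.sqrt_pos.2 hpos
      have hss : √(1 - (x * u) ^ 2) ^ 2 = 1 - (x * u) ^ 2 := Real.sq_sqrt hpos.le
      have d1 := (Real.hasDerivAt_arcsin (x := x * u) (by linarith) (by linarith)).comp u hlin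
      have d2 := (hlin.pow 2).const_sub 1
      have d3 := d2.sqrt hpos.ne'
      have d4 := ((hlin.mul ((hlin.pow 2).const_mul 2 |>.const_sub 1)).mul d3)
      refine (d1.sub d4).congr_deriv ?_
      simp only [Pi.mul_apply, Pi.pow_apply, Nat.reduceSub, pow_one]
      generalize √(1 - (x * u) ^ 2) = s at *
      field_simp
      linear_combination (-(2 + 4 * (x * u) ^ 2)) * hss
    · exact absurd (show u = 1 / x by rw [eq_div_iff hx.ne']; linarith) hux
    · have hev : P =ᶠ[𝓝 u] fun _ => π / 2 := by
        have : ∀ᶠ v in 𝓝 u, 1 < x * v :=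
          (continuous_const.mul continuous_id).continuousAt.eventually (lt_mem_nhds h)
        filter_upwards [this] with v hv
        simp only [hP]
        rw [Real.arcsin_of_one_le hv.le, Real.sqrt_eq_zero_of_nonpos (by nlinarith)]
        ring
      have : √(1 - (x * u) ^ 2) = 0 := Real.sqrt_eq_zero_of_nonpos (by nlinarith)
      rw [this, mul_zero, mul_zero]
      exact (hasDerivAt_const u (π / 2)).congr_of_eventuallyEq hev
  have hint := integral_eq_of_hasDerivAt_off_countable P
    (fun u => 8 * x ^ 3 * (u ^ 2 * √(1 - (x * u) ^ 2))) (a := 0) (b := 1)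
    (Set.countable_singleton (1 / x)) hPc.continuousOn hderiv
    ((by fun_prop : Continuous fun u => 8 * x ^ 3 * (u ^ 2 * √(1 - (x * u) ^ 2))).intervalIntegrable _ _)
  rw [intervalIntegral.integral_const_mul] at hint
  rw [eq_div_iff (by positivity), mul_comm]
  change 8 * x ^ 3 * profile x = _ at hint
  rw [hint]
  simp [hP]

variable (K : Type*) [Field K] [NumberField K]

/-- Put `x = |t|/(2l)` in the closed form of `profile`; beyond `2l` only the term `π/2` survives. -/
theorem rho_eq {l : ℝ} (hl : 0 < l) (t : ℝ) :
    rho K l t = 8 * π / absDisc K * profile (|t| / (2 * l)) := by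
  have hD := absDisc_pos (K := K)
  unfold rho
  by_cases h0 : t = 0
  · rw [if_pos h0, h0, abs_zero, zero_div, profile_zero]
    field_simp
  have ht : 0 < |t| := abs_pos.2 h0
  have hx : 0 < |t| / (2 * l) := by positivity
  rw [if_neg h0, profile_eq hx]
  split_ifs with h
  · have e1 : 1 - t ^ 2 / (2 * l ^ 2) = 1 - 2 * (|t| / (2 * l)) ^ 2 := by
      rw [div_pow, sq_abs]; field_simp
    have e2 : 1 - t ^ 2 / (4 * l ^ 2) = 1 - (|t| / (2 * l)) ^ 2 := by
      rw [div_pow, sq_abs]; field_simp; ring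
    rw [e1, e2]
    generalize Real.arcsin (|t| / (2 * l)) - |t| / (2 * l) * (1 - 2 * (|t| / (2 * l)) ^ 2) *
      √(1 - (|t| / (2 * l)) ^ 2) = y
    field_simp
    ring
  · have h1 : 1 ≤ |t| / (2 * l) := by
      rw [le_div_iff₀ (by positivity)]; linarith
    rw [Real.arcsin_of_one_le h1, Real.sqrt_eq_zero_of_nonpos (by nlinarith)]
    field_simp
    ring

variable {K}

/-- The functions `profile (|t| / (2 l))` depend on `l` in a Hölder continuous way. -/
theorem abs_profile_sub_le (x : ℝ) {θ : ℝ} (hθ : |θ| ≤ 1 / 2) :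
    |profile ((1 + θ) * x) - profile x| ≤ 4 * √|θ| := by
  -- The truncated square root is Hölder of exponent `1/2`; this is the origin of the `δ_N^{1/2}` in
  -- the second regime.
  have hsq : ∀ a b : ℝ, |√a - √b| ≤ √|a - b| := by
    have key : ∀ a b : ℝ, b ≤ a → √a - √b ≤ √|a - b| := by
      intro a b hab
      rw [abs_of_nonneg (by linarith)]
      rcases le_total b 0 with h | h
      · rw [Real.sqrt_eq_zero_of_nonpos h, sub_zero]
        exact Real.sqrt_le_sqrt (by linarith)
      · rw [sub_le_iff_le_add, Real.sqrt_le_iff]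
        refine ⟨by positivity, ?_⟩
        nlinarith [Real.sq_sqrt h, Real.sq_sqrt (sub_nonneg.2 hab),
          mul_nonneg (Real.sqrt_nonneg (a - b)) (Real.sqrt_nonneg b)]
    intro a b
    rcases le_total b a with h | h
    · rw [abs_of_nonneg (by linarith [Real.sqrt_le_sqrt h])]
      exact key a b h
    · rw [abs_sub_comm, abs_sub_comm a b, abs_of_nonneg (by linarith [Real.sqrt_le_sqrt h])]
      exact key b a h
  have hpt : ∀ y : ℝ, |√(1 - ((1 + θ) * y) ^ 2) - √(1 - y ^ 2)| ≤ 4 * √|θ| := by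
    intro y
    rw [abs_le] at hθ
    -- Since `|1 + θ| ≥ 1/2`, both radicands are nonpositive here; otherwise `y² < 4` bounds their
    -- difference by a multiple of `|θ|`.
    by_cases hy : 4 ≤ y ^ 2
    · rw [Real.sqrt_eq_zero_of_nonpos (x := 1 - y ^ 2) (by linarith),
        Real.sqrt_eq_zero_of_nonpos]
      · simp
      · rw [mul_pow]; nlinarith [sq_nonneg (θ + 1 / 2)]
    · refine (hsq _ _).trans ?_
      have h1 : 1 - ((1 + θ) * y) ^ 2 - (1 - y ^ 2) = -(y ^ 2 * (2 + θ)) * θ := by ring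
      have h2 : |1 - ((1 + θ) * y) ^ 2 - (1 - y ^ 2)| ≤ 4 ^ 2 * |θ| := by
        rw [h1, abs_mul, abs_neg, abs_of_nonneg (by nlinarith [sq_nonneg y])]
        refine mul_le_mul_of_nonneg_right ?_ (abs_nonneg _)
        nlinarith [sq_nonneg y]
      refine (Real.sqrt_le_sqrt h2).trans (le_of_eq ?_)
      rw [Real.sqrt_mul (by norm_num), Real.sqrt_sq (by norm_num)]
  unfold profile
  rw [← intervalIntegral.integral_sub, ← Real.norm_eq_abs]
  · refine (intervalIntegral.norm_integral_le_of_norm_le_const (C := 4 * √|θ|) ?_).trans ?_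
    · intro s hs
      rw [uIoc_of_le zero_le_one] at hs
      rw [← mul_sub, mul_assoc, norm_mul, Real.norm_eq_abs, Real.norm_eq_abs,
        abs_of_nonneg (sq_nonneg s)]
      have h1 : s ^ 2 ≤ 1 := by nlinarith [hs.1, hs.2]
      have := hpt (x * s)
      calc s ^ 2 * _ ≤ 1 * (4 * √|θ|) := mul_le_mul h1 this (abs_nonneg _) zero_le_one
        _ = _ := one_mul _
    · simp
  · exact Continuous.intervalIntegrable (by fun_prop) _ _
  · exact Continuous.intervalIntegrable (by fun_prop) _ _

/-- The mean of `f (2 κ Re (p / w))` over two discs, in terms of the density `profile`. -/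
theorem integral_integral_closedBall (f : ℝ → ℝ) (hf : Continuous f) {F A κ N R : ℝ}
    (hF : ∀ t, |f t| ≤ F) (hfA : ∀ t, A < |t| → f t = 0) (hκ : 0 < κ) (hN : 0 < N) (hR : 0 < R) :
    ∫ w in Metric.closedBall (0 : ℂ) N, ∫ p in Metric.closedBall (0 : ℂ) R, f (κ * (2 * (p / w).re)) =
      2 * π * N ^ 3 * R / κ * ∫ t, f t * profile (t / (2 * (κ * R / N))) := by
  have hcs : HasCompactSupport f := by
    apply HasCompactSupport.of_support_subset_isCompact (isCompact_Icc (a := -A) (b := A))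
    intro t ht
    rw [mem_Icc, ← abs_le]
    by_contra h
    exact ht (hfA t (not_le.1 h))
  have hfint : Integrable f := hf.integrable_of_hasCompactSupport hcs
  -- By rotation invariance the inner integral depends on `r = |w|` only. Chords of the disc and the
  -- substitution `t = 2κx/r` give this expression.
  set u : ℝ → ℝ := fun r => r / κ * ∫ t, f t * √(R ^ 2 - (t * r / (2 * κ)) ^ 2) with hu
  have h1 : ∀ w : ℂ, w ≠ 0 → ∫ p in Metric.closedBall (0 : ℂ) R, f (κ * (2 * (p / w).re)) = u ‖w‖ := by
    intro w hw
    have hw' : 0 < ‖w‖ := norm_pos_iff.2 hw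
    have hw'' : (‖w‖ : ℂ) ≠ 0 := by exact_mod_cast hw'.ne'
    have hrot := integral_closedBall_rotate (fun p => f (κ * (2 * (p / w).re))) R (c := w / ‖w‖)
      (by rw [norm_div, Complex.norm_real, norm_norm, div_self hw'.ne'])
    have hsimp : ∀ p : ℂ, (w / ‖w‖ * p / w).re = p.re / ‖w‖ := by
      intro p
      have : w / ‖w‖ * p / w = p / (‖w‖ : ℂ) := by field_simp
      rw [this, Complex.div_ofReal_re]
    simp only [hsimp] at hrot
    rw [← hrot, integral_closedBall_re (fun x => f (κ * (2 * (x / ‖w‖)))) (by fun_prop)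
      (fun t => hF _) R hR.le]
    have h2 := Measure.integral_comp_mul_left
      (fun t => f t * (2 * √(R ^ 2 - (t * ‖w‖ / (2 * κ)) ^ 2))) (2 * κ / ‖w‖)
    have h3 : ∀ x : ℝ, f (κ * (2 * (x / ‖w‖))) * (2 * √(R ^ 2 - x ^ 2)) =
        f (2 * κ / ‖w‖ * x) * (2 * √(R ^ 2 - (2 * κ / ‖w‖ * x * ‖w‖ / (2 * κ)) ^ 2)) := by
      intro x
      have e1 : κ * (2 * (x / ‖w‖)) = 2 * κ / ‖w‖ * x := by ring
      have e2 : 2 * κ / ‖w‖ * x * ‖w‖ / (2 * κ) = x := by field_simp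
      rw [e1, e2]
    simp_rw [h3]
    rw [h2, abs_of_pos (by positivity), hu, smul_eq_mul]
    have h4 : ∀ t, f t * (2 * √(R ^ 2 - (t * ‖w‖ / (2 * κ)) ^ 2)) =
      2 * (f t * √(R ^ 2 - (t * ‖w‖ / (2 * κ)) ^ 2)) := fun t => by ring
    simp_rw [h4]
    rw [integral_const_mul]
    field_simp
  have h2 : ∫ w in Metric.closedBall (0 : ℂ) N, ∫ p in Metric.closedBall (0 : ℂ) R,
      f (κ * (2 * (p / w).re)) = ∫ w in Metric.closedBall (0 : ℂ) N, u ‖w‖ := by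
    apply integral_congr_ae
    have : ∀ᵐ w : ℂ ∂(volume.restrict (Metric.closedBall (0 : ℂ) N)), w ≠ 0 :=
      ae_restrict_of_ae (Measure.ae_ne volume 0)
    filter_upwards [this] with w hw
    exact h1 w hw
  rw [h2, integral_closedBall_radial u hN.le]
  have h3 : ∫ r in (0 : ℝ)..N, r * u r = N * ∫ s in (0 : ℝ)..1, (N * s) * u (N * s) := by
    have := intervalIntegral.mul_integral_comp_mul_left (a := 0) (b := 1) (f := fun r => r * u r) N
    rw [mul_zero, mul_one] at this
    rw [this]
  set lam := κ * R / N with hlam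
  have hlam0 : 0 < lam := by positivity
  have h4 : ∀ s : ℝ, (N * s) * u (N * s) = N ^ 2 * R / κ *
      ∫ t, f t * (s ^ 2 * √(1 - (t / (2 * lam) * s) ^ 2)) := by
    intro s
    simp only [hu]
    have e1 : ∀ t, f t * √(R ^ 2 - (t * (N * s) / (2 * κ)) ^ 2) =
        R * (f t * √(1 - (t / (2 * lam) * s) ^ 2)) := by
      intro t
      have : R ^ 2 - (t * (N * s) / (2 * κ)) ^ 2 = R ^ 2 * (1 - (t / (2 * lam) * s) ^ 2) := by
        rw [hlam]; field_simp
      rw [this, Real.sqrt_mul (sq_nonneg R), Real.sqrt_sq hR.le]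
      ring
    have e2 : ∀ t, f t * (s ^ 2 * √(1 - (t / (2 * lam) * s) ^ 2)) =
        s ^ 2 * (f t * √(1 - (t / (2 * lam) * s) ^ 2)) := fun t => by ring
    simp_rw [e1, e2]
    rw [integral_const_mul, integral_const_mul]
    ring
  -- Fubini moves the radial integral inside, where it is the definition of `profile`. The
  -- domination by `|f|` uses that the kernel lies in `[0, 1]`.
  have h5 : ∫ s in (0 : ℝ)..1, ∫ t, f t * (s ^ 2 * √(1 - (t / (2 * lam) * s) ^ 2)) =
      ∫ t, f t * profile (t / (2 * lam)) := by
    have hi : Integrable (Function.uncurry fun (s t : ℝ) =>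
        f t * (s ^ 2 * √(1 - (t / (2 * lam) * s) ^ 2))) ((volume.restrict (Ioc (0 : ℝ) 1)).prod volume) := by
      have hi1 : Integrable (fun z : ℝ × ℝ => (1 : ℝ) * |f z.2|)
          ((volume.restrict (Ioc (0 : ℝ) 1)).prod volume) :=
        (integrable_const (1 : ℝ)).mul_prod hfint.abs
      refine hi1.mono' (Continuous.aestronglyMeasurable (by unfold Function.uncurry; fun_prop)) ?_
      have : ∀ᵐ z : ℝ × ℝ ∂((volume.restrict (Ioc (0 : ℝ) 1)).prod volume), z.1 ∈ Ioc (0 : ℝ) 1 :=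
        Measure.quasiMeasurePreserving_fst.ae (ae_restrict_mem measurableSet_Ioc)
      filter_upwards [this] with z hz
      simp only [Function.uncurry]
      have hz0 : 0 ≤ z.1 ^ 2 * √(1 - (z.2 / (2 * lam) * z.1) ^ 2) := by positivity
      rw [norm_mul, Real.norm_eq_abs, Real.norm_eq_abs, one_mul, abs_of_nonneg hz0]
      have hz1 : z.1 ^ 2 ≤ 1 := by nlinarith [hz.1, hz.2]
      have hz2 : √(1 - (z.2 / (2 * lam) * z.1) ^ 2) ≤ 1 := by
        rw [Real.sqrt_le_one]
        nlinarith [sq_nonneg (z.2 / (2 * lam) * z.1)]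
      have : z.1 ^ 2 * √(1 - (z.2 / (2 * lam) * z.1) ^ 2) ≤ 1 :=
        mul_le_one₀ hz1 (Real.sqrt_nonneg _) hz2
      exact mul_le_of_le_one_right (abs_nonneg _) this
    rw [intervalIntegral.integral_of_le zero_le_one, integral_integral_swap hi]
    congr 1
    ext t
    rw [integral_const_mul, profile, intervalIntegral.integral_of_le zero_le_one]
  rw [h3]
  simp_rw [h4]
  rw [intervalIntegral.integral_const_mul, h5]
  field_simp

end Density

/-! ### The pair sums for small, large and intermediate scaling -/

section Asymptotics

variable {ω : ℂ}

/-- The pair sums when the scaling factor is small. -/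
theorem exists_abs_pairSum_sub_mul_apply_zero_le (hω : 0 < ω.im)
    (hmin : ∀ c ≠ 0, 1 ≤ ‖lat ω c‖) {ε : ℝ}
    (hε : 0 < ε) (hε1 : ε ≤ 1) : ∃ C : ℝ, 0 < C ∧ ∀ (N R κ F F' : ℝ) (f : ℝ → ℝ), 1 ≤ R → R ≤ N →
      0 ≤ κ → 0 ≤ F → 0 ≤ F' → Continuous f → (∀ t, |f t| ≤ F) →
      (∀ s t, |f s - f t| ≤ F' * |s - t|) →
      |pairSum ω N R κ f - π * N ^ 2 / ω.im * (ballPts ω R).card * f 0| ≤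
        C * (F * N * R ^ 3 + F' * κ * R ^ 4 * N ^ ε + F' * κ * R ^ 3 * N) := by
  obtain ⟨C₁, hC₁, h1⟩ := exists_abs_pairSum_sub_le hω hmin hε hε1
  obtain ⟨C₂, hC₂, hcard⟩ := exists_card_le hω
  refine ⟨C₁ + 1 / ω.im * (C₂ * (4 * π)), by positivity, ?_⟩
  intro N R κ F F' f hR hRN hκ hF hF' hf hfF hfL
  have hN : 1 ≤ N := hR.trans hRN
  have hmain := h1 N R κ F F' f hR hRN hκ hF hF' hf hfF hfL
  have hp : ∀ p ∈ ballPts ω R,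
      |(∫ w in Metric.closedBall 0 N, f (κ * (2 * (lat ω p / w).re))) - π * N ^ 2 * f 0| ≤
        4 * π * (F' * κ * R * N) := by
    intro p hp
    have hpR := ((mem_ballPts hω).1 hp).2
    have hfin : volume (Metric.closedBall (0 : ℂ) N) < ⊤ := measure_closedBall_lt_top
    have hmeas : Measurable fun w : ℂ => f (κ * (2 * (lat ω p / w).re)) :=
      hf.measurable.comp
        (((Complex.measurable_re.comp (measurable_id.const_div _)).const_mul 2).const_mul κ)
    have hint : IntegrableOn (fun w : ℂ => f (κ * (2 * (lat ω p / w).re))) (Metric.closedBall 0 N) :=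
      Measure.integrableOn_of_bounded hfin.ne hmeas.aestronglyMeasurable
        (Eventually.of_forall fun w => hfF _)
    have e1 : π * N ^ 2 * f 0 = ∫ w in Metric.closedBall (0 : ℂ) N, f 0 := by
      rw [setIntegral_const, volume_real_closedBall N (by linarith), smul_eq_mul]
    rw [e1, ← integral_sub (f := fun w : ℂ => f (κ * (2 * (lat ω p / w).re))) hint
      (integrableOn_const (C := f 0) hfin.ne)]
    have h2 : ∀ w : ℂ, ‖f (κ * (2 * (lat ω p / w).re)) - f 0‖ ≤ 2 * (F' * κ * R) * ‖w‖⁻¹ := by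
      intro w
      refine (hfL _ _).trans ?_
      have : |(lat ω p / w).re| ≤ R * ‖w‖⁻¹ := by
        refine (Complex.abs_re_le_norm _).trans ?_
        rw [norm_div, div_eq_mul_inv]
        gcongr
      rw [sub_zero, abs_mul, abs_mul, abs_two, abs_of_nonneg hκ]
      calc F' * (κ * (2 * |(lat ω p / w).re|)) ≤ F' * (κ * (2 * (R * ‖w‖⁻¹))) := by gcongr
        _ = _ := by ring
    refine (norm_integral_le_of_norm_le
      ((integrableOn_closedBall_norm_inv N).const_mul _) (Eventually.of_forall h2)).trans ?_
    rw [integral_const_mul, integral_closedBall_norm_inv (by linarith)]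
    apply le_of_eq
    ring
  have hsum : |1 / ω.im * ∑ p ∈ ballPts ω R,
      (∫ w in Metric.closedBall 0 N, f (κ * (2 * (lat ω p / w).re))) -
        π * N ^ 2 / ω.im * (ballPts ω R).card * f 0| ≤
      1 / ω.im * (C₂ * (4 * π)) * (F' * κ * R ^ 3 * N) := by
    have e2 : π * N ^ 2 / ω.im * (ballPts ω R).card * f 0 =
        1 / ω.im * ∑ p ∈ ballPts ω R, π * N ^ 2 * f 0 := by
      rw [Finset.sum_const, nsmul_eq_mul]; ring
    rw [e2, ← mul_sub, ← Finset.sum_sub_distrib, abs_mul, abs_of_pos (by positivity), mul_assoc (1 / ω.im)]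
    refine mul_le_mul_of_nonneg_left ?_ (by positivity)
    refine (Finset.abs_sum_le_sum_abs _ _).trans ((Finset.sum_le_card_nsmul _ _ _ hp).trans ?_)
    rw [nsmul_eq_mul]
    have h3 := hcard (ballPts ω R) R hR (fun c hc => ((mem_ballPts hω).1 hc).2)
    calc _ ≤ C₂ * R ^ 2 * (4 * π * (F' * κ * R * N)) := by gcongr
      _ = _ := by ring
  refine (abs_sub_le _ _ _).trans ((add_le_add hmain hsum).trans ?_)
  have t1 : 0 ≤ C₁ * (F' * κ * R ^ 3 * N) := by positivity
  have t2 : 0 ≤ 1 / ω.im * (C₂ * (4 * π)) * (F * N * R ^ 3 + F' * κ * R ^ 4 * N ^ ε) := by positivity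
  linarith

/-- The pair sums when the scaling factor is large. -/
theorem exists_abs_pairSum_sub_mul_integral_le (hω : 0 < ω.im)
    (hmin : ∀ c ≠ 0, 1 ≤ ‖lat ω c‖) {ε : ℝ}
    (hε : 0 < ε) (hε1 : ε ≤ 1) : ∃ C : ℝ, 0 < C ∧ ∀ (N R κ F F' A : ℝ) (f : ℝ → ℝ), 1 ≤ R → R ≤ N →
      0 < κ → 0 ≤ F → 0 ≤ F' → 0 ≤ A → Continuous f → (∀ t, |f t| ≤ F) →
      (∀ s t, |f s - f t| ≤ F' * |s - t|) → (∀ t, A < |t| → f t = 0) →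
      |pairSum ω N R κ f - N ^ 3 / (3 * κ * ω.im) * (∑ p ∈ ballPts ω R, 1 / ‖lat ω p‖) * ∫ t, f t| ≤
        C * (F * N * R ^ 3 + F' * κ * R ^ 4 * N ^ ε +
          F * N ^ 2 * (A * N / κ) ^ (5 / 3 : ℝ) * R ^ (1 / 3 : ℝ)) := by
  obtain ⟨C₁, hC₁, h1⟩ := exists_abs_pairSum_sub_le hω hmin hε hε1
  obtain ⟨C₂, hC₂, hsum⟩ := exists_sum_rpow_le hω hmin (s := 5 / 3) (by norm_num) (by norm_num)
  refine ⟨C₁ + 1 / ω.im * (16 * C₂), by positivity, ?_⟩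
  intro N R κ F F' A f hR hRN hκ hF hF' hA hf hfF hfL hfA
  have hN : 1 ≤ N := hR.trans hRN
  have hmain := h1 N R κ F F' f hR hRN hκ.le hF hF' hf hfF hfL
  have hdiff : |1 / ω.im * ∑ p ∈ ballPts ω R,
      (∫ w in Metric.closedBall 0 N, f (κ * (2 * (lat ω p / w).re))) -
        N ^ 3 / (3 * κ * ω.im) * (∑ p ∈ ballPts ω R, 1 / ‖lat ω p‖) * ∫ t, f t| ≤
      1 / ω.im * (16 * C₂) * (F * N ^ 2 * (A * N / κ) ^ (5 / 3 : ℝ) * R ^ (1 / 3 : ℝ)) := by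
    have e2 : N ^ 3 / (3 * κ * ω.im) * (∑ p ∈ ballPts ω R, 1 / ‖lat ω p‖) * ∫ t, f t =
        1 / ω.im * ∑ p ∈ ballPts ω R, N ^ 3 / (3 * κ * ‖lat ω p‖) * ∫ t, f t := by
      rw [← Finset.sum_mul, ← mul_assoc, Finset.mul_sum, Finset.mul_sum]
      congr 1
      refine Finset.sum_congr rfl fun p _ => ?_
      rw [div_mul_div_comm, div_mul_div_comm]
      congr 1 <;> ring
    rw [e2, ← mul_sub, ← Finset.sum_sub_distrib, abs_mul, abs_of_pos (by positivity), mul_assoc (1 / ω.im)]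
    refine mul_le_mul_of_nonneg_left ?_ (by positivity)
    refine (Finset.abs_sum_le_sum_abs _ _).trans ?_
    have hterm : ∀ p ∈ ballPts ω R,
        |(∫ w in Metric.closedBall 0 N, f (κ * (2 * (lat ω p / w).re))) -
          N ^ 3 / (3 * κ * ‖lat ω p‖) * ∫ t, f t| ≤
        16 * F * N ^ 2 * (A * N / κ) ^ (5 / 3 : ℝ) * ‖lat ω p‖ ^ (-(5 / 3 : ℝ)) := by
      intro p hp
      have hp1 := hmin p ((mem_ballPts hω).1 hp).1
      refine (abs_integral_closedBall_div_sub_le f hf hfF hA hfA hκ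
        (norm_pos_iff.1 (by linarith)) (by linarith)).trans (le_of_eq ?_)
      rw [← div_div, Real.div_rpow (by positivity) (norm_nonneg _), Real.rpow_neg (norm_nonneg _),
        div_eq_mul_inv]
      ring
    refine (Finset.sum_le_sum hterm).trans ?_
    rw [← Finset.mul_sum]
    have h3 := hsum R (by linarith)
    rw [show (2 : ℝ) - 5 / 3 = 1 / 3 by norm_num] at h3
    calc _ ≤ 16 * F * N ^ 2 * (A * N / κ) ^ (5 / 3 : ℝ) * (C₂ * R ^ (1 / 3 : ℝ)) := by gcongr
      _ = _ := by ring
  refine (abs_sub_le _ _ _).trans ((add_le_add hmain hdiff).trans ?_)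
  have t1 : 0 ≤ C₁ * (F * N ^ 2 * (A * N / κ) ^ (5 / 3 : ℝ) * R ^ (1 / 3 : ℝ)) := by positivity
  have t2 : 0 ≤ 1 / ω.im * (16 * C₂) * (F * N * R ^ 3 + F' * κ * R ^ 4 * N ^ ε) := by positivity
  linarith

/-- The pair sums when the scaling factor is intermediate. -/
theorem exists_abs_pairSum_sub_mul_integral_profile_le (hω : 0 < ω.im)
    (hmin : ∀ c ≠ 0, 1 ≤ ‖lat ω c‖) {ε : ℝ}
    (hε : 0 < ε) (hε1 : ε ≤ 1) : ∃ C : ℝ, 0 < C ∧ ∀ (N R κ F F' A : ℝ) (f : ℝ → ℝ), 1 ≤ R → R ≤ N →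
      0 < κ → 0 ≤ F → 0 ≤ F' → Continuous f → (∀ t, |f t| ≤ F) →
      (∀ s t, |f s - f t| ≤ F' * |s - t|) → (∀ t, A < |t| → f t = 0) →
      |pairSum ω N R κ f - 2 * π * N ^ 3 * R / (κ * ω.im ^ 2) *
          ∫ t, f t * profile (t / (2 * (κ * R / N)))| ≤
        C * (F * N * R ^ 3 + F' * κ * R ^ 4 * N ^ ε + F * N ^ 2 * R + F' * κ * R ^ 2 * N) := by
  obtain ⟨C₁, hC₁, h1⟩ := exists_abs_pairSum_sub_le hω hmin hε hε1
  obtain ⟨C₂, hC₂, h2⟩ := exists_riemann_fst hω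
  refine ⟨C₁ + 1 / ω.im * (C₂ * (2 * π)), by positivity, ?_⟩
  intro N R κ F F' A f hR hRN hκ hF hF' hf hfF hfL hfA
  have hN : 1 ≤ N := hR.trans hRN
  have hmain := h1 N R κ F F' f hR hRN hκ.le hF hF' hf hfF hfL
  have hfin : ∀ r : ℝ, volume (Metric.closedBall (0 : ℂ) r) < ⊤ := fun r => measure_closedBall_lt_top
  have hint : ∀ p : ℂ, IntegrableOn (fun w : ℂ => f (κ * (2 * (p / w).re)))
      (Metric.closedBall 0 N) := by
    intro p
    have hmeas : Measurable fun w : ℂ => f (κ * (2 * (p / w).re)) :=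
      hf.measurable.comp
        (((Complex.measurable_re.comp (measurable_id.const_div _)).const_mul 2).const_mul κ)
    exact Measure.integrableOn_of_bounded (hfin N).ne hmeas.aestronglyMeasurable
        (Eventually.of_forall fun w => hfF _)
  have hint2 : IntegrableOn (fun w : ℂ => ∫ p in Metric.closedBall (0 : ℂ) R,
      f (κ * (2 * (p / w).re))) (Metric.closedBall 0 N) := by
    have hmeas : Measurable fun x : ℂ × ℂ => f (κ * (2 * (x.2 / x.1).re)) :=
      hf.measurable.comp
        (((Complex.measurable_re.comp (measurable_snd.div measurable_fst)).const_mul 2).const_mul κ)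
    have : Integrable (fun x : ℂ × ℂ => f (κ * (2 * (x.2 / x.1).re)))
        ((volume.restrict (Metric.closedBall (0 : ℂ) N)).prod
          (volume.restrict (Metric.closedBall (0 : ℂ) R))) := by
      have : IsFiniteMeasure (volume.restrict (Metric.closedBall (0 : ℂ) N)) := ⟨by simpa using hfin N⟩
      have : IsFiniteMeasure (volume.restrict (Metric.closedBall (0 : ℂ) R)) := ⟨by simpa using hfin R⟩
      exact Integrable.of_bound hmeas.aestronglyMeasurable F (Eventually.of_forall fun x => hfF _)
    exact this.integral_prod_left
  have hdiff : |1 / ω.im * ∑ p ∈ ballPts ω R,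
      (∫ w in Metric.closedBall 0 N, f (κ * (2 * (lat ω p / w).re))) -
        2 * π * N ^ 3 * R / (κ * ω.im ^ 2) * ∫ t, f t * profile (t / (2 * (κ * R / N)))| ≤
      1 / ω.im * (C₂ * (2 * π)) * (F * N ^ 2 * R + F' * κ * R ^ 2 * N) := by
    have e2 : 2 * π * N ^ 3 * R / (κ * ω.im ^ 2) * ∫ t, f t * profile (t / (2 * (κ * R / N))) =
        1 / ω.im * (1 / ω.im * ∫ w in Metric.closedBall (0 : ℂ) N,
          ∫ p in Metric.closedBall (0 : ℂ) R, f (κ * (2 * (p / w).re))) := by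
      rw [integral_integral_closedBall f hf hfF hfA hκ (by linarith) (by linarith)]
      field_simp
    rw [e2, ← mul_sub, abs_mul, abs_of_pos (by positivity), mul_assoc (1 / ω.im)]
    refine mul_le_mul_of_nonneg_left ?_ (by positivity)
    rw [← integral_finsetSum _ (fun p _ => hint _), ← integral_const_mul,
      ← integral_sub (integrable_finsetSum _ (fun p _ => hint _)) (hint2.const_mul _),
      ← Real.norm_eq_abs]
    refine le_trans (norm_integral_le_of_norm_le
      (g := fun w : ℂ => C₂ * (F * R) + C₂ * (F' * κ * R ^ 2) * ‖w‖⁻¹)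
      ?_ (Eventually.of_forall fun w => ?_)) ?_
    · exact (integrableOn_const (C := C₂ * (F * R)) (hfin N).ne).integrable.add
        ((integrableOn_closedBall_norm_inv N).const_mul _)
    · refine (h2 R κ F F' f w hR hκ.le hF hF' hf hfF hfL).trans (le_of_eq ?_)
      ring
    · rw [integral_add (integrableOn_const (C := C₂ * (F * R)) (hfin N).ne).integrable
        ((integrableOn_closedBall_norm_inv N).const_mul _), setIntegral_const,
        volume_real_closedBall N (by linarith), smul_eq_mul, integral_const_mul,
        integral_closedBall_norm_inv (by linarith)]
      have : 0 ≤ C₂ * π * (N ^ 2 * (F * R)) := by positivity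
      linarith
  refine (abs_sub_le _ _ _).trans ((add_le_add hmain hdiff).trans ?_)
  have t1 : 0 ≤ C₁ * (F * N ^ 2 * R + F' * κ * R ^ 2 * N) := by positivity
  have t2 : 0 ≤ 1 / ω.im * (C₂ * (2 * π)) * (F * N * R ^ 3 + F' * κ * R ^ 4 * N ^ ε) := by positivity
  linarith

end Asymptotics

/-! ### Norms of test functions and normalisation -/

section TestFunctions

theorem abs_le_supNorm {f : ℝ → ℝ} (hf : Continuous f) (hc : HasCompactSupport f) (t : ℝ) :
    |f t| ≤ supNorm f := by
  obtain ⟨C, hC⟩ := hc.exists_bound_of_continuous hf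
  exact le_ciSup (f := fun t => |f t|) ⟨C, by rintro _ ⟨t, rfl⟩; exact hC t⟩ t

theorem supNorm_nonneg (f : ℝ → ℝ) : 0 ≤ supNorm f := Real.iSup_nonneg fun t => abs_nonneg (f t)

theorem hasCompactSupport_of_tsupport_subset {f : ℝ → ℝ} {A : ℝ} (hs : tsupport f ⊆ Icc (-A) A) :
    HasCompactSupport f := isCompact_Icc.of_isClosed_subset (isClosed_tsupport f) hs

theorem abs_sub_le_supNorm_deriv {f : ℝ → ℝ} (hf : ContDiff ℝ 1 f) (hc : HasCompactSupport f)
    (s t : ℝ) : |f s - f t| ≤ supNorm (deriv f) * |s - t| :=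
  Convex.norm_image_sub_le_of_norm_deriv_le (s := Set.univ) (C := supNorm (deriv f))
    (fun _ _ => (hf.differentiable one_ne_zero).differentiableAt)
    (fun x _ => abs_le_supNorm (hf.continuous_deriv le_rfl) hc.deriv x) convex_univ
    (mem_univ t) (mem_univ s)

theorem eq_zero_of_tsupport_subset {f : ℝ → ℝ} {A : ℝ} (hs : tsupport f ⊆ Icc (-A) A) (t : ℝ)
    (ht : A < |t|) : f t = 0 := by
  by_contra h
  have := hs (subset_tsupport f h)
  rw [mem_Icc, ← abs_le] at this
  linarith

/-- Separates the error `E'` produced by the analysis from the prescribed error `E`: it remains to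
dominate `E'` by a multiple of `E`, uniformly in `A`, `F` and `F'`. -/
theorem hasErrorTerm_of_eventually {R : ℕ → Measure ℝ} {m : Measure ℝ} {E : ℕ → ℝ → ℝ → ℝ → ℝ}
    (E' : ℕ → ℝ → ℝ → ℝ → ℝ)
    (h : ∃ C : ℝ, 0 < C ∧ ∀ᶠ N in atTop, ∀ A : ℝ, 1 ≤ A → ∀ f : ℝ → ℝ, ContDiff ℝ 1 f →
      tsupport f ⊆ Icc (-A) A →
        |(∫ t, f t ∂(R N)) - ∫ t, f t ∂m| ≤ C * E' N A (supNorm f) (supNorm (deriv f)))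
    (hE : ∃ C : ℝ, ∀ᶠ N in atTop, ∀ A F F' : ℝ, 1 ≤ A → 0 ≤ F → 0 ≤ F' →
      E' N A F F' ≤ C * E N A F F') : HasErrorTerm R m E := by
  obtain ⟨C, hC, h⟩ := h
  obtain ⟨C', hE⟩ := hE
  obtain ⟨N₀, hN₀⟩ := eventually_atTop.1 (h.and hE)
  refine ⟨C * C', N₀, fun A hA f hf hs N hN => ?_⟩
  obtain ⟨h1, h2⟩ := hN₀ N hN
  refine (h1 A hA f hf hs).trans ?_
  rw [mul_assoc]
  exact mul_le_mul_of_nonneg_left (h2 A _ _ hA (supNorm_nonneg _) (supNorm_nonneg _)) hC.le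

/-- Only a lower bound `b` of the normalisation is needed, since the exact `ψ` already multiplies
the main term. -/
theorem abs_one_div_mul_sub_le {ψ b M T E : ℝ} (hb : 0 < b) (hψ : b ≤ ψ) (h : |M - ψ * T| ≤ E) :
    |1 / ψ * M - T| ≤ E / b := by
  have hψ0 : 0 < ψ := hb.trans_le hψ
  have hE : 0 ≤ E := (abs_nonneg _).trans h
  have e : 1 / ψ * M - T = (M - ψ * T) / ψ := by field_simp
  rw [e, abs_div, abs_of_pos hψ0]
  exact div_le_div₀ hE h hb hψ

end TestFunctions

/-! ### Rates of convergence before comparison with the stated errors -/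

section Rates

variable {K : Type*} [Field K] [NumberField K]

theorem absDisc_eq : absDisc K = 4 * (omega K).im ^ 2 := by
  rw [omega_im, div_pow, Real.sq_sqrt absDisc_pos.le]; ring

theorem sqrt_absDisc_eq : √(absDisc K) = 2 * (omega K).im := by
  rw [omega_im]; ring

theorem S_one_eq (hK : Module.finrank ℚ K = 2) [NumberField.IsTotallyComplex K]
    (σ : K →+* ℂ) (α : ℝ) (N : ℕ) :
    S σ α 1 N = (omega K).im / π * (ballPts (omega K) ((N : ℝ) ^ α)).card := by
  rw [S_eq hK, sqrt_absDisc_eq, Finset.card_eq_sum_ones, Nat.cast_sum]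
  have hπ := Real.pi_pos
  have : ∀ c ∈ ballPts (omega K) ((N : ℝ) ^ α), ‖lat (omega K) c‖ ^ 1 / ‖lat (omega K) c‖ =
      ((1 : ℕ) : ℝ) := by
    intro c hc
    have := one_le_norm_lat hK σ ((mem_ballPts omega_im_pos).1 hc).1
    rw [pow_one, Nat.cast_one, div_self (by linarith)]
  rw [Finset.sum_congr rfl this]
  congr 1
  push_cast
  field_simp
  ring

theorem S_zero_eq (hK : Module.finrank ℚ K = 2) [NumberField.IsTotallyComplex K]
    (σ : K →+* ℂ) (α : ℝ) (N : ℕ) :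
    S σ α 0 N = (omega K).im / (2 * π) *
      ∑ c ∈ ballPts (omega K) ((N : ℝ) ^ α), 1 / ‖lat (omega K) c‖ := by
  rw [S_eq hK, sqrt_absDisc_eq]
  simp only [pow_zero]
  congr 1
  push_cast
  field_simp
  ring

variable {α : ℝ}

theorem eventually_le_rpow (hα : 0 < α) (x : ℝ) : ∀ᶠ N : ℕ in atTop, x ≤ (N : ℝ) ^ α :=
  ((tendsto_rpow_atTop hα).comp tendsto_natCast_atTop_atTop).eventually_ge_atTop x

theorem div_rpow_one_sub {x a : ℝ} {N : ℕ} (hN : 1 ≤ N) :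
    x / (N : ℝ) ^ (1 - a) = x * (N : ℝ) ^ a / N := by
  have hn : (0 : ℝ) < N := by exact_mod_cast hN
  rw [Real.rpow_sub hn, Real.rpow_one]
  field_simp

/-- The normalisation `N² S_{N,1}` counts the `p`, hence matches the main term exactly; the lower
bound for the number of lattice points in a disc makes it at least `N² R² / π`. -/
theorem exists_rate_small (hK : Module.finrank ℚ K = 2) [NumberField.IsTotallyComplex K]
    (σ : K →+* ℂ) (hα : 0 < α) (hα1 : α < 1) (φ : ℕ → ℝ) (hφ : ∀ N : ℕ, 0 < N → 0 < φ N) :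
    ∃ C : ℝ, 0 < C ∧ ∀ᶠ N in atTop, ∀ A : ℝ, 1 ≤ A → ∀ f : ℝ → ℝ, ContDiff ℝ 1 f →
      tsupport f ⊆ Icc (-A) A →
        |(∫ t, f t ∂(empirical σ α φ (fun N => (N : ℝ) ^ 2 * S σ α 1 N) N)) -
          4 * π ^ 2 / absDisc K * f 0| ≤
        C * ((N : ℝ) ^ (α - 1) * supNorm f + φ N / (N : ℝ) ^ (1 - α) * supNorm (deriv f)) := by
  have hω := omega_im_pos (K := K)
  obtain ⟨C, hC, h⟩ := exists_abs_pairSum_sub_mul_apply_zero_le hω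
    (fun c hc => one_le_norm_lat hK σ hc) (ε := 1 - α) (by linarith) (by linarith)
  refine ⟨2 * C * π, by positivity, ?_⟩
  filter_upwards [eventually_ge_atTop 1, eventually_le_rpow hα (4 * cellDiam (omega K))]
    with N hN hR A hA f hf hs
  have hc := hasCompactSupport_of_tsupport_subset hs
  have hn1 : (1 : ℝ) ≤ N := by exact_mod_cast hN
  have hn : (0 : ℝ) < N := by linarith
  have hκ := hφ N hN
  have hcard := sq_le_card_ballPts hω hR
  have hR1 : 1 ≤ (N : ℝ) ^ α := Real.one_le_rpow hn1 hα.le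
  have hRN : (N : ℝ) ^ α ≤ N := by
    calc (N : ℝ) ^ α ≤ (N : ℝ) ^ (1 : ℝ) := Real.rpow_le_rpow_of_exponent_le hn1 hα1.le
      _ = N := Real.rpow_one _
  have hpow : (N : ℝ) ^ α * (N : ℝ) ^ (1 - α) = N := by
    rw [← Real.rpow_add hn, add_sub_cancel, Real.rpow_one]
  have hpow2 : (N : ℝ) ^ (α - 1) = (N : ℝ) ^ α / N := by
    rw [Real.rpow_sub hn, Real.rpow_one]
  have hmain := h N ((N : ℝ) ^ α) (φ N) (supNorm f) (supNorm (deriv f)) f hR1 hRN hκ.le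
    (supNorm_nonneg _) (supNorm_nonneg _) hf.continuous (abs_le_supNorm hf.continuous hc)
    (abs_sub_le_supNorm_deriv hf hc)
  have hS := S_one_eq hK σ α N
  rw [div_rpow_one_sub hN, hpow2]
  set R := (N : ℝ) ^ α
  set c := ((ballPts (omega K) R).card : ℝ)
  have hb : (0 : ℝ) < N ^ 2 * (R ^ 2 / π) := by positivity
  have hψ : (N : ℝ) ^ 2 * (R ^ 2 / π) ≤ (N : ℝ) ^ 2 * S σ α 1 N := by
    rw [hS, div_mul_eq_mul_div]
    gcongr
  rw [integral_empirical hK σ α φ _ N (hb.trans_le hψ) f]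
  have e : π * (N : ℝ) ^ 2 / (omega K).im * c * f 0 =
      (N : ℝ) ^ 2 * S σ α 1 N * (4 * π ^ 2 / absDisc K * f 0) := by
    rw [hS, absDisc_eq]
    field_simp
  rw [e] at hmain
  refine (abs_one_div_mul_sub_le hb hψ hmain).trans ?_
  have hF := supNorm_nonneg f
  have hF' := supNorm_nonneg (deriv f)
  set F := supNorm f
  set F' := supNorm (deriv f)
  -- The choice `ε = 1 - α` gives `R N^ε = N`, so the two error terms in `F'` coincide.
  have e2 : F' * φ N * R ^ 4 * (N : ℝ) ^ (1 - α) = F' * φ N * R ^ 3 * N := by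
    linear_combination (F' * φ N * R ^ 3) * hpow
  have e3 : C * (F * N * R ^ 3 + F' * φ N * R ^ 4 * (N : ℝ) ^ (1 - α) + F' * φ N * R ^ 3 * N) /
      (N ^ 2 * (R ^ 2 / π)) = C * π * (R / N * F + 2 * (φ N * R / N * F')) := by
    rw [e2]; field_simp; ring
  rw [e3]
  have : 0 ≤ C * π * (R / N * F) := by positivity
  linarith

theorem exists_rate_large (hK : Module.finrank ℚ K = 2) [NumberField.IsTotallyComplex K]
    (σ : K →+* ℂ) (hα : 0 < α) (hα1 : α < 1) (φ : ℕ → ℝ) (hφ : ∀ N : ℕ, 0 < N → 0 < φ N)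
    {ε : ℝ} (hε : 0 < ε) (hε1 : ε ≤ 1) :
    ∃ C : ℝ, 0 < C ∧ ∀ᶠ N in atTop, ∀ A : ℝ, 1 ≤ A → ∀ f : ℝ → ℝ, ContDiff ℝ 1 f →
      tsupport f ⊆ Icc (-A) A →
        |(∫ t, f t ∂(empirical σ α φ (fun N => (N : ℝ) ^ 3 * S σ α 0 N / φ N) N)) -
          ∫ t, f t ∂(limitMeasure K ⊤)| ≤
        C * ((A ^ 3 * (φ N / (N : ℝ) ^ (1 - α)) ^ (-(2 / 3) : ℝ) +
            φ N / (N : ℝ) ^ (1 - α) * (N : ℝ) ^ (α - 1)) * supNorm f +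
          (φ N / (N : ℝ) ^ (1 - α)) ^ 2 * (N : ℝ) ^ (α - 1 + ε) * supNorm (deriv f)) := by
  have hω := omega_im_pos (K := K)
  obtain ⟨C, hC, h⟩ := exists_abs_pairSum_sub_mul_integral_le hω
    (fun c hc => one_le_norm_lat hK σ hc) hε hε1
  refine ⟨C * (2 * π), by positivity, ?_⟩
  filter_upwards [eventually_ge_atTop 1, eventually_le_rpow hα (4 * cellDiam (omega K))]
    with N hN hR A hA f hf hs
  have hc := hasCompactSupport_of_tsupport_subset hs
  have hn1 : (1 : ℝ) ≤ N := by exact_mod_cast hN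
  have hn : (0 : ℝ) < N := by linarith
  have hκ := hφ N hN
  have hcard := sq_le_card_ballPts hω hR
  have hR1 : 1 ≤ (N : ℝ) ^ α := Real.one_le_rpow hn1 hα.le
  have hRN : (N : ℝ) ^ α ≤ N := by
    calc (N : ℝ) ^ α ≤ (N : ℝ) ^ (1 : ℝ) := Real.rpow_le_rpow_of_exponent_le hn1 hα1.le
      _ = N := Real.rpow_one _
  have hpow2 : (N : ℝ) ^ (α - 1) = (N : ℝ) ^ α / N := by
    rw [Real.rpow_sub hn, Real.rpow_one]
  have hmain := h N ((N : ℝ) ^ α) (φ N) (supNorm f) (supNorm (deriv f)) A f hR1 hRN hκ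
    (supNorm_nonneg _) (supNorm_nonneg _) (by linarith) hf.continuous
    (abs_le_supNorm hf.continuous hc)
    (abs_sub_le_supNorm_deriv hf hc) (eq_zero_of_tsupport_subset hs)
  have hS := S_zero_eq hK σ α N
  rw [Real.rpow_add hn, div_rpow_one_sub hN, hpow2]
  set R := (N : ℝ) ^ α
  have hR0 : 0 < R := by linarith
  -- Each of the at least `R²/Im ω_K` terms is at least `1/R`; this bounds the normalisation from
  -- below.
  have hsum : R ≤ (omega K).im * ∑ c ∈ ballPts (omega K) R, 1 / ‖lat (omega K) c‖ := by
    have h1 : (ballPts (omega K) R).card • (1 / R) ≤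
        ∑ c ∈ ballPts (omega K) R, 1 / ‖lat (omega K) c‖ := by
      refine Finset.card_nsmul_le_sum _ _ _ fun c hc => ?_
      have := one_le_norm_lat hK σ ((mem_ballPts hω).1 hc).1
      exact one_div_le_one_div_of_le (by linarith) ((mem_ballPts hω).1 hc).2
    rw [nsmul_eq_mul] at h1
    refine le_trans ?_ (mul_le_mul_of_nonneg_left h1 hω.le)
    rw [← mul_assoc, mul_one_div, le_div_iff₀ hR0]
    linarith
  set s₀ := ∑ c ∈ ballPts (omega K) R, 1 / ‖lat (omega K) c‖
  have hb : (0 : ℝ) < N ^ 3 * (R / (2 * π)) / φ N := by positivity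
  have hψ : (N : ℝ) ^ 3 * (R / (2 * π)) / φ N ≤ (N : ℝ) ^ 3 * S σ α 0 N / φ N := by
    rw [hS, div_mul_eq_mul_div]
    gcongr
  rw [integral_empirical hK σ α φ _ N (hb.trans_le hψ) f]
  have e : (N : ℝ) ^ 3 / (3 * φ N * (omega K).im) * s₀ * ∫ t, f t =
      (N : ℝ) ^ 3 * S σ α 0 N / φ N * ∫ t, f t ∂(limitMeasure K ⊤) := by
    have hD := absDisc_pos (K := K)
    rw [limitMeasure, if_neg ENNReal.top_ne_zero, if_pos rfl, integral_smul_measure,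
      ENNReal.toReal_ofReal (by positivity), smul_eq_mul, hS, absDisc_eq]
    field_simp
    ring
  rw [e] at hmain
  refine (abs_one_div_mul_sub_le hb hψ hmain).trans ?_
  have hF := supNorm_nonneg f
  have hF' := supNorm_nonneg (deriv f)
  set F := supNorm f
  set F' := supNorm (deriv f)
  have hA0 : 0 < A := by linarith
  -- In terms of `X = φ(N) R / N` the powers `5/3` and `1/3` of `R` recombine to `R²`. Division by
  -- `N R / φ(N) = R² / X` leaves `X^(-2/3)`.
  have e4 : (A * N / φ N) ^ (5 / 3 : ℝ) * R ^ (1 / 3 : ℝ) =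
      N * R / φ N * (A ^ (5 / 3 : ℝ) * (φ N * R / N) ^ (-(2 / 3) : ℝ)) := by
    set X := φ N * R / N with hX
    have hX0 : 0 < X := by positivity
    have a1 : A * N / φ N = A * R * X⁻¹ := by rw [hX]; field_simp
    have a2 : N * R / φ N = R ^ 2 * X⁻¹ := by rw [hX]; field_simp
    have a3 : R ^ (5 / 3 : ℝ) * R ^ (1 / 3 : ℝ) = R ^ 2 := by
      rw [← Real.rpow_add hR0, ← Real.rpow_two]; norm_num
    have a4 : (X ^ (5 / 3 : ℝ))⁻¹ = X⁻¹ * X ^ (-(2 / 3) : ℝ) := by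
      rw [← Real.rpow_neg hX0.le, ← Real.rpow_neg_one, ← Real.rpow_add hX0]; norm_num
    rw [a1, a2, Real.mul_rpow (by positivity) (by positivity), Real.mul_rpow hA0.le hR0.le,
      Real.inv_rpow hX0.le, a4, ← a3]
    ring
  have e3 : C * (F * N * R ^ 3 + F' * φ N * R ^ 4 * (N : ℝ) ^ ε +
      F * N ^ 2 * (A * N / φ N) ^ (5 / 3 : ℝ) * R ^ (1 / 3 : ℝ)) /
      (N ^ 3 * (R / (2 * π)) / φ N) = C * (2 * π) *
        ((A ^ (5 / 3 : ℝ) * (φ N * R / N) ^ (-(2 / 3) : ℝ) + φ N * R / N * (R / N)) * F +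
        (φ N * R / N) ^ 2 * (R / N * (N : ℝ) ^ ε) * F') := by
    rw [mul_assoc (F * (N : ℝ) ^ 2), e4]
    generalize (φ N * R / N) ^ (-(2 / 3) : ℝ) = Y
    field_simp
    ring
  have e5 : A ^ (5 / 3 : ℝ) ≤ A ^ 3 := by
    rw [← Real.rpow_natCast A 3]
    exact Real.rpow_le_rpow_of_exponent_le hA (by norm_num)
  rw [e3]
  gcongr

/-- The main term keeps the finite scale `X = φ(N)/N^(1-α)`; replacing it by its limit is a separate
estimate, responsible for the `δ_N` term. -/
theorem exists_rate_intermediate (hK : Module.finrank ℚ K = 2) [NumberField.IsTotallyComplex K]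
    (σ : K →+* ℂ) (hα : 0 < α) (hα1 : α < 1) (φ : ℕ → ℝ) (hφ : ∀ N : ℕ, 0 < N → 0 < φ N)
    {ε : ℝ} (hε : 0 < ε) (hε1 : ε ≤ 1) :
    ∃ C : ℝ, 0 < C ∧ ∀ᶠ N in atTop, ∀ A : ℝ, 1 ≤ A → ∀ f : ℝ → ℝ, ContDiff ℝ 1 f →
      tsupport f ⊆ Icc (-A) A →
        |(∫ t, f t ∂(empirical σ α φ (fun N => (N : ℝ) ^ (3 + α) / φ N) N)) -
          8 * π / absDisc K * ∫ t, f t * profile (t / (2 * (φ N / (N : ℝ) ^ (1 - α))))| ≤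
        C * ((φ N / (N : ℝ) ^ (1 - α) * (N : ℝ) ^ (α - 1) +
            φ N / (N : ℝ) ^ (1 - α) * (N : ℝ) ^ (-α)) * supNorm f +
          ((φ N / (N : ℝ) ^ (1 - α)) ^ 2 * (N : ℝ) ^ (α - 1 + ε) +
            (φ N / (N : ℝ) ^ (1 - α)) ^ 2 * (N : ℝ) ^ (-α)) * supNorm (deriv f)) := by
  have hω := omega_im_pos (K := K)
  obtain ⟨C, hC, h⟩ := exists_abs_pairSum_sub_mul_integral_profile_le hω
    (fun c hc => one_le_norm_lat hK σ hc) hε hε1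
  refine ⟨C, by positivity, ?_⟩
  filter_upwards [eventually_ge_atTop 1] with N hN A hA f hf hs
  have hc := hasCompactSupport_of_tsupport_subset hs
  have hn1 : (1 : ℝ) ≤ N := by exact_mod_cast hN
  have hn : (0 : ℝ) < N := by linarith
  have hκ := hφ N hN
  have hR1 : 1 ≤ (N : ℝ) ^ α := Real.one_le_rpow hn1 hα.le
  have hRN : (N : ℝ) ^ α ≤ N := by
    calc (N : ℝ) ^ α ≤ (N : ℝ) ^ (1 : ℝ) := Real.rpow_le_rpow_of_exponent_le hn1 hα1.le
      _ = N := Real.rpow_one _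
  have hpow2 : (N : ℝ) ^ (α - 1) = (N : ℝ) ^ α / N := by
    rw [Real.rpow_sub hn, Real.rpow_one]
  have hpow3 : (N : ℝ) ^ (3 + α) = (N : ℝ) ^ 3 * (N : ℝ) ^ α := by
    rw [Real.rpow_add hn]; norm_cast
  have hmain := h N ((N : ℝ) ^ α) (φ N) (supNorm f) (supNorm (deriv f)) A f hR1 hRN hκ
    (supNorm_nonneg _) (supNorm_nonneg _) hf.continuous
    (abs_le_supNorm hf.continuous hc)
    (abs_sub_le_supNorm_deriv hf hc) (eq_zero_of_tsupport_subset hs)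
  have hψ : 0 < (N : ℝ) ^ (3 + α) / φ N := by positivity
  rw [integral_empirical hK σ α φ _ N hψ f]
  simp only [hpow3] at hψ ⊢
  rw [Real.rpow_add hn, div_rpow_one_sub hN, hpow2, Real.rpow_neg hn.le]
  set R := (N : ℝ) ^ α
  have hR0 : 0 < R := by linarith
  have e : 2 * π * (N : ℝ) ^ 3 * R / (φ N * (omega K).im ^ 2) *
        (∫ t, f t * profile (t / (2 * (φ N * R / N)))) =
      (N : ℝ) ^ 3 * R / φ N * (8 * π / absDisc K * ∫ t, f t * profile (t / (2 * (φ N * R / N)))) := by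
    rw [absDisc_eq]
    field_simp
    ring
  rw [e] at hmain
  refine (abs_one_div_mul_sub_le hψ le_rfl hmain).trans (le_of_eq ?_)
  field_simp
  ring

end Rates

/-! ### The five regimes -/

section Regimes

theorem tendsto_toReal_of_tendsto_ofReal {u : ℕ → ℝ} {a : ℝ≥0∞} (ha : a ≠ ⊤)
    (hu : ∀ᶠ N in atTop, 0 ≤ u N) (h : Tendsto (fun N => ENNReal.ofReal (u N)) atTop (𝓝 a)) :
    Tendsto u atTop (𝓝 a.toReal) := by
  refine ((ENNReal.tendsto_toReal ha).comp h).congr' ?_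
  filter_upwards [hu] with N hN
  exact ENNReal.toReal_ofReal hN

theorem div_rpow_eq {x a b n : ℝ} (hn : 0 < n) : x / n ^ b = x / n ^ a * n ^ (a - b) := by
  rw [Real.rpow_sub hn]
  field_simp

variable {K : Type*} [Field K] [NumberField K]

theorem integral_limitMeasure_zero (f : ℝ → ℝ) :
    ∫ t, f t ∂(limitMeasure K 0) = 4 * π ^ 2 / absDisc K * f 0 := by
  have hD := absDisc_pos (K := K)
  rw [limitMeasure, if_pos rfl, integral_smul_measure, ENNReal.toReal_ofReal (by positivity),
    integral_dirac, smul_eq_mul]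

theorem profile_abs (x : ℝ) : profile |x| = profile x := by
  unfold profile
  simp only [mul_pow, sq_abs]

theorem integral_limitMeasure {l : ℝ≥0∞} (h0 : 0 < l) (htop : l < ⊤) (f : ℝ → ℝ) :
    ∫ t, f t ∂(limitMeasure K l) =
      8 * π / absDisc K * ∫ t, f t * profile (t / (2 * l.toReal)) := by
  have hD := absDisc_pos (K := K)
  have hl : 0 < l.toReal := ENNReal.toReal_pos h0.ne' htop.ne
  have hrho : ∀ t, rho K l.toReal t = 8 * π / absDisc K * profile (t / (2 * l.toReal)) := by
    intro t
    rw [rho_eq K hl, ← profile_abs (t / _), abs_div, abs_of_pos (by positivity : 0 < 2 * l.toReal)]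
  have hm : Measurable fun t => ENNReal.ofReal (rho K l.toReal t) := by
    simp_rw [hrho]
    exact (((continuous_profile.comp (continuous_id.div_const _)).const_mul _).measurable).ennreal_ofReal
  rw [limitMeasure, if_neg h0.ne', if_neg htop.ne,
    integral_withDensity_eq_integral_toReal_smul hm (by simp), ← integral_const_mul]
  congr 1
  ext t
  have : 0 ≤ profile (t / (2 * l.toReal)) := profile_nonneg _
  rw [hrho, ENNReal.toReal_ofReal (by positivity), smul_eq_mul]
  ring

variable (hK : Module.finrank ℚ K = 2) [NumberField.IsTotallyComplex K]
  (σ : K →+* ℂ) {α : ℝ} (hα : 0 < α) (hα1 : α < 1 / 2) (φ : ℕ → ℝ) (hφ : ∀ N : ℕ, 0 < N → 0 < φ N)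

include hK hα hα1 hφ

theorem hasErrorTerm_of_limit_zero (hφ1 : ∀ᶠ N in atTop, 1 ≤ φ N)
    (hl : Tendsto (fun N : ℕ => ENNReal.ofReal (φ N / (N : ℝ) ^ (1 - α))) atTop (𝓝 0)) (γ : ℝ) :
    HasErrorTerm (empirical σ α φ (fun N => (N : ℝ) ^ 2 * S σ α 1 N)) (limitMeasure K 0)
      (fun N _ F F' => (φ N / (N : ℝ) ^ (1 - α)) ^ (1 / 2 : ℝ) * F'
            + max (φ N / (N : ℝ) ^ (1 - α)) (1 / (N : ℝ) ^ (2 * γ)) * F) := by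
  apply hasErrorTerm_of_eventually
    (fun N _ F F' => (N : ℝ) ^ (α - 1) * F + φ N / (N : ℝ) ^ (1 - α) * F')
  · obtain ⟨C, hC, h⟩ := exists_rate_small hK σ hα (by linarith) φ hφ
    refine ⟨C, hC, h.mono fun N hN A hA f hf hs => ?_⟩
    rw [integral_limitMeasure_zero]
    exact hN A hA f hf hs
  · refine ⟨1, ?_⟩
    have hX0 : ∀ᶠ N : ℕ in atTop, 0 ≤ φ N / (N : ℝ) ^ (1 - α) := by
      filter_upwards [eventually_ge_atTop 1] with N hN
      have := hφ N hN
      positivity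
    have hX := tendsto_toReal_of_tendsto_ofReal ENNReal.zero_ne_top hX0 hl
    rw [ENNReal.toReal_zero] at hX
    filter_upwards [hX0, hX.eventually_le_const one_pos, hφ1, eventually_ge_atTop 1]
      with N h0 h1 h2 hN A F F' hA hF hF'
    have hn : (0 : ℝ) < N := by exact_mod_cast hN
    -- This is where `φ(N) ≥ 1` enters; the next bound uses that the ratio is eventually at most 1.
    have e1 : (N : ℝ) ^ (α - 1) ≤ φ N / (N : ℝ) ^ (1 - α) := by
      rw [← neg_sub 1 α, Real.rpow_neg hn.le, inv_eq_one_div]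
      gcongr
    have e2 : φ N / (N : ℝ) ^ (1 - α) ≤ (φ N / (N : ℝ) ^ (1 - α)) ^ (1 / 2 : ℝ) := by
      have := Real.rpow_le_rpow_of_exponent_ge' h0 h1 (by norm_num : (0 : ℝ) ≤ 1 / 2)
        (by norm_num : (1 / 2 : ℝ) ≤ 1)
      rwa [Real.rpow_one] at this
    rw [one_mul, add_comm]
    gcongr
    exact e1.trans (le_max_left _ _)

theorem hasErrorTerm_of_limit_pos {l : ℝ≥0∞} (h0 : 0 < l) (htop : l < ⊤)
    (hl : Tendsto (fun N : ℕ => ENNReal.ofReal (φ N / (N : ℝ) ^ (1 - α))) atTop (𝓝 l)) (γ : ℝ) :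
    HasErrorTerm (empirical σ α φ (fun N => (N : ℝ) ^ (3 + α) / φ N)) (limitMeasure K l)
      (fun N A F F' => (N : ℝ) ^ (-α) * F'
            + max (A / (N : ℝ) ^ (α / 4)) (1 / (N : ℝ) ^ (2 * γ)) * F
            + A * |(N : ℝ) ^ (1 - α) / φ N - 1 / l.toReal| ^ (1 / 2 : ℝ)
                * |Real.log (|(N : ℝ) ^ (1 - α) / φ N - 1 / l.toReal|)| * F) := by
  have hD := absDisc_pos (K := K)
  have hl0 : 0 < l.toReal := ENNReal.toReal_pos h0.ne' htop.ne
  set L := l.toReal with hL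
  have hX0 : ∀ᶠ N : ℕ in atTop, 0 < φ N / (N : ℝ) ^ (1 - α) := by
    filter_upwards [eventually_ge_atTop 1] with N hN
    have := hφ N hN
    have hn : (0 : ℝ) < N := by exact_mod_cast hN
    positivity
  have hX : Tendsto (fun N : ℕ => φ N / (N : ℝ) ^ (1 - α)) atTop (𝓝 L) :=
    tendsto_toReal_of_tendsto_ofReal htop.ne (hX0.mono fun _ h => h.le) hl
  have hδ : Tendsto (fun N : ℕ => |(N : ℝ) ^ (1 - α) / φ N - 1 / L|) atTop (𝓝 0) := by
    have h1 := ((hX.inv₀ hl0.ne').sub_const (1 / L)).abs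
    rw [inv_eq_one_div, sub_self, abs_zero] at h1
    simpa only [inv_div] using h1
  apply hasErrorTerm_of_eventually (fun N A F F' =>
    ((φ N / (N : ℝ) ^ (1 - α) * (N : ℝ) ^ (α - 1) +
            φ N / (N : ℝ) ^ (1 - α) * (N : ℝ) ^ (-α)) * F +
          ((φ N / (N : ℝ) ^ (1 - α)) ^ 2 * (N : ℝ) ^ (α - 1 + (1 - 2 * α)) +
            (φ N / (N : ℝ) ^ (1 - α)) ^ 2 * (N : ℝ) ^ (-α)) * F') +
      A * √(L * |(N : ℝ) ^ (1 - α) / φ N - 1 / L|) * F)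
  -- `ε = 1 - 2α`, positive because `α < 1/2`, makes `N^(α-1+ε)` equal to `N^(-α)`.
  · obtain ⟨C, hC, h⟩ := exists_rate_intermediate hK σ hα (by linarith) φ hφ (ε := 1 - 2 * α)
      (by linarith) (by linarith)
    refine ⟨C + 8 * π / absDisc K * 8, by positivity, ?_⟩
    filter_upwards [h, hX0, hδ.eventually_le_const (by positivity : 0 < 1 / (2 * L))]
      with N hN hx hδN A hA f hf hs
    have hc := hasCompactSupport_of_tsupport_subset hs
    have hF := abs_le_supNorm hf.continuous hc
    have hF0 := supNorm_nonneg f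
    have hF0' := supNorm_nonneg (deriv f)
    have h1 := hN A hA f hf hs
    have hinv : (N : ℝ) ^ (1 - α) / φ N = 1 / (φ N / (N : ℝ) ^ (1 - α)) := (one_div_div _ _).symm
    rw [integral_limitMeasure h0 htop]
    rw [hinv] at hδN ⊢
    set X := φ N / (N : ℝ) ^ (1 - α) with hXdef
    set δ := |1 / X - 1 / L|
    have hδ0 : 0 ≤ δ := abs_nonneg _
    -- Chosen so that `1 + θ = L/X`: passing from scale `L` to scale `X` multiplies the argument of
    -- `profile` by `1 + θ`.
    set θ := L * (1 / X - 1 / L) with hθ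
    have hθabs : |θ| = L * δ := by rw [hθ, abs_mul, abs_of_pos hl0]
    have hθ2 : |θ| ≤ 1 / 2 := by
      rw [hθabs]
      calc L * δ ≤ L * (1 / (2 * L)) := by gcongr
        _ = 1 / 2 := by field_simp
    have harg : ∀ t : ℝ, t / (2 * X) = (1 + θ) * (t / (2 * L)) := by
      intro t
      rw [hθ]; field_simp; ring
    have hi : ∀ x : ℝ, Integrable fun t => f t * profile (t / (2 * x)) := fun x =>
      (hf.continuous.mul (continuous_profile.comp (continuous_id.div_const _))).integrable_of_hasCompactSupport
        hc.mul_right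
    have h2 : |(∫ t, f t * profile (t / (2 * X))) - ∫ t, f t * profile (t / (2 * L))| ≤
        8 * (A * √(L * δ) * supNorm f) := by
      rw [← integral_sub (hi X) (hi L)]
      have hzero : ∀ t, t ∉ Icc (-A) A →
          f t * profile (t / (2 * X)) - f t * profile (t / (2 * L)) = 0 := by
        intro t ht
        rw [mem_Icc, ← abs_le, not_le] at ht
        rw [eq_zero_of_tsupport_subset hs t ht]; ring
      rw [← setIntegral_eq_integral_of_forall_compl_eq_zero hzero, ← Real.norm_eq_abs]
      refine (norm_setIntegral_le_of_norm_le_const (C := supNorm f * (4 * √(L * δ)))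
        (by simp) ?_).trans (le_of_eq ?_)
      · intro t _
        rw [← mul_sub, norm_mul, harg, Real.norm_eq_abs, Real.norm_eq_abs]
        have := abs_profile_sub_le (t / (2 * L)) hθ2
        rw [hθabs] at this
        exact mul_le_mul (hF t) this (abs_nonneg _) hF0
      · rw [Real.volume_real_Icc_of_le (by linarith)]; ring
    have h3 : |8 * π / absDisc K * (∫ t, f t * profile (t / (2 * X))) -
        8 * π / absDisc K * ∫ t, f t * profile (t / (2 * L))| ≤
        8 * π / absDisc K * 8 * (A * √(L * δ) * supNorm f) := by
      rw [← mul_sub, abs_mul, abs_of_pos (by positivity), mul_assoc (8 * π / absDisc K)]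
      exact mul_le_mul_of_nonneg_left h2 (by positivity)
    refine (abs_sub_le _ _ _).trans ((add_le_add h1 h3).trans ?_)
    have t1 : 0 ≤ C * (A * √(L * δ) * supNorm f) := by positivity
    have t2 : 0 ≤ 8 * π / absDisc K * 8 * ((X * (N : ℝ) ^ (α - 1) + X * (N : ℝ) ^ (-α)) * supNorm f +
          (X ^ 2 * (N : ℝ) ^ (α - 1 + (1 - 2 * α)) + X ^ 2 * (N : ℝ) ^ (-α)) *
            supNorm (deriv f)) := by
      positivity
    linarith
  · refine ⟨2 * (L + 1) + 2 * (L + 1) ^ 2 + √L, ?_⟩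
    filter_upwards [hX0, hX.eventually_le_const (lt_add_one L),
      hδ.eventually_le_const (Real.exp_pos (-1)), eventually_ge_atTop 1]
      with N hx hXL hδN hN A F F' hA hF hF'
    have hn1 : (1 : ℝ) ≤ N := by exact_mod_cast hN
    have hn : (0 : ℝ) < N := by linarith
    set X := φ N / (N : ℝ) ^ (1 - α)
    set δ := |(N : ℝ) ^ (1 - α) / φ N - 1 / L|
    have hδ0 : 0 ≤ δ := abs_nonneg _
    have e1 : (N : ℝ) ^ (α - 1) ≤ (N : ℝ) ^ (-α) :=
      Real.rpow_le_rpow_of_exponent_le hn1 (by linarith)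
    have e2 : (N : ℝ) ^ (α - 1 + (1 - 2 * α)) = (N : ℝ) ^ (-α) := by congr 1; ring
    have e3 : (N : ℝ) ^ (-α) ≤ max (A / (N : ℝ) ^ (α / 4)) (1 / (N : ℝ) ^ (2 * γ)) := by
      refine le_trans ?_ (le_max_left _ _)
      have : (N : ℝ) ^ (-α) ≤ (N : ℝ) ^ (-(α / 4)) :=
        Real.rpow_le_rpow_of_exponent_le hn1 (by linarith)
      rw [Real.rpow_neg hn.le (α / 4), inv_eq_one_div] at this
      exact this.trans (by gcongr)
    -- Eventually `δ ≤ e⁻¹`, hence `|ln δ| ≥ 1` and the logarithmic factor only enlarges the bound.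
    -- For `δ = 0` both sides vanish.
    have e4 : √(L * δ) ≤ √L * (δ ^ (1 / 2 : ℝ) * |Real.log δ|) := by
      rw [Real.sqrt_mul hl0.le, ← Real.sqrt_eq_rpow]
      refine mul_le_mul_of_nonneg_left ?_ (Real.sqrt_nonneg _)
      rcases hδ0.eq_or_lt with h | h
      · rw [← h]; simp
      · refine le_mul_of_one_le_right (Real.sqrt_nonneg _) ?_
        have := Real.log_le_log h hδN
        rw [Real.log_exp] at this
        rw [abs_of_neg (by linarith)]
        linarith
    rw [e2]
    set n₁ := (N : ℝ) ^ (-α)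
    set m := max (A / (N : ℝ) ^ (α / 4)) (1 / (N : ℝ) ^ (2 * γ))
    have hn₁ : 0 ≤ n₁ := by positivity
    have hm0 : 0 ≤ m := hn₁.trans e3
    set D := δ ^ (1 / 2 : ℝ) * |Real.log δ|
    have hD0 : 0 ≤ D := by positivity
    have hX2 : X ^ 2 ≤ (L + 1) ^ 2 := pow_le_pow_left₀ hx.le hXL 2
    have f1 : (X * (N : ℝ) ^ (α - 1) + X * n₁) * F ≤ 2 * (L + 1) * (m * F) := by
      calc _ ≤ ((L + 1) * m + (L + 1) * m) * F := by
            gcongr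
            exact e1.trans e3
        _ = _ := by ring
    have f2 : (X ^ 2 * n₁ + X ^ 2 * n₁) * F' ≤ 2 * (L + 1) ^ 2 * (n₁ * F') := by
      calc _ ≤ ((L + 1) ^ 2 * n₁ + (L + 1) ^ 2 * n₁) * F' := by gcongr
        _ = _ := by ring
    have f3 : A * √(L * δ) * F ≤ √L * (A * D * F) := by
      calc _ ≤ A * (√L * D) * F := by gcongr
        _ = _ := by ring
    have g1 : 0 ≤ m * F := by positivity
    have g2 : 0 ≤ n₁ * F' := by positivity
    have g3 : 0 ≤ A * D * F := by positivity
    have g4 : A * δ ^ (1 / 2 : ℝ) * |Real.log δ| * F = A * D * F := by ring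
    rw [g4]
    have hs : 0 ≤ √L := Real.sqrt_nonneg _
    have p1 : 0 ≤ (2 * (L + 1) ^ 2 + √L) * (m * F) := by positivity
    have p2 : 0 ≤ (2 * (L + 1) + √L) * (n₁ * F') := by positivity
    have p3 : 0 ≤ (2 * (L + 1) + 2 * (L + 1) ^ 2) * (A * D * F) := by positivity
    linarith

theorem hasErrorTerm_of_limit_top (E : ℕ → ℝ → ℝ → ℝ → ℝ) {ε : ℝ} (hε : 0 < ε) (hε1 : ε ≤ 1)
    (hE : ∃ C : ℝ, ∀ᶠ N in atTop, ∀ A F F' : ℝ, 1 ≤ A → 0 ≤ F → 0 ≤ F' →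
      (A ^ 3 * (φ N / (N : ℝ) ^ (1 - α)) ^ (-(2 / 3) : ℝ) +
            φ N / (N : ℝ) ^ (1 - α) * (N : ℝ) ^ (α - 1)) * F +
          (φ N / (N : ℝ) ^ (1 - α)) ^ 2 * (N : ℝ) ^ (α - 1 + ε) * F' ≤ C * E N A F F') :
    HasErrorTerm (empirical σ α φ (fun N => (N : ℝ) ^ 3 * S σ α 0 N / φ N)) (limitMeasure K ⊤) E :=
  hasErrorTerm_of_eventually _ (exists_rate_large hK σ hα (by linarith) φ hφ hε hε1) hE

theorem hasErrorTerm_third {l' : ℝ≥0∞} (htop : l' < ⊤)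
    (hl' : Tendsto (fun N : ℕ => ENNReal.ofReal (φ N / (N : ℝ) ^ (1 - α / 2))) atTop (𝓝 l')) :
    HasErrorTerm (empirical σ α φ (fun N => (N : ℝ) ^ 3 * S σ α 0 N / φ N)) (limitMeasure K ⊤)
      (fun N A F F' => (N : ℝ) ^ ((5 * α - 2) / 4) * F'
            + max (A ^ 3 * ((N : ℝ) ^ (1 - α) / φ N) ^ (2 / 3 : ℝ))
                ((N : ℝ) ^ ((5 * α - 2) / 4)) * F) := by
  -- A finite `λ'` bounds `X = φ(N)/N^(1-α)` by a multiple of `N^(α/2)`. This `ε` solves `α + (α - 1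
  -- + ε) = (5α - 2)/4`, the stated exponent.
  apply hasErrorTerm_of_limit_top hK σ hα hα1 φ hφ _ (ε := 1 / 2 - 3 * α / 4) (by linarith)
    (by linarith)
  have hX0 : ∀ᶠ N : ℕ in atTop, 0 ≤ φ N / (N : ℝ) ^ (1 - α / 2) := by
    filter_upwards [eventually_ge_atTop 1] with N hN
    have := hφ N hN
    positivity
  have hX := tendsto_toReal_of_tendsto_ofReal htop.ne hX0 hl'
  set B := l'.toReal + 1
  have hB : 0 < B := by positivity
  refine ⟨1 + B + B ^ 2, ?_⟩
  filter_upwards [hX.eventually_le_const (lt_add_one _), eventually_ge_atTop 1]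
    with N hXB hN A F F' hA hF hF'
  have hn1 : (1 : ℝ) ≤ N := by exact_mod_cast hN
  have hn : (0 : ℝ) < N := by linarith
  have hκ := hφ N hN
  rw [div_rpow_eq hn (a := 1 - α)] at hXB
  have hinv : (N : ℝ) ^ (1 - α) / φ N = (φ N / (N : ℝ) ^ (1 - α))⁻¹ := (inv_div _ _).symm
  rw [hinv]
  have hx : 0 < φ N / (N : ℝ) ^ (1 - α) := by positivity
  set X := φ N / (N : ℝ) ^ (1 - α)
  have hXle : X ≤ B * (N : ℝ) ^ (α / 2) := by
    have : X = X * (N : ℝ) ^ (1 - α - (1 - α / 2)) * (N : ℝ) ^ (α / 2) := by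
      rw [mul_assoc, ← Real.rpow_add hn, show 1 - α - (1 - α / 2) + α / 2 = 0 by ring,
        Real.rpow_zero, mul_one]
    rw [this]
    exact mul_le_mul_of_nonneg_right hXB (by positivity)
  rw [Real.inv_rpow hx.le, ← Real.rpow_neg hx.le]
  set e := (5 * α - 2) / 4 with he
  have e1 : X * (N : ℝ) ^ (α - 1) ≤ B * (N : ℝ) ^ e := by
    calc _ ≤ B * (N : ℝ) ^ (α / 2) * (N : ℝ) ^ (α - 1) := by gcongr
      _ = B * (N : ℝ) ^ (α / 2 + (α - 1)) := by rw [mul_assoc, ← Real.rpow_add hn]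
      _ ≤ _ := by
        gcongr
        rw [he]; linarith
  have e2 : X ^ 2 * (N : ℝ) ^ (α - 1 + (1 / 2 - 3 * α / 4)) ≤ B ^ 2 * (N : ℝ) ^ e := by
    calc _ ≤ (B * (N : ℝ) ^ (α / 2)) ^ 2 * (N : ℝ) ^ (α - 1 + (1 / 2 - 3 * α / 4)) := by gcongr
      _ = B ^ 2 * (N : ℝ) ^ (α / 2 + α / 2 + (α - 1 + (1 / 2 - 3 * α / 4))) := by
        rw [mul_pow, Real.rpow_add hn (α / 2 + α / 2), Real.rpow_add hn (α / 2) (α / 2)]; ring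
      _ = _ := by congr 2; rw [he]; ring
  set m := max (A ^ 3 * X ^ (-(2 / 3) : ℝ)) ((N : ℝ) ^ e)
  have m1 : A ^ 3 * X ^ (-(2 / 3) : ℝ) ≤ m := le_max_left _ _
  have m2 : (N : ℝ) ^ e ≤ m := le_max_right _ _
  have m0 : 0 ≤ m := le_trans (by positivity) m2
  have f1 : (A ^ 3 * X ^ (-(2 / 3) : ℝ) + X * (N : ℝ) ^ (α - 1)) * F ≤ (1 + B) * (m * F) := by
    calc _ ≤ (m + B * m) * F := mul_le_mul_of_nonneg_right
            (add_le_add m1 (e1.trans (mul_le_mul_of_nonneg_left m2 hB.le))) hF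
      _ = _ := by ring
  have f2 : X ^ 2 * (N : ℝ) ^ (α - 1 + (1 / 2 - 3 * α / 4)) * F' ≤ B ^ 2 * ((N : ℝ) ^ e * F') := by
    rw [← mul_assoc]; gcongr
  have p1 : 0 ≤ B ^ 2 * (m * F) := by positivity
  have p2 : 0 ≤ (1 + B) * ((N : ℝ) ^ e * F') := by positivity
  linarith

theorem hasErrorTerm_fourth (hα2 : α ≤ 2 / 11)
    (hl'' : Tendsto (fun N : ℕ => ENNReal.ofReal (φ N / (N : ℝ))) atTop (𝓝 0)) :
    HasErrorTerm (empirical σ α φ (fun N => (N : ℝ) ^ 3 * S σ α 0 N / φ N)) (limitMeasure K ⊤)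
      (fun N A F F' => φ N / (N : ℝ) ^ (1 + α / 2) * F'
            + A ^ 3 * ((N : ℝ) ^ (1 - α / 2) / φ N) * F) := by
  -- Here `λ'' = 0` gives `X ≤ N^α`, and the derivative term then requires `ε ≤ 1 - 7α/2`, which
  -- `1/5` satisfies for `α ≤ 2/11`.
  apply hasErrorTerm_of_limit_top hK σ hα hα1 φ hφ _ (ε := 1 / 5) (by norm_num) (by norm_num)
  have hX0 : ∀ᶠ N : ℕ in atTop, 0 ≤ φ N / (N : ℝ) := by
    filter_upwards [eventually_ge_atTop 1] with N hN
    have := hφ N hN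
    positivity
  have hX := tendsto_toReal_of_tendsto_ofReal ENNReal.zero_ne_top hX0 hl''
  rw [ENNReal.toReal_zero] at hX
  refine ⟨2, ?_⟩
  filter_upwards [hX.eventually_le_const one_pos, eventually_ge_atTop 1]
    with N hXB hN A F F' hA hF hF'
  have hn1 : (1 : ℝ) ≤ N := by exact_mod_cast hN
  have hn : (0 : ℝ) < N := by linarith
  have hκ := hφ N hN
  have hmono : ∀ a b : ℝ, a ≤ b → (N : ℝ) ^ a ≤ (N : ℝ) ^ b := fun a b h =>
    Real.rpow_le_rpow_of_exponent_le hn1 h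
  have hinv : (N : ℝ) ^ (1 - α / 2) / φ N = (φ N / (N : ℝ) ^ (1 - α / 2))⁻¹ := (inv_div _ _).symm
  rw [hinv, div_rpow_eq hn (a := 1 - α) (b := 1 + α / 2), div_rpow_eq hn (a := 1 - α) (b := 1 - α / 2)]
  have hXle : φ N / (N : ℝ) ^ (1 - α) ≤ (N : ℝ) ^ α := by
    rw [div_rpow_one_sub hN, mul_div_right_comm]
    exact mul_le_of_le_one_left (by positivity) hXB
  have hx : 0 < φ N / (N : ℝ) ^ (1 - α) := by positivity
  set X := φ N / (N : ℝ) ^ (1 - α)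
  rw [mul_inv, ← Real.rpow_neg hn.le]
  -- Writing `X^(-2/3) = X⁻¹ X^(1/3)`, this bound converts the natural error into `N^(α/2)/X =
  -- N^(1-α/2)/φ(N)`.
  have e0 : X ^ (1 / 3 : ℝ) ≤ (N : ℝ) ^ (α / 2) := by
    calc X ^ (1 / 3 : ℝ) ≤ ((N : ℝ) ^ α) ^ (1 / 3 : ℝ) :=
          Real.rpow_le_rpow hx.le hXle (by norm_num)
      _ = (N : ℝ) ^ (α * (1 / 3)) := (Real.rpow_mul hn.le _ _).symm
      _ ≤ _ := hmono _ _ (by linarith)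
  have e1 : X ^ (-(2 / 3) : ℝ) ≤ X⁻¹ * (N : ℝ) ^ (-(1 - α - (1 - α / 2))) := by
    have : X ^ (-(2 / 3) : ℝ) = X⁻¹ * X ^ (1 / 3 : ℝ) := by
      rw [← Real.rpow_neg_one, ← Real.rpow_add hx]; norm_num
    rw [this, show -(1 - α - (1 - α / 2)) = α / 2 by ring]
    gcongr
  have e2 : X * (N : ℝ) ^ (α - 1) ≤ X⁻¹ * (N : ℝ) ^ (-(1 - α - (1 - α / 2))) := by
    rw [show -(1 - α - (1 - α / 2)) = α / 2 by ring, inv_mul_eq_div, le_div_iff₀ hx]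
    calc X * (N : ℝ) ^ (α - 1) * X ≤ (N : ℝ) ^ α * (N : ℝ) ^ (α - 1) * (N : ℝ) ^ α := by gcongr
      _ = (N : ℝ) ^ (α + (α - 1) + α) := by rw [Real.rpow_add hn, Real.rpow_add hn]
      _ ≤ _ := hmono _ _ (by linarith)
  have e3 : X ^ 2 * (N : ℝ) ^ (α - 1 + 1 / 5) ≤ X * (N : ℝ) ^ (1 - α - (1 + α / 2)) := by
    rw [pow_two, mul_assoc]
    refine mul_le_mul_of_nonneg_left ?_ hx.le
    calc X * (N : ℝ) ^ (α - 1 + 1 / 5) ≤ (N : ℝ) ^ α * (N : ℝ) ^ (α - 1 + 1 / 5) := by gcongr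
      _ = (N : ℝ) ^ (α + (α - 1 + 1 / 5)) := (Real.rpow_add hn _ _).symm
      _ ≤ _ := hmono _ _ (by linarith)
  set Y := X⁻¹ * (N : ℝ) ^ (-(1 - α - (1 - α / 2)))
  have hY : 0 ≤ Y := by positivity
  have hA3 : 1 ≤ A ^ 3 := one_le_pow₀ hA
  have f1 : (A ^ 3 * X ^ (-(2 / 3) : ℝ) + X * (N : ℝ) ^ (α - 1)) * F ≤ 2 * (A ^ 3 * Y * F) := by
    calc _ ≤ (A ^ 3 * Y + A ^ 3 * Y) * F := mul_le_mul_of_nonneg_right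
            (add_le_add (mul_le_mul_of_nonneg_left e1 (by positivity))
              (e2.trans (le_mul_of_one_le_left hY hA3))) hF
      _ = _ := by ring
  have f2 := mul_le_mul_of_nonneg_right e3 hF'
  have p : 0 ≤ X * (N : ℝ) ^ (1 - α - (1 + α / 2)) * F' := by positivity
  linarith

theorem hasErrorTerm_fifth (hα2 : α ≤ 2 / 11) {l'' : ℝ≥0∞} (h0 : 0 < l'')
    (hl'' : Tendsto (fun N : ℕ => ENNReal.ofReal (φ N / (N : ℝ))) atTop (𝓝 l''))
    (hl''' : Tendsto (fun N : ℕ => ENNReal.ofReal (φ N / (N : ℝ) ^ (1 + α / 2))) atTop (𝓝 0)) :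
    HasErrorTerm (empirical σ α φ (fun N => (N : ℝ) ^ 3 * S σ α 0 N / φ N)) (limitMeasure K ⊤)
      (fun N A F F' => φ N / (N : ℝ) ^ (1 + α / 2) * (F' + A ^ 3 * F)) := by
  -- Now `X` is only bounded by `N^(3α/2)`, through `λ''' = 0`. The derivative term requires `ε ≤ 1
  -- - 4α`, still true of `1/5`.
  apply hasErrorTerm_of_limit_top hK σ hα hα1 φ hφ _ (ε := 1 / 5) (by norm_num) (by norm_num)
  have hX0 : ∀ᶠ N : ℕ in atTop, 0 ≤ φ N / (N : ℝ) ^ (1 + α / 2) := by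
    filter_upwards [eventually_ge_atTop 1] with N hN
    have := hφ N hN
    positivity
  have hX := tendsto_toReal_of_tendsto_ofReal ENNReal.zero_ne_top hX0 hl'''
  rw [ENNReal.toReal_zero] at hX
  obtain ⟨c, hc0, hc⟩ : ∃ c : ℝ, 0 < c ∧ ∀ᶠ N : ℕ in atTop, c ≤ φ N / (N : ℝ) := by
    obtain ⟨c, hc0, hcl⟩ := ENNReal.lt_iff_exists_nnreal_btwn.1 h0
    refine ⟨c, by exact_mod_cast hc0, ?_⟩
    filter_upwards [hl''.eventually_const_lt hcl] with N hN
    have := (ENNReal.lt_ofReal_iff_toReal_lt ENNReal.coe_ne_top).1 hN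
    simpa using this.le
  refine ⟨2 + c ^ (-(5 / 3) : ℝ), ?_⟩
  filter_upwards [hX.eventually_le_const one_pos, hc, eventually_ge_atTop 1]
    with N hXB hcN hN A F F' hA hF hF'
  have hn1 : (1 : ℝ) ≤ N := by exact_mod_cast hN
  have hn : (0 : ℝ) < N := by linarith
  have hκ := hφ N hN
  have hmono : ∀ a b : ℝ, a ≤ b → (N : ℝ) ^ a ≤ (N : ℝ) ^ b := fun a b h =>
    Real.rpow_le_rpow_of_exponent_le hn1 h
  rw [div_rpow_eq hn (a := 1 - α)] at hXB
  rw [div_rpow_eq hn (a := 1 - α) (b := 1 + α / 2)]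
  have hcX : c * (N : ℝ) ^ α ≤ φ N / (N : ℝ) ^ (1 - α) := by
    rw [div_rpow_one_sub hN, mul_div_right_comm]
    gcongr
  have hx : 0 < φ N / (N : ℝ) ^ (1 - α) := by positivity
  set X := φ N / (N : ℝ) ^ (1 - α)
  rw [show 1 - α - (1 + α / 2) = -(3 * α / 2) by ring] at hXB ⊢
  have hXle : X ≤ (N : ℝ) ^ (3 * α / 2) := by
    rw [Real.rpow_neg hn.le, ← div_eq_mul_inv, div_le_one (by positivity)] at hXB
    exact hXB
  set Z := X * (N : ℝ) ^ (-(3 * α / 2)) with hZ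
  have hZ0 : 0 ≤ Z := by positivity
  -- From `λ'' > 0`, `X ≥ c N^α`. Thus `X^(-2/3) = X · X^(-5/3)` is at most `c^(-5/3) X N^(-5α/3)`,
  -- and `5/3 ≥ 3/2`.
  have e1 : X ^ (-(2 / 3) : ℝ) ≤ c ^ (-(5 / 3) : ℝ) * Z := by
    have h1 : X ^ (-(2 / 3) : ℝ) = X ^ (-(5 / 3) : ℝ) * X := by
      rw [← Real.rpow_add_one hx.ne']; norm_num
    have h2 : X ^ (-(5 / 3) : ℝ) ≤ (c * (N : ℝ) ^ α) ^ (-(5 / 3) : ℝ) :=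
      Real.rpow_le_rpow_of_nonpos (by positivity) hcX (by norm_num)
    have h3 : (c * (N : ℝ) ^ α) ^ (-(5 / 3) : ℝ) ≤ c ^ (-(5 / 3) : ℝ) * (N : ℝ) ^ (-(3 * α / 2)) := by
      rw [Real.mul_rpow hc0.le (by positivity), ← Real.rpow_mul hn.le]
      exact mul_le_mul_of_nonneg_left (hmono _ _ (by linarith)) (by positivity)
    rw [h1]
    calc _ ≤ c ^ (-(5 / 3) : ℝ) * (N : ℝ) ^ (-(3 * α / 2)) * X := by
          gcongr
          exact h2.trans h3
      _ = _ := by rw [hZ]; ring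
  have e2 : X * (N : ℝ) ^ (α - 1) ≤ Z := by
    rw [hZ]
    exact mul_le_mul_of_nonneg_left (hmono _ _ (by linarith)) hx.le
  have e3 : X ^ 2 * (N : ℝ) ^ (α - 1 + 1 / 5) ≤ Z := by
    rw [hZ, pow_two, mul_assoc]
    refine mul_le_mul_of_nonneg_left ?_ hx.le
    calc X * (N : ℝ) ^ (α - 1 + 1 / 5) ≤ (N : ℝ) ^ (3 * α / 2) * (N : ℝ) ^ (α - 1 + 1 / 5) := by
          gcongr
      _ = (N : ℝ) ^ (3 * α / 2 + (α - 1 + 1 / 5)) := (Real.rpow_add hn _ _).symm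
      _ ≤ _ := hmono _ _ (by linarith)
  have hA3 : 1 ≤ A ^ 3 := one_le_pow₀ hA
  set c' := c ^ (-(5 / 3) : ℝ)
  have hc' : 0 ≤ c' := by positivity
  have f1 : (A ^ 3 * X ^ (-(2 / 3) : ℝ) + X * (N : ℝ) ^ (α - 1)) * F ≤ (c' + 1) * (Z * (A ^ 3 * F)) := by
    calc _ ≤ (A ^ 3 * (c' * Z) + A ^ 3 * Z) * F := mul_le_mul_of_nonneg_right
            (add_le_add (mul_le_mul_of_nonneg_left e1 (by positivity))
              (e2.trans (le_mul_of_one_le_left hZ0 hA3))) hF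
      _ = _ := by ring
  have f2 := mul_le_mul_of_nonneg_right e3 hF'
  have p1 : 0 ≤ (1 + c') * (Z * F') := by positivity
  have p2 : 0 ≤ Z * (A ^ 3 * F) := by positivity
  rw [mul_add Z]
  linarith

end Regimes

/-! ### Comparison of the limits -/

section Limits

variable {α : ℝ} {φ : ℕ → ℝ} {l : ℝ≥0∞}

/-- A lower bound `φ(N) ≥ c N^b` with `b > 1 - α` forces `λ = ∞`. This identifies the limit measure
in the last two regimes, whose hypotheses do not mention `λ`. -/
theorem eq_top_of_div_rpow_le {b : ℝ} (hb : 1 - α < b) {c : ℝ} (hc0 : 0 < c)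
    (hc : ∀ᶠ N : ℕ in atTop, c ≤ φ N / (N : ℝ) ^ b)
    (hl : Tendsto (fun N : ℕ => ENNReal.ofReal (φ N / (N : ℝ) ^ (1 - α))) atTop (𝓝 l)) : l = ⊤ := by
  refine tendsto_nhds_unique hl ?_
  rw [ENNReal.tendsto_ofReal_nhds_top]
  have h1 : Tendsto (fun N : ℕ => c * (N : ℝ) ^ (b - (1 - α))) atTop atTop :=
    ((tendsto_rpow_atTop (by linarith)).comp tendsto_natCast_atTop_atTop).const_mul_atTop hc0
  refine tendsto_atTop_mono' _ ?_ h1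
  filter_upwards [hc, eventually_ge_atTop 1] with N hcN hN
  have hn : (0 : ℝ) < N := by exact_mod_cast hN
  rw [div_rpow_eq hn (a := b) (b := 1 - α)]
  gcongr

end Limits

end PairCorr

/-! ### Assembly of the five cases -/

theorem theorem4p1 (K : Type*) [Field K] [NumberField K]
    (hK : Module.finrank ℚ K = 2) [NumberField.IsTotallyComplex K] (σ : K →+* ℂ)
    (α : ℝ) (hα : 0 < α ∧ α < 1 / 2)
    (φ : ℕ → ℝ) (hφpos : ∀ N : ℕ, 0 < N → 0 < φ N) (hφ : Tendsto φ atTop atTop)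
    -- the limits of `φ(N) / N^{1-α}`, `φ(N) / N^{1-α/2}`, `φ(N) / N`, `φ(N) / N^{1+α/2}`
    (l l' l'' l''' : ℝ≥0∞)
    (hl : Tendsto (fun N : ℕ => ENNReal.ofReal (φ N / (N : ℝ) ^ (1 - α))) atTop (𝓝 l))
    (hl' : Tendsto (fun N : ℕ => ENNReal.ofReal (φ N / (N : ℝ) ^ (1 - α / 2))) atTop (𝓝 l'))
    (hl'' : Tendsto (fun N : ℕ => ENNReal.ofReal (φ N / (N : ℝ))) atTop (𝓝 l''))
    (hl''' : Tendsto (fun N : ℕ => ENNReal.ofReal (φ N / (N : ℝ) ^ (1 + α / 2))) atTop (𝓝 l'''))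
    (γ : ℝ) (hγ : 0 < γ ∧ γ < (1 - 2 * α) / 2)
    (hφγ : Tendsto (fun N : ℕ => φ N / (N : ℝ) ^ (2 - 2 * α - 2 * γ)) atTop (𝓝 0)) :
    -- first regime
    (l = 0 →
      PairCorr.HasErrorTerm
        (PairCorr.empirical σ α φ (fun N => (N : ℝ) ^ 2 * PairCorr.S σ α 1 N))
        (PairCorr.limitMeasure K l)
        (fun N _ F F' =>
          (φ N / (N : ℝ) ^ (1 - α)) ^ (1 / 2 : ℝ) * F'
            + max (φ N / (N : ℝ) ^ (1 - α)) (1 / (N : ℝ) ^ (2 * γ)) * F)) ∧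
    -- second regime
    (0 < l → l < ⊤ → 4 ∣ NumberField.discr K →
      PairCorr.HasErrorTerm
        (PairCorr.empirical σ α φ (fun N => (N : ℝ) ^ (3 + α) / φ N))
        (PairCorr.limitMeasure K l)
        (fun N A F F' =>
          (N : ℝ) ^ (-α) * F'
            + max (A / (N : ℝ) ^ (α / 4)) (1 / (N : ℝ) ^ (2 * γ)) * F
            + A * |(N : ℝ) ^ (1 - α) / φ N - 1 / l.toReal| ^ (1 / 2 : ℝ)
                * |Real.log (|(N : ℝ) ^ (1 - α) / φ N - 1 / l.toReal|)| * F)) ∧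
    -- third regime
    (l = ⊤ → l' < ⊤ → α < 2 / 5 →
      PairCorr.HasErrorTerm
        (PairCorr.empirical σ α φ (fun N => (N : ℝ) ^ 3 * PairCorr.S σ α 0 N / φ N))
        (PairCorr.limitMeasure K l)
        (fun N A F F' =>
          (N : ℝ) ^ ((5 * α - 2) / 4) * F'
            + max (A ^ 3 * ((N : ℝ) ^ (1 - α) / φ N) ^ (2 / 3 : ℝ))
                ((N : ℝ) ^ ((5 * α - 2) / 4)) * F)) ∧
    -- fourth regime
    (l' = ⊤ → l'' = 0 → α ≤ 2 / 11 →
      PairCorr.HasErrorTerm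
        (PairCorr.empirical σ α φ (fun N => (N : ℝ) ^ 3 * PairCorr.S σ α 0 N / φ N))
        (PairCorr.limitMeasure K l)
        (fun N A F F' =>
          φ N / (N : ℝ) ^ (1 + α / 2) * F'
            + A ^ 3 * ((N : ℝ) ^ (1 - α / 2) / φ N) * F)) ∧
    -- fifth regime
    (0 < l'' → l''' = 0 → α ≤ 2 / 11 →
      PairCorr.HasErrorTerm
        (PairCorr.empirical σ α φ (fun N => (N : ℝ) ^ 3 * PairCorr.S σ α 0 N / φ N))
        (PairCorr.limitMeasure K l)
        (fun N A F F' =>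
          φ N / (N : ℝ) ^ (1 + α / 2) * (F' + A ^ 3 * F))) := by
  obtain ⟨hα0, hα1⟩ := hα
  refine ⟨?_, ?_, ?_, ?_, ?_⟩
  · rintro rfl
    exact PairCorr.hasErrorTerm_of_limit_zero hK σ hα0 hα1 φ hφpos
      (hφ.eventually_ge_atTop 1) hl γ
  · intro h0 htop _
    exact PairCorr.hasErrorTerm_of_limit_pos hK σ hα0 hα1 φ hφpos h0 htop hl γ
  · rintro rfl htop _
    exact PairCorr.hasErrorTerm_third hK σ hα0 hα1 φ hφpos htop hl'
  · rintro rfl rfl hα2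
    have hltop : l = ⊤ := by
      rw [ENNReal.tendsto_ofReal_nhds_top] at hl'
      exact PairCorr.eq_top_of_div_rpow_le (by linarith) one_pos
        (hl'.eventually_ge_atTop 1) hl
    rw [hltop]
    exact PairCorr.hasErrorTerm_fourth hK σ hα0 hα1 φ hφpos hα2 hl''
  · rintro h0 rfl hα2
    have hltop : l = ⊤ := by
      obtain ⟨c, hc0, hcl⟩ := ENNReal.lt_iff_exists_nnreal_btwn.1 h0
      refine PairCorr.eq_top_of_div_rpow_le (b := 1) (c := c) (by linarith)
        (by exact_mod_cast hc0) ?_ hl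
      filter_upwards [hl''.eventually_const_lt hcl] with N hN
      have := (ENNReal.lt_ofReal_iff_toReal_lt ENNReal.coe_ne_top).1 hN
      rw [Real.rpow_one]
      simpa using this.le
    rw [hltop]
    exact PairCorr.hasErrorTerm_fifth hK σ hα0 hα1 φ hφpos hα2 h0 hl'' hl'''
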